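/- **Setting.** Let $\Gamma=\mathbb Z\gamma^1\oplus\dots\oplus\mathbb Z\gamma^m$ be a lattice with an integer skew-symmetric pairing, $\omega^{ab}=\langle\gamma^a,\gamma^b\rangle$, and let $\sigma:\Gamma\to\mathbb C^\times$ be a quadratic refinement, $\sigma_\gamma\sigma_{\gamma'}=(-1)^{\langle\gamma,\gamma'\rangle}\sigma_{\gamma+\gamma'}$. For $\gamma=\sum_a q_a\gamma^a$ and $z,\theta\in\mathbb C^m$ put $Z_\gamma=\sum_a q_az^a$ and $\theta_\gamma=\sum_a q_a\theta^a$. Let $\Omega:\Gamma\to\mathbb Z$ be the DT invariants, constant on the region considered, and $\bar\Omega(\gamma)=\sum_{d\mid\gamma}d^{-2}\,\Omega(\gamma/d)$ for $\gamma\ne0$. The BPS ray $\ell_\gamma=\{t: Z_\gamma/t\in i\mathbb R_{<0}\}$ is oriented from $0$ to $\infty$. Put $\mathcal X^{\rm sf}_\gamma(t)=\sigma_\gamma e^{2\pi i(\theta_\gamma-Z_\gamma/t)}$ and $$K_{\gamma\gamma'}(t,t')=\frac{\langle\gamma,\gamma'\rangle}{2\pi i}\,\frac{tt'}{t'-t}.$$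 A charge is active if its weight ($\bar\Omega$ in (A), $\Omega$ in (B)) is nonzero; in (C) the active charges are those of the given set $S$. In every part no two active charges with $\langle\gamma,\gamma'\rangle\neq0$ have positively proportional central charges anywhere in the region (no walls of marginal stability are met). **(A) Convergent solutions, rational invariants.** Let $D\subset\mathbb C^m\times\mathbb C^m$ be open, with $|Z_\gamma|>\varepsilon\|\gamma\|$ for all active $\gamma$, for some $\varepsilon>0$ (support property). For $(z,\theta)\in D$ let $\mathcal X_\gamma(t)$ solve, for active $\gamma$ and $t\in\ell_\gamma$, $$\mathcal X_\gamma(t)=\mathcal X^{\rm sf}_\gamma(t)\exp\Big[\sum_{\gamma'}\bar\Omega(\gamma')\int_{\ell_{\gamma'}}\frac{dt'}{t'^2}K_{\gamma\gamma'}(t,t')\,\mathcal X_{\gamma'}(t')\Big].$$ Assume that $\mathcal X_\gamma$ is holomorphic in $(z,\theta)$ (at the point $t=iZ_\gamma/s$ of the ray, for each fixed $s>0$) and differentiable in $t$ along $\ell_\gamma$, and that the sums and integrals over charges and rays converge absolutely and locally uniformly on $D$. That is, near each point of $D$ there are majorants, as functions of the ray parameters $s,s'$, independent of $(z,\theta)$,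 of $\mathcal X_\gamma$ and $t\partial_t\mathcal X_\gamma$ (one common majorant) and of $K_{\gamma\gamma'}(iZ_\gamma/s,iZ_{\gamma'}/s')/(Z_\gamma Z_{\gamma'})$, such that, with these majorants inserted, the sums over active charges of the integrals $|\bar\Omega(\gamma)|\int_0^\infty(1+s)\,ds\,(\cdot)$ of the first, and the double sums of the integrals $|\bar\Omega(\gamma)\bar\Omega(\gamma')|\int_0^\infty\!\!\int_0^\infty(1+s)\,ds\,ds'\,(\cdot)$ of the product of the first at $(\gamma,s)$, the second, and the first at $(\gamma',s')$, are finite. Then the Joyce and Plebański potentials $$F=\sum_\gamma\bar\Omega(\gamma)\int_{\ell_\gamma}\frac{dt}{t^2}Z_\gamma\mathcal X_\gamma(t),\qquad W=\frac1{2\pi i}\sum_\gamma\bar\Omega(\gamma)\int_{\ell_\gamma}\frac{dt}{t^2}\mathcal X_\gamma(t)\Big[1-\frac12\sum_{\gamma'}\bar\Omega(\gamma')\int_{\ell_{\gamma'}}\frac{dt'}{t'^2}K_{\gamma\gamma'}(t,t')\mathcal X_{\gamma'}(t')\Big]$$ and the $\partial_{\theta^c}W$ are holomorphic on $D$, and for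 the differential $d$ in the variables $z$ $$dF=\frac1{(2\pi i)^2}\sum_{a,b,c}\omega^{ab}\,\partial_{\theta^a}F\,\partial_{\theta^b}\partial_{\theta^c}W\,dz^c .\tag{1}$$ If moreover $D=U\times V$ with $V$ invariant under real translations and the $\mathcal X_\gamma$ (for active $\gamma$, on $\ell_\gamma$) are invariant under $\theta\mapsto\theta+k$, $k\in\mathbb Z^m$, then the Fourier modes $F_\gamma(z)=\int_{[0,1]^m}F(z,\theta_0+x)e^{-2\pi i(\theta_0+x)_\gamma}dx$, for any $\theta_0\in V$, satisfy the isomonodromy equation $$dF_\gamma=\sum_{\gamma_1+\gamma_2=\gamma,\ \gamma_1,\gamma_2\neq0}\langle\gamma_1,\gamma_2\rangle F_{\gamma_1}F_{\gamma_2}\,d\log Z_{\gamma_2}\tag{2}$$ for all $\gamma\in\Gamma$, at each $z\in U$ with $Z_{\gamma'}(z)\neq0$ for all $\gamma'\neq0$, where the sum converges unconditionally. **(B) Convergent solutions, integer invariants.** Everything in (A) holds in the same way for solutions of $$\mathcal X_\gamma(t)=\mathcal X^{\rm sf}_\gamma(t)\exp\Big[-\sum_{\gamma'}\Omega(\gamma')\int_{\ell_{\gamma'}}\frac{dt'}{t'^2}K_{\gamma\gamma'}(t,t')\log(1-\mathcal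 X_{\gamma'}(t'))\Big]$$ with $\mathcal X_\gamma(t)\notin[1,\infty)$ on $\ell_\gamma$ for active $\gamma$, and for $$F=-\sum_\gamma\Omega(\gamma)Z_\gamma\int_{\ell_\gamma}\frac{dt}{t^2}\log(1-\mathcal X_\gamma(t)),$$ $$W=\frac1{2\pi i}\sum_\gamma\Omega(\gamma)\int_{\ell_\gamma}\frac{dt}{t^2}\Big[{\rm Li}_2(\mathcal X_\gamma(t))-\frac12\log(1-\mathcal X_\gamma(t))\sum_{\gamma'}\Omega(\gamma')\int_{\ell_{\gamma'}}\frac{dt'}{t'^2}K_{\gamma\gamma'}(t,t')\log(1-\mathcal X_{\gamma'}(t'))\Big],$$ where the weights are $\Omega$, the convergence assumption is made for $-\log(1-\mathcal X_\gamma)$ in place of $\mathcal X_\gamma$, and in addition $\sum_\gamma|\Omega(\gamma)|\int_0^\infty ds\,|{\rm Li}_2(\mathcal X_\gamma(iZ_\gamma/s))|$ is assumed to converge locally uniformly in the same sense, with a majorant independent of $(z,\theta)$. Here $\log$ and ${\rm Li}_2$ are the principal branches. **(C) Formal solutions.** Let $S\subset\Gamma$, let $U\subset\mathbb C^m$ be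 open with $Z_\gamma\ne0$ on $U$ for $\gamma\in S$, and regard $\bar\Omega(\gamma)$, $\gamma\in S$, as independent formal variables (and $\bar\Omega=0$ off $S$). For every solution $\mathcal X_\gamma$ ($\gamma\in S$, $z\in U$, $\theta\in\mathbb C^m$, $t\in\ell_\gamma$) of the integral equations in (A), as formal power series in these variables integrated coefficient by coefficient, the formal power series $F$, $W$ and $\partial_{\theta^c}W$, with $F$ and $W$ given by the formulas in (A), have coefficients holomorphic on $U\times\mathbb C^m$, and (1) holds as an identity of formal power series. Moreover $F=\sum_{\gamma\neq0}F_\gamma e^{2\pi i\theta_\gamma}$, with finitely many terms in each coefficient, and the modes $F_\gamma$ satisfy (2), in each coefficient, where only finitely many terms are nonzero, at each $z\in U$ with $Z_{\gamma'}(z)\neq0$ for all $\gamma'\neq0$. -/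

import Mathlib

open Complex Set MeasureTheory Topology

noncomputable section

namespace Joyce

/-- The charge lattice `Γ = ℤ γ¹ + ⋯ + ℤ γᵐ`; a charge `γ = ∑ q_a γᵃ` is its coefficient vector. -/
abbrev Lat (m : ℕ) := Fin m → ℤ

/-- `ℂᵐ`, the space of the coordinates `z = (zᵃ)`, and also that of `θ = (θᵃ)`. -/
abbrev Cpx (m : ℕ) := Fin m → ℂ

variable {m : ℕ}

/-- `⟨γ, γ'⟩ = ∑ ω^{ab} q_a q'_b`, where `ω^{ab} = ⟨γᵃ, γᵇ⟩`. -/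
def pairing (ω : Matrix (Fin m) (Fin m) ℤ) (γ γ' : Lat m) : ℤ :=
  ∑ a, ∑ b, ω a b * γ a * γ' b

/-- `∑ q_a vᵃ`. It gives the central charge `Z_γ = lin γ z` and `θ_γ = lin γ θ`. -/
def lin (γ : Lat m) (v : Cpx m) : ℂ := ∑ a, (γ a : ℂ) * v a

/-- Quadratic refinements `σ : Γ → ℂ^×` of the pairing. -/
def IsQuadraticRefinement (ω : Matrix (Fin m) (Fin m) ℤ) (σ : Lat m → ℂ) : Prop :=
  (∀ γ, σ γ ≠ 0) ∧
    ∀ γ γ', σ γ * σ γ' = (-1 : ℂ) ^ (pairing ω γ γ') * σ (γ + γ')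

/-- Rational DT invariants `Ω̄(γ) = ∑_{d ∣ γ} Ω(γ/d) / d²` (the value at `γ = 0` is `0`). -/
def rationalDT (Ω : Lat m → ℤ) (γ : Lat m) : ℂ :=
  ∑ d ∈ (Finset.univ.gcd fun a => (γ a).natAbs).divisors,
    (Ω (fun a => γ a / (d : ℤ)) : ℂ) / (d : ℂ) ^ 2

/-- Two central charges lie on a wall of marginal stability: they are positively proportional. -/
def Aligned (Z Z' : ℂ) : Prop :=
  (Z * (starRingEnd ℂ) Z').im = 0 ∧ 0 < (Z * (starRingEnd ℂ) Z').re

/-- The BPS ray `ℓ = {t : Z / t ∈ i ℝ₋}` (its end points `0` and `∞` left out). -/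
def bpsRay (Z : ℂ) : Set ℂ := {t | t ≠ 0 ∧ ∃ y : ℝ, y < 0 ∧ Z / t = I * y}

/-- For `Z ≠ 0`, `s ↦ i Z / s` is a parametrization of the BPS ray by `0 < s < ∞`. -/
def rayPoint (Z : ℂ) (s : ℝ) : ℂ := I * Z / s

/-- `∫_ℓ f(t) dt / t²` along the BPS ray, oriented from `0` to `∞`. With `t = i Z / s` one has
`dt / t² = - ds / (i Z)`, and `s` runs from `∞` to `0`. -/
def rayInt (Z : ℂ) (f : ℂ → ℂ) : ℂ := ∫ s in Ioi (0 : ℝ), f (rayPoint Z s) / (I * Z)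

/-- `X^sf_γ(t) = σ_γ exp(2πi (θ_γ - Z_γ / t))`. -/
def semiflat (σ : Lat m → ℂ) (γ : Lat m) (z θ : Cpx m) (t : ℂ) : ℂ :=
  σ γ * exp (2 * Real.pi * I * (lin γ θ - lin γ z / t))

/-- `K(γ, t; γ', t') = ⟨γ, γ'⟩ / (2πi) · t t' / (t' - t)`. -/
def kern (ω : Matrix (Fin m) (Fin m) ℤ) (γ γ' : Lat m) (t t' : ℂ) : ℂ :=
  (pairing ω γ γ' : ℂ) / (2 * Real.pi * I) * (t * t' / (t' - t))

/-- `∂f / ∂xᵃ`. -/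
def pderiv (a : Fin m) (f : Cpx m → ℂ) (x : Cpx m) : ℂ := fderiv ℂ f x (Pi.single a 1)

/-- `∂Φ / ∂zᵃ` for a function `Φ(z, θ)`. -/
def dz (a : Fin m) (Φ : Cpx m → Cpx m → ℂ) (z θ : Cpx m) : ℂ := pderiv a (fun w => Φ w θ) z

/-- `∂Φ / ∂θᵃ` for a function `Φ(z, θ)`. -/
def dθ (a : Fin m) (Φ : Cpx m → Cpx m → ℂ) (z θ : Cpx m) : ℂ := pderiv a (Φ z) θ

/-- `∫_{[0,1]^m} f(θ₀ + x) exp(-2πi (θ₀ + x)_γ) dx`, the coefficient of `exp(2πi θ_γ)` in the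
Fourier expansion of `f` on the real torus through `θ₀`. -/
def fourierMode (f : Cpx m → ℂ) (θ₀ : Cpx m) (γ : Lat m) : ℂ :=
  ∫ x in Icc (0 : Fin m → ℝ) 1,
    f (fun a => θ₀ a + (x a : ℂ)) *
      exp (-(2 * Real.pi * I * lin γ (fun a => θ₀ a + (x a : ℂ))))

/-- Pairs `(γ₁, γ₂)` of nonzero charges with `γ₁ + γ₂ = γ`. -/
abbrev Decomp (γ : Lat m) :=
  {p : Lat m × Lat m // p.1 ≠ 0 ∧ p.2 ≠ 0 ∧ p.1 + p.2 = γ}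

/-! ### Convergent solutions

The two forms of the system are treated together. In the form with rational invariants the weights
are `c = Ω̄` and `g(x) = h(x) = x`; in the form with integer invariants `c = Ω`,
`g(x) = - log (1 - x)` and `h(x) = Li₂(x)`. -/

/-- `∑_γ c(γ) ∫_{ℓ_γ} dt / t² f(γ, t)`. -/
def sumInt (c : Lat m → ℂ) (z : Cpx m) (f : Lat m → ℂ → ℂ) : ℂ :=
  ∑' γ, c γ * rayInt (lin γ z) (f γ)

/-- The principal branch of the dilogarithm, on `ℂ ∖ [1, ∞)`. -/
def dilog (x : ℂ) : ℂ := -∫ u in (0 : ℝ)..1, log (1 - x * u) / u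

/-- `- log (1 - x)`. -/
def negLog (x : ℂ) : ℂ := -log (1 - x)

/-- `X_γ(z, θ, t)` solves, for `(z, θ)` in `D`, the integral equations
`X_γ(t) = X^sf_γ(t) exp (∑_{γ'} c(γ') ∫_{ℓ_{γ'}} dt'/t'² K(γ,t;γ',t') g(X_{γ'}(t')))`
on the rays of the active charges (those with `c(γ) ≠ 0`), away from walls of marginal stability,
depends holomorphically on `(z, θ)` and differentiably on `t` along the rays, and the sums and
integrals over charges and rays converge absolutely, locally uniformly in `(z, θ)`. -/
structure IsConvergentSolution (ω : Matrix (Fin m) (Fin m) ℤ) (σ c : Lat m → ℂ) (g h : ℂ → ℂ)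
    (D : Set (Cpx m × Cpx m)) (X : Lat m → Cpx m → Cpx m → ℂ → ℂ) : Prop where
  /-- the support property, with respect to a fixed norm -/
  support : ∃ ε : ℝ, 0 < ε ∧ ∀ p ∈ D, ∀ γ, c γ ≠ 0 → ε * ‖γ‖ < ‖lin γ p.1‖
  offWalls : ∀ p ∈ D, ∀ γ γ', c γ ≠ 0 → c γ' ≠ 0 → pairing ω γ γ' ≠ 0 →
    ¬ Aligned (lin γ p.1) (lin γ' p.1)
  tba : ∀ p ∈ D, ∀ γ, c γ ≠ 0 → ∀ t ∈ bpsRay (lin γ p.1),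
    X γ p.1 p.2 t = semiflat σ γ p.1 p.2 t *
      exp (sumInt c p.1 fun γ' t' => kern ω γ γ' t t' * g (X γ' p.1 p.2 t'))
  holomorphic : ∀ γ, c γ ≠ 0 → ∀ s : ℝ, 0 < s →
    DifferentiableOn ℂ (fun p : Cpx m × Cpx m => X γ p.1 p.2 (rayPoint (lin γ p.1) s)) D
  differentiable : ∀ p ∈ D, ∀ γ, c γ ≠ 0 → ∀ s : ℝ, 0 < s →
    DifferentiableAt ℝ (fun r : ℝ => X γ p.1 p.2 (rayPoint (lin γ p.1) r)) s
  /-- Near each point of `D` there are majorants `M` of `g(X)` and of `t ∂_t g(X)`, `M'` of `h(X)`,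
  and `κ` of the kernel (all on the rays, written in the parameter `s`), for which the single sums,
  with weights `dt/t²` and `dt/t³`, and the double sums converge. -/
  dominated : ∀ p₀ ∈ D, ∃ N ∈ 𝓝 p₀, ∃ (M M' : Lat m → ℝ → ℝ) (κ : Lat m → Lat m → ℝ → ℝ → ℝ),
    (∀ p ∈ N ∩ D, ∀ γ, c γ ≠ 0 → ∀ s : ℝ, 0 < s →
      ‖g (X γ p.1 p.2 (rayPoint (lin γ p.1) s))‖ ≤ M γ s ∧
      ‖(s : ℂ) * deriv (fun r : ℝ => g (X γ p.1 p.2 (rayPoint (lin γ p.1) r))) s‖ ≤ M γ s ∧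
      ‖h (X γ p.1 p.2 (rayPoint (lin γ p.1) s))‖ ≤ M' γ s) ∧
    (∀ p ∈ N ∩ D, ∀ γ γ', c γ ≠ 0 → c γ' ≠ 0 → ∀ s s' : ℝ, 0 < s → 0 < s' →
      ‖kern ω γ γ' (rayPoint (lin γ p.1) s) (rayPoint (lin γ' p.1) s')
        / (lin γ p.1 * lin γ' p.1)‖ ≤ κ γ γ' s s') ∧
    (∀ γ, IntegrableOn (fun s => ‖c γ‖ * ((1 + s) * M γ s)) (Ioi 0)) ∧
    (Summable fun γ => ∫ s in Ioi (0 : ℝ), ‖c γ‖ * ((1 + s) * M γ s)) ∧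
    (∀ γ, IntegrableOn (fun s => ‖c γ‖ * M' γ s) (Ioi 0)) ∧
    (Summable fun γ => ∫ s in Ioi (0 : ℝ), ‖c γ‖ * M' γ s) ∧
    (∀ γ γ', IntegrableOn (fun q : ℝ × ℝ => ‖c γ‖ * ‖c γ'‖ *
        ((1 + q.1) * M γ q.1 * κ γ γ' q.1 q.2 * M γ' q.2)) (Ioi 0 ×ˢ Ioi 0)) ∧
    (Summable fun γ : Lat m × Lat m => ∫ q in Ioi (0 : ℝ) ×ˢ Ioi (0 : ℝ), ‖c γ.1‖ * ‖c γ.2‖ *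
        ((1 + q.1) * M γ.1 q.1 * κ γ.1 γ.2 q.1 q.2 * M γ.2 q.2))

/-- The Joyce potential `F = ∑_γ c(γ) ∫_{ℓ_γ} dt/t² Z_γ g(X_γ(t))`. -/
def potF (c : Lat m → ℂ) (g : ℂ → ℂ) (X : Lat m → Cpx m → Cpx m → ℂ → ℂ) (z θ : Cpx m) : ℂ :=
  sumInt c z fun γ t => lin γ z * g (X γ z θ t)

/-- The Plebański potential
`W = 1/(2πi) ∑_γ c(γ) ∫ dt/t² [h(X_γ) - 1/2 g(X_γ) ∑_{γ'} c(γ') ∫ dt'/t'² K g(X_{γ'})]`. -/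
def potW (ω : Matrix (Fin m) (Fin m) ℤ) (c : Lat m → ℂ) (g h : ℂ → ℂ)
    (X : Lat m → Cpx m → Cpx m → ℂ → ℂ) (z θ : Cpx m) : ℂ :=
  1 / (2 * Real.pi * I) * sumInt c z fun γ t =>
    h (X γ z θ t) - 1 / 2 * g (X γ z θ t) *
      sumInt c z fun γ' t' => kern ω γ γ' t t' * g (X γ' z θ t')

/-- `dF = (2πi)⁻² ∑ ω^{ab} ∂_{θᵃ}F ∂_{θᵇ}∂_{θᶜ}W dzᶜ` on `D`, all derivatives being genuine. -/
def PotentialEq (ω : Matrix (Fin m) (Fin m) ℤ) (D : Set (Cpx m × Cpx m))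
    (F W : Cpx m → Cpx m → ℂ) : Prop :=
  DifferentiableOn ℂ (fun p : Cpx m × Cpx m => F p.1 p.2) D ∧
  DifferentiableOn ℂ (fun p : Cpx m × Cpx m => W p.1 p.2) D ∧
  (∀ c, DifferentiableOn ℂ (fun p : Cpx m × Cpx m => dθ c W p.1 p.2) D) ∧
  ∀ p ∈ D, ∀ c, dz c F p.1 p.2 =
    1 / (2 * Real.pi * I) ^ 2 *
      ∑ a, ∑ b, (ω a b : ℂ) * dθ a F p.1 p.2 * dθ b (dθ c W) p.1 p.2

/-- `dF_γ = ∑_{γ₁+γ₂=γ} ⟨γ₁,γ₂⟩ F_{γ₁} F_{γ₂} d log Z_{γ₂}` at `z`, tested on each vector `v`. -/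
def ModeEq (ω : Matrix (Fin m) (Fin m) ℤ) (Fm : Lat m → Cpx m → ℂ) (z : Cpx m) : Prop :=
  ∀ γ, DifferentiableAt ℂ (Fm γ) z ∧ ∀ v : Cpx m,
    HasSum (fun p : Decomp γ => (pairing ω p.1.1 p.1.2 : ℂ) * (Fm p.1.1 z * Fm p.1.2 z) *
      (lin p.1.2 v / lin p.1.2 z)) (fderiv ℂ (Fm γ) z v)

/-- The isomonodromy equation for a pair of potentials built from the modes `X` on `D`: the
potential form on `D`; and, if `D = U × V` with `V` stable under real translations and `X` is
periodic under the integral ones, the equation for the Fourier modes of `F`, at each `z ∈ U` where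
all the `d log Z_γ` are defined. -/
def Isomonodromy (ω : Matrix (Fin m) (Fin m) ℤ) (c : Lat m → ℂ) (D : Set (Cpx m × Cpx m))
    (X : Lat m → Cpx m → Cpx m → ℂ → ℂ) (F W : Cpx m → Cpx m → ℂ) : Prop :=
  PotentialEq ω D F W ∧
  ∀ U V : Set (Cpx m), D = U ×ˢ V →
    (∀ θ ∈ V, ∀ x : Fin m → ℝ, (fun a => θ a + (x a : ℂ)) ∈ V) →
    (∀ z ∈ U, ∀ θ ∈ V, ∀ k : Fin m → ℤ, ∀ γ, c γ ≠ 0 → ∀ t ∈ bpsRay (lin γ z),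
      X γ z (fun a => θ a + (k a : ℂ)) t = X γ z θ t) →
    ∀ θ₀ ∈ V, ∀ z ∈ U, (∀ γ : Lat m, γ ≠ 0 → lin γ z ≠ 0) →
      ModeEq ω (fun γ w => fourierMode (F w) θ₀ γ) z

/-! ### Formal solutions

Here the rational invariants `Ω̄(γ)` of the active charges `γ ∈ S` are independent formal variables,
and everything is a power series in them, whose coefficients are functions. -/

/-- `∑_{γ ∈ S} Ω̄(γ) ∫_{ℓ_γ} dt/t² f(γ, t)`, integrated coefficient by coefficient; `Ω̄(γ)` is the
variable with index `γ`. -/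
def fSumInt (S : Set (Lat m)) (z : Cpx m) (f : S → ℂ → MvPowerSeries S ℂ) : MvPowerSeries S ℂ :=
  fun n => ∑ γ ∈ n.support, rayInt (lin γ.1 z) fun t =>
    MvPowerSeries.coeff (n - Finsupp.single γ 1) (f γ t)

/-- The formal integral equations
`X_γ(t) = X^sf_γ(t) exp (∑_{γ'} Ω̄(γ') ∫_{ℓ_{γ'}} dt'/t'² K(γ,t;γ',t') X_{γ'}(t'))`. -/
def IsFormalSolution (ω : Matrix (Fin m) (Fin m) ℤ) (σ : Lat m → ℂ) (S : Set (Lat m))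
    (U : Set (Cpx m)) (X : S → Cpx m → Cpx m → ℂ → MvPowerSeries S ℂ) : Prop :=
  ∀ z ∈ U, ∀ (θ : Cpx m) (γ : S), ∀ t ∈ bpsRay (lin γ.1 z),
    X γ z θ t = MvPowerSeries.C (semiflat σ γ.1 z θ t) *
      (PowerSeries.exp ℂ).subst
        (fSumInt S z fun γ' t' => MvPowerSeries.C (kern ω γ.1 γ'.1 t t') * X γ' z θ t')

/-- `F = ∑_γ Ω̄(γ) ∫_{ℓ_γ} dt/t² Z_γ X_γ(t)`. -/
def fPotF (S : Set (Lat m)) (X : S → Cpx m → Cpx m → ℂ → MvPowerSeries S ℂ) (z θ : Cpx m) :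
    MvPowerSeries S ℂ :=
  fSumInt S z fun γ t => MvPowerSeries.C (lin γ.1 z) * X γ z θ t

/-- `W = 1/(2πi) ∑_γ Ω̄(γ) ∫ dt/t² X_γ (1 - 1/2 ∑_{γ'} Ω̄(γ') ∫ dt'/t'² K X_{γ'})`. -/
def fPotW (ω : Matrix (Fin m) (Fin m) ℤ) (S : Set (Lat m))
    (X : S → Cpx m → Cpx m → ℂ → MvPowerSeries S ℂ) (z θ : Cpx m) : MvPowerSeries S ℂ :=
  MvPowerSeries.C (1 / (2 * Real.pi * I)) * fSumInt S z fun γ t =>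
    X γ z θ t * (1 - MvPowerSeries.C (1 / 2) *
      fSumInt S z fun γ' t' => MvPowerSeries.C (kern ω γ.1 γ'.1 t t') * X γ' z θ t')

/-- `∂Φ / ∂zᵃ`, coefficient by coefficient. -/
def fdz {S : Set (Lat m)} (a : Fin m) (Φ : Cpx m → Cpx m → MvPowerSeries S ℂ) (z θ : Cpx m) :
    MvPowerSeries S ℂ :=
  fun n => dz a (fun w η => MvPowerSeries.coeff n (Φ w η)) z θ

/-- `∂Φ / ∂θᵃ`, coefficient by coefficient. -/
def fdθ {S : Set (Lat m)} (a : Fin m) (Φ : Cpx m → Cpx m → MvPowerSeries S ℂ) (z θ : Cpx m) :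
    MvPowerSeries S ℂ :=
  fun n => dθ a (fun w η => MvPowerSeries.coeff n (Φ w η)) z θ

/-- `Φ(z, θ)` has coefficients that are holomorphic on `U × ℂᵐ`. -/
def FHolomorphic {S : Set (Lat m)} (U : Set (Cpx m))
    (Φ : Cpx m → Cpx m → MvPowerSeries S ℂ) : Prop :=
  ∀ n, DifferentiableOn ℂ (fun p : Cpx m × Cpx m => MvPowerSeries.coeff n (Φ p.1 p.2)) (U ×ˢ univ)

/-- `dF = (2πi)⁻² ∑ ω^{ab} ∂_{θᵃ}F ∂_{θᵇ}∂_{θᶜ}W dzᶜ`, as an identity of formal power series. -/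
def FPotentialEq (ω : Matrix (Fin m) (Fin m) ℤ) {S : Set (Lat m)} (U : Set (Cpx m))
    (F W : Cpx m → Cpx m → MvPowerSeries S ℂ) : Prop :=
  FHolomorphic U F ∧ FHolomorphic U W ∧ (∀ c, FHolomorphic U (fdθ c W)) ∧
  ∀ z ∈ U, ∀ θ c, fdz c F z θ =
    MvPowerSeries.C (1 / (2 * Real.pi * I) ^ 2) *
      ∑ a, ∑ b, MvPowerSeries.C (ω a b : ℂ) * fdθ a F z θ * fdθ b (fdθ c W) z θ

/-- The Fourier mode `F_γ(z)`, a formal power series. -/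
def fMode {S : Set (Lat m)} (F : Cpx m → Cpx m → MvPowerSeries S ℂ) (γ : Lat m) (z : Cpx m) :
    MvPowerSeries S ℂ :=
  fun n => fourierMode (fun θ => MvPowerSeries.coeff n (F z θ)) 0 γ

/-- `F = ∑_{γ ≠ 0} F_γ exp(2πi θ_γ)` on `U × ℂᵐ`: in each coefficient, only finitely many `γ`
contribute. -/
def FHasFourierExpansion {S : Set (Lat m)} (U : Set (Cpx m))
    (F : Cpx m → Cpx m → MvPowerSeries S ℂ) : Prop :=
  ∀ z ∈ U, ∀ n, ∃ A : Finset (Lat m), 0 ∉ A ∧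
    (∀ γ ∉ A, MvPowerSeries.coeff n (fMode F γ z) = 0) ∧
    ∀ θ, MvPowerSeries.coeff n (F z θ) =
      ∑ γ ∈ A, MvPowerSeries.coeff n (fMode F γ z) * exp (2 * Real.pi * I * lin γ θ)

/-- `dF_γ = ∑_{γ₁+γ₂=γ} ⟨γ₁,γ₂⟩ F_{γ₁} F_{γ₂} d log Z_{γ₂}` at `z`, in each coefficient (where only
finitely many terms are nonzero), tested on each vector `v`. -/
def FModeEq (ω : Matrix (Fin m) (Fin m) ℤ) {S : Set (Lat m)}
    (Fm : Lat m → Cpx m → MvPowerSeries S ℂ) (z : Cpx m) : Prop :=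
  ∀ γ n, DifferentiableAt ℂ (fun w => MvPowerSeries.coeff n (Fm γ w)) z ∧ ∀ v : Cpx m,
    (Function.support fun p : Decomp γ => (pairing ω p.1.1 p.1.2 : ℂ) *
      MvPowerSeries.coeff n (Fm p.1.1 z * Fm p.1.2 z)).Finite ∧
    fderiv ℂ (fun w => MvPowerSeries.coeff n (Fm γ w)) z v =
      ∑ᶠ p : Decomp γ, (pairing ω p.1.1 p.1.2 : ℂ) *
        MvPowerSeries.coeff n (Fm p.1.1 z * Fm p.1.2 z) * (lin p.1.2 v / lin p.1.2 z)

end Joyce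

end

/-!
The three settings are instances of one: solutions, with values in a commutative Banach algebra, of
integral equations over the disjoint union of the BPS rays, with majorants that are uniform near a
given point (`UniformSolution`). The algebra is `ℂ` for convergent solutions, and the truncated
power series `Trunc n` for formal ones. Write `t = i Z_γ / s` on the ray of `γ`; in the parameters
`x = (γ, s)` and `y = (γ', s')` the kernel becomes the symmetric function
`⟨γ, γ'⟩ / (2πi) / (s Z_{γ'} - s' Z_γ)` (`rayKern`).

*Linearization.* Let `u` be the weighted unknown, `c(γ) X_γ` or `-c(γ) log (1 - X_γ)`. Its
derivatives in `θ` (`isTangent_theta`), its derivatives in `z` at a fixed point `t` of the ray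
(`isTangent_z`) and its scaling derivative along the rays (`isTangent_scale`) all solve the
linearized integral equation, with explicit inhomogeneities. This equation is symmetric, which gives
`reciprocity`: inhomogeneities and responses may be exchanged in pairings. Multiplying by `s / Z`
before pairing gives `commutator`: the commutator of the kernel with `s / Z` is, up to a constant,
`⟨γ, γ'⟩ / (Z_γ Z_{γ'})`, so that a product of two integrals over the rays becomes a single one.

*Potentials.* By the symmetry of the kernel and `x h'(x) = g(x)`, where `u = c g(X)`, the derivative
`∂_w W` in an angular direction `w` is the linear expression `∑ c(γ) w_γ ∫ dt/t² g(X_γ)`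
(`plebPot_holomorphic`, `anglePot`). Here `h = g = id` for the rational invariants, while
`g = -log (1 - x)` and `h = Li₂` for the integer ones (`hasDerivAt_dilog`). Evaluating at `w = z`
shows `F = ∑ z^a ∂_{θ^a} W`. For the angular tangent vectors, reciprocity computes `∂_z ∂_θ W`
(`fderiv_anglePot_z`), and the commutator identity then becomes Plebański's heavenly equation
(`fderiv_anglePot_z_sub`). Reciprocity between angular and scaling derivatives shows that `∂_θ W` is
homogeneous of degree `-1` in `z` (`fderiv_anglePot_euler`). Contracting the heavenly equation with
`z` gives the differential equation for `F` (`fderiv_joycePot_eq`).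

*Fourier modes.* The `γ`-th mode of `F` is `2πi Z_γ` times that of `W`, and the modes of a product
are convolutions, by Parseval's identity on the torus (`hasSum_fourierMode_mul`). Hence the modes of
the equation for the potentials are the isomonodromy equations (`modeEq_of_potentialEq`).

*Formal solutions.* Up to the factor `exp (-2πs)`, the coefficients of `X_γ` grow more slowly than
every power of `1 + 1/s` (`Tame`). The integral equations determine each coefficient from
lower ones by finitely many sums, products and kernel integrals, all of which preserve this
(`Tame.integral`, `IsFormalSolution.tame`). The truncations of a formal solution are therefore
uniform solutions (`IsFormalSolution.uniformSolution`), and the equation for the potentials holds in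
each coefficient. The coefficient of exponent `n` of `F` or `W` depends on `θ` through the single
character of the charge `∑ n_γ γ` (`IsFormalSolution.covariant`, `IsFormalSolution.coeff_fPotW`), so
the passage to Fourier modes is a finite computation (`modeEq_of_fPotentialEq`).
-/


noncomputable section

set_option linter.unusedSectionVars false

namespace Joyce

variable {m : ℕ}

/-! ### Integration over the disjoint union of the rays -/

section RayMeasure

variable {ι : Type*} [MeasurableSpace ι]

/-- The measure space of all BPS rays: the disjoint union, over an index set of charges, of half
lines `0 < s < ∞` with Lebesgue measure. -/
def rayMeasure (ι : Type*) [MeasurableSpace ι] : Measure (ι × ℝ) :=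
  Measure.sum fun i => (volume.restrict (Ioi (0 : ℝ))).map (Prod.mk i)

theorem integral_rayMeasure [MeasurableSingletonClass ι] {F : Type*} [NormedAddCommGroup F]
    [NormedSpace ℝ F] {f : ι × ℝ → F}
    (hf : Integrable f (rayMeasure ι)) :
    ∫ x, f x ∂rayMeasure ι = ∑' i, ∫ s in Ioi (0 : ℝ), f (i, s) := by
  rw [rayMeasure, integral_sum_measure hf]
  simp_rw [(measurableEmbedding_prodMk_left (_ : ι)).integral_map]

variable [Countable ι] [MeasurableSingletonClass ι] {F : Type*} [NormedAddCommGroup F]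

instance : SFinite (rayMeasure ι) := by
  unfold rayMeasure; infer_instance

theorem ae_rayMeasure_iff {p : ι × ℝ → Prop} :
    (∀ᵐ x ∂rayMeasure ι, p x) ↔ ∀ i, ∀ᵐ s ∂volume.restrict (Ioi (0 : ℝ)), p (i, s) := by
  rw [rayMeasure, Measure.ae_sum_iff]
  exact forall_congr' fun i => (measurableEmbedding_prodMk_left i).ae_map_iff

theorem ae_rayMeasure_pos : ∀ᵐ x ∂rayMeasure ι, 0 < x.2 :=
  ae_rayMeasure_iff.2 fun _ => ae_restrict_mem measurableSet_Ioi

theorem aestronglyMeasurable_rayMeasure_iff {f : ι × ℝ → F} :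
    AEStronglyMeasurable f (rayMeasure ι) ↔
      ∀ i, AEStronglyMeasurable (fun s => f (i, s)) (volume.restrict (Ioi (0 : ℝ))) := by
  rw [rayMeasure, aestronglyMeasurable_sum_measure_iff]
  exact forall_congr' fun i => (measurableEmbedding_prodMk_left i).aestronglyMeasurable_map_iff

theorem integrable_rayMeasure_iff {f : ι × ℝ → F} :
    Integrable f (rayMeasure ι) ↔
      (∀ i, IntegrableOn (fun s => f (i, s)) (Ioi 0)) ∧
        Summable fun i => ∫ s in Ioi (0 : ℝ), ‖f (i, s)‖ := by
  rw [rayMeasure, integrable_sum_measure_iff]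
  refine and_congr (forall_congr' fun i => (measurableEmbedding_prodMk_left i).integrable_map_iff) ?_
  simp_rw [(measurableEmbedding_prodMk_left (_ : ι)).integral_map]

theorem rayMeasure_prod : (rayMeasure ι).prod (rayMeasure ι) =
    Measure.sum fun i : ι × ι =>
      ((volume : Measure (ℝ × ℝ)).restrict (Ioi 0 ×ˢ Ioi 0)).map
        (Prod.map (Prod.mk i.1) (Prod.mk i.2)) := by
  rw [rayMeasure, Measure.prod_sum]
  congr 1
  funext i
  rw [Measure.map_prod_map _ _ (measurableEmbedding_prodMk_left i.1).measurable
    (measurableEmbedding_prodMk_left i.2).measurable, Measure.prod_restrict]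
  rfl

theorem integrable_rayMeasure_prod_iff {f : (ι × ℝ) × (ι × ℝ) → F} :
    Integrable f ((rayMeasure ι).prod (rayMeasure ι)) ↔
      (∀ i j, IntegrableOn (fun q : ℝ × ℝ => f ((i, q.1), (j, q.2))) (Ioi 0 ×ˢ Ioi 0)) ∧
        Summable fun i : ι × ι => ∫ q in Ioi (0 : ℝ) ×ˢ Ioi (0 : ℝ),
          ‖f ((i.1, q.1), (i.2, q.2))‖ := by
  have hE : ∀ i : ι × ι, MeasurableEmbedding
      (Prod.map (Prod.mk i.1 : ℝ → ι × ℝ) (Prod.mk i.2 : ℝ → ι × ℝ)) := fun i =>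
    (measurableEmbedding_prodMk_left i.1).prodMap (measurableEmbedding_prodMk_left i.2)
  rw [rayMeasure_prod, integrable_sum_measure_iff]
  refine and_congr ⟨fun h i j => (hE (i, j)).integrable_map_iff.1 (h (i, j)),
    fun h i => (hE i).integrable_map_iff.2 (h i.1 i.2)⟩ (Iff.of_eq ?_)
  congr 1
  funext i
  rw [(hE i).integral_map]
  rfl

end RayMeasure

/-! ### Holomorphic parameter integrals -/

section Parameter

variable {P : Type*} [NormedAddCommGroup P] [NormedSpace ℂ P]
  {F : Type*} [NormedAddCommGroup F] [NormedSpace ℂ F]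

/-- Cauchy's estimate for the derivative of a bounded holomorphic function of several variables. -/
theorem norm_fderiv_apply_le_of_ball {f : P → F} {p : P} {r C : ℝ} (hr : 0 < r)
    (hf : DifferentiableOn ℂ f (Metric.ball p r))
    (hC : ∀ w ∈ Metric.ball p r, ‖f w‖ ≤ C) (v : P) :
    ‖fderiv ℂ f p v‖ ≤ 2 * C / r * ‖v‖ := by
  rcases eq_or_ne v 0 with rfl | hv
  · simp
  have hv' : 0 < ‖v‖ := norm_pos_iff.2 hv
  set R := r / (2 * ‖v‖) with hR
  have hR0 : 0 < R := by positivity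
  have hmem : ∀ z ∈ Metric.closedBall (0 : ℂ) R, p + z • v ∈ Metric.ball p r := by
    intro z hz
    rw [mem_ball_iff_norm, add_sub_cancel_left, norm_smul]
    have hz' : ‖z‖ ≤ R := by simpa using hz
    calc ‖z‖ * ‖v‖ ≤ R * ‖v‖ := by gcongr
      _ = r / 2 := by rw [hR]; field_simp
      _ < r := by linarith
  have hd : ∀ z ∈ Metric.closedBall (0 : ℂ) R, DifferentiableAt ℂ (fun z : ℂ => f (p + z • v)) z := by
    intro z hz
    exact (hf.differentiableAt (Metric.isOpen_ball.mem_nhds (hmem z hz))).fun_comp' z (by fun_prop)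
  have hder : deriv (fun z : ℂ => f (p + z • v)) 0 = fderiv ℂ f p v := by
    have h1 : HasFDerivAt f (fderiv ℂ f p) (p + (0 : ℂ) • v) := by
      rw [zero_smul, add_zero]
      exact (hf.differentiableAt (Metric.isOpen_ball.mem_nhds (Metric.mem_ball_self hr))).hasFDerivAt
    have h2 : HasDerivAt (fun z : ℂ => p + z • v) v 0 := by
      simpa using ((hasDerivAt_id (0 : ℂ)).smul_const v).const_add p
    exact (h1.comp_hasDerivAt 0 h2).deriv
  have := Complex.norm_deriv_le_of_forall_mem_sphere_norm_le (f := fun z : ℂ => f (p + z • v))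
    (c := 0) (C := C) hR0
    (DifferentiableOn.diffContOnCl (by
      rw [closure_ball _ hR0.ne']
      exact fun z hz => (hd z hz).differentiableWithinAt))
    fun z hz => hC _ (hmem z (Metric.sphere_subset_closedBall hz))
  rw [hder] at this
  refine this.trans (le_of_eq ?_)
  rw [hR]; field_simp

variable {α : Type*} [MeasurableSpace α] {μ : Measure α}

theorem aestronglyMeasurable_fderiv_apply {Φ : P → α → F} {B : Set P} (hB : IsOpen B)
    (hm : ∀ p ∈ B, AEStronglyMeasurable (Φ p) μ)
    (hd : ∀ᵐ a ∂μ, DifferentiableOn ℂ (fun p => Φ p a) B) {p : P} (hp : p ∈ B) (v : P) :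
    AEStronglyMeasurable (fun a => fderiv ℂ (fun p => Φ p a) p v) μ := by
  -- the derivative is the limit of the difference quotients `n (Φ (p + v / n) - Φ p)`
  have hlim : Filter.Tendsto (fun n : ℕ => p + ((n : ℂ) + 1)⁻¹ • v) Filter.atTop (𝓝 p) := by
    have h0 : Filter.Tendsto (fun n : ℕ => ((n : ℂ) + 1)⁻¹) Filter.atTop (𝓝 0) := by
      have := tendsto_one_div_add_atTop_nhds_zero_nat (𝕜 := ℂ)
      simpa using this
    simpa using (h0.smul_const v).const_add p
  obtain ⟨n₀, hn₀⟩ := Filter.eventually_atTop.1 (hlim.eventually (hB.mem_nhds hp))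
  refine aestronglyMeasurable_of_tendsto_ae (u := Filter.atTop)
    (f := fun (n : ℕ) a => (((n + n₀ : ℕ) : ℂ) + 1) •
      (Φ (p + (((n + n₀ : ℕ) : ℂ) + 1)⁻¹ • v) a - Φ p a)) ?_ ?_
  · exact fun n => ((hm _ (hn₀ _ (by omega))).sub (hm p hp)).const_smul _
  · filter_upwards [hd] with a ha
    have h1 : HasFDerivAt (fun p => Φ p a) (fderiv ℂ (fun p => Φ p a) p) p :=
      (ha.differentiableAt (hB.mem_nhds hp)).hasFDerivAt
    have hc : Filter.Tendsto (fun n : ℕ => ‖((n + n₀ : ℕ) : ℂ) + 1‖) Filter.atTop Filter.atTop := by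
      have : ∀ n : ℕ, ‖((n + n₀ : ℕ) : ℂ) + 1‖ = (n : ℝ) + (n₀ + 1) := by
        intro n
        have : ((n + n₀ : ℕ) : ℂ) + 1 = ((n + n₀ + 1 : ℕ) : ℂ) := by push_cast; ring
        rw [this, Complex.norm_natCast]; push_cast; ring
      simp_rw [this]
      exact Filter.tendsto_atTop_add_const_right _ _ tendsto_natCast_atTop_atTop
    exact h1.lim v hc

variable [FiniteDimensional ℂ P]

/-- The integral of a dominated family of holomorphic functions is holomorphic, and may be
differentiated under the integral sign; the bound on the derivatives comes from Cauchy's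
estimate. -/
theorem hasFDerivAt_integral_of_holomorphic {Φ : P → α → F} {B : Set P} (hB : IsOpen B)
    {b : α → ℝ} (hm : ∀ p ∈ B, AEStronglyMeasurable (Φ p) μ)
    (hd : ∀ᵐ a ∂μ, DifferentiableOn ℂ (fun p => Φ p a) B)
    (hb : ∀ᵐ a ∂μ, ∀ p ∈ B, ‖Φ p a‖ ≤ b a) (hbi : Integrable b μ) {p : P} (hp : p ∈ B) :
    DifferentiableAt ℂ (fun p => ∫ a, Φ p a ∂μ) p ∧ ∀ v,
      Integrable (fun a => fderiv ℂ (fun p => Φ p a) p v) μ ∧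
      fderiv ℂ (fun p => ∫ a, Φ p a ∂μ) p v = ∫ a, fderiv ℂ (fun p => Φ p a) p v ∂μ := by
  obtain ⟨r, hr, hrB⟩ := Metric.isOpen_iff.1 hB p hp
  have hr2 : 0 < r / 2 := by positivity
  have hsub : ∀ x ∈ Metric.ball p (r / 2), Metric.ball x (r / 2) ⊆ B := fun x hx =>
    (Metric.ball_subset_ball' (by have := Metric.mem_ball.1 hx; linarith)).trans hrB
  have hbound : ∀ᵐ a ∂μ, ∀ x ∈ Metric.ball p (r / 2), ∀ v,
      ‖fderiv ℂ (fun p => Φ p a) x v‖ ≤ 2 * b a / (r / 2) * ‖v‖ := by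
    filter_upwards [hd, hb] with a ha hba x hx v
    exact norm_fderiv_apply_le_of_ball hr2 (ha.mono (hsub x hx))
      (fun w hw => hba w (hsub x hx hw)) v
  have hmeas : AEStronglyMeasurable (fun a => fderiv ℂ (fun p => Φ p a) p) μ := by
    let e := Module.finBasis ℂ P
    have key : (fun a => fderiv ℂ (fun p => Φ p a) p) = fun a =>
        ∑ k, (ContinuousLinearMap.smulRightL ℂ P F (LinearMap.toContinuousLinearMap (e.coord k)))
          (fderiv ℂ (fun p => Φ p a) p (e k)) := by
      funext a
      ext v
      have hv := congrArg (fderiv ℂ (fun p => Φ p a) p) (e.sum_repr v).symm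
      rw [map_sum] at hv
      rw [hv]
      simp
    rw [key]
    refine Finset.aestronglyMeasurable_fun_sum _ fun k _ => ?_
    exact (ContinuousLinearMap.continuous _).comp_aestronglyMeasurable
      (aestronglyMeasurable_fderiv_apply hB hm hd hp _)
  have hbi' : Integrable (fun a => 2 * b a / (r / 2)) μ := (hbi.const_mul 2).div_const _
  have h0 : ∀ᵐ a ∂μ, 0 ≤ b a := by
    filter_upwards [hb] with a ha using (norm_nonneg _).trans (ha p hp)
  have H := hasFDerivAt_integral_of_dominated_of_fderiv_le (𝕜 := ℂ) (μ := μ)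
    (F := Φ) (x₀ := p) (bound := fun a => 2 * b a / (r / 2)) (s := Metric.ball p (r / 2))
    (F' := fun x a => fderiv ℂ (fun p => Φ p a) x) (Metric.ball_mem_nhds p hr2)
    (by filter_upwards [hB.mem_nhds hp] with x hx using hm x hx)
    (hbi.mono' (hm p hp) (by filter_upwards [hb] with a ha using ha p hp)) hmeas
    (by
      filter_upwards [hbound, h0] with a ha h0 x hx
      exact ContinuousLinearMap.opNorm_le_bound _ (by positivity) (ha x hx)) hbi'
    (by
      filter_upwards [hd] with a ha x hx
      exact (ha.differentiableAt (hB.mem_nhds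
        (hsub x hx (Metric.mem_ball_self hr2)))).hasFDerivAt)
  have hint : Integrable (fun a => fderiv ℂ (fun p => Φ p a) p) μ :=
    hbi'.mono' hmeas (by
      filter_upwards [hbound, h0] with a ha h0
      exact ContinuousLinearMap.opNorm_le_bound _ (by positivity)
        (ha p (Metric.mem_ball_self hr2)))
  refine ⟨H.differentiableAt, fun v => ⟨?_, ?_⟩⟩
  · exact (ContinuousLinearMap.apply ℂ F v).integrable_comp hint
  · rw [H.fderiv, ContinuousLinearMap.integral_apply hint]

end Parameter

/-! ### Scaling along the rays -/

section Scaling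

variable {ι : Type*} [MeasurableSpace ι] [Countable ι] [MeasurableSingletonClass ι]
  {F : Type*} [NormedAddCommGroup F]

theorem integrable_rayMeasure_comp_mul {f : ι × ℝ → F} (hf : Integrable f (rayMeasure ι))
    {r : ℝ} (hr : 0 < r) : Integrable (fun x : ι × ℝ => f (x.1, r * x.2)) (rayMeasure ι) := by
  rw [integrable_rayMeasure_iff] at hf ⊢
  refine ⟨fun i => ?_, ?_⟩
  · have := (integrableOn_Ioi_comp_mul_left_iff (fun s => f (i, s)) 0 hr).2
    rw [mul_zero] at this
    exact this (hf.1 i)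
  · have : (fun i => ∫ s in Ioi (0 : ℝ), ‖f (i, r * s)‖) =
        fun i => r⁻¹ • ∫ s in Ioi (0 : ℝ), ‖f (i, s)‖ := by
      funext i
      have := integral_comp_mul_left_Ioi (fun s => ‖f (i, s)‖) 0 hr
      rwa [mul_zero] at this
    rw [this]
    exact hf.2.const_smul _

theorem integral_rayMeasure_comp_mul [NormedSpace ℝ F] {f : ι × ℝ → F}
    (hf : Integrable f (rayMeasure ι)) {r : ℝ} (hr : 0 < r) :
    ∫ x, f (x.1, r * x.2) ∂rayMeasure ι = r⁻¹ • ∫ x, f x ∂rayMeasure ι := by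
  rw [integral_rayMeasure (integrable_rayMeasure_comp_mul hf hr), integral_rayMeasure hf,
    ← tsum_const_smul'']
  refine tsum_congr fun i => ?_
  have := integral_comp_mul_left_Ioi (fun s => f (i, s)) 0 hr
  rwa [mul_zero] at this

/-- Integration by parts on a half line with respect to the scaling field `s d/ds`: no boundary
terms occur, since `s u(s)`, as a function of `log s`, is integrable together with its
derivative. -/
theorem integral_Ioi_add_smul_deriv_eq_zero [NormedSpace ℝ F] {u u' : ℝ → F}
    (hu : ∀ s, 0 < s → HasDerivAt u (u' s) s)
    (h1 : IntegrableOn u (Ioi 0)) (h2 : IntegrableOn (fun s => u s + s • u' s) (Ioi 0)) :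
    ∫ s in Ioi (0 : ℝ), (u s + s • u' s) = 0 := by
  have himg : Real.exp '' univ = Ioi 0 := by simp
  have hd : ∀ x ∈ (univ : Set ℝ), HasDerivWithinAt Real.exp (Real.exp x) univ x := fun x _ =>
    (Real.hasDerivAt_exp x).hasDerivWithinAt
  have hinj : InjOn Real.exp univ := Real.exp_injective.injOn
  have i1 := (integrableOn_image_iff_integrableOn_abs_deriv_smul MeasurableSet.univ hd hinj u).1
    (by rwa [himg])
  have i2 := (integrableOn_image_iff_integrableOn_abs_deriv_smul MeasurableSet.univ hd hinj
    (fun s => u s + s • u' s)).1 (by rwa [himg])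
  have i3 := integral_image_eq_integral_abs_deriv_smul MeasurableSet.univ hd hinj
    (fun s => u s + s • u' s)
  rw [himg] at i3
  rw [i3]
  simp only [Real.abs_exp, integrableOn_univ, Measure.restrict_univ] at i1 i2 ⊢
  refine integral_eq_zero_of_hasDerivAt_of_integrable (f := fun x => Real.exp x • u (Real.exp x))
    (fun x => ?_) i2 i1
  have := (Real.hasDerivAt_exp x).fun_smul
    ((hu (Real.exp x) (Real.exp_pos x)).scomp x (Real.hasDerivAt_exp x))
  refine this.congr_deriv ?_
  simp only [Function.comp, smul_add]
  rw [add_comm]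

end Scaling

section Logarithm

variable {A : Type*} [NormedCommRing A] [NormedAlgebra ℂ A] [CompleteSpace A]

/-- If `Y = exp Q` is differentiable and the increments of `Q` between almost all points are
integrals of `ρ`, then `Y' = Y ρ` almost everywhere. -/
theorem ae_hasDerivAt_of_exp {Y Q ρ : ℝ → A} (hY : ∀ s, 0 < s → DifferentiableAt ℝ Y s)
    (hexp : ∀ s, 0 < s → Y s = NormedSpace.exp (Q s))
    (hρ : ∀ a b, 0 < a → 0 < b → IntervalIntegrable ρ volume a b) {good : Set ℝ}
    (hgood : ∀ᵐ s ∂volume.restrict (Ioi (0 : ℝ)), s ∈ good)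
    (hQ : ∀ a ∈ good, ∀ b ∈ good, 0 < a → 0 < b → a ≤ b → Q b - Q a = ∫ s in a..b, ρ s) :
    ∀ᵐ s ∂volume.restrict (Ioi (0 : ℝ)), HasDerivAt Y (Y s * ρ s) s := by
  let _ : NormedAlgebra ℚ A := NormedAlgebra.restrictScalars ℚ ℂ A
  have hQ' : ∀ a ∈ good, ∀ b ∈ good, 0 < a → 0 < b → Q b = Q a + ∫ s in a..b, ρ s := by
    intro a ha b hb ha0 hb0
    rcases le_total a b with hab | hab
    · rw [← hQ a ha b hb ha0 hb0 hab]; abel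
    · rw [intervalIntegral.integral_symm, ← hQ b hb a ha hb0 ha0 hab]; abel
  obtain ⟨a, ha, ha0⟩ : ∃ a, a ∈ good ∧ 0 < a := by
    have hne : (ae (volume.restrict (Ioi (0 : ℝ)))).NeBot := by
      rw [ae_neBot, Ne, Measure.restrict_eq_zero]; simp
    exact (hgood.and (ae_restrict_mem measurableSet_Ioi)).exists
  have hcont : ∀ s, 0 < s → ContinuousAt (fun s => ∫ t in a..s, ρ t) s := by
    intro s hs
    have hc := intervalIntegral.continuousOn_primitive_interval' (μ := volume) (f := ρ)
      (b₁ := min a s / 2) (b₂ := max a s + 1) (a := a)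
      (hρ _ _ (by positivity) (by positivity)) (by
        rw [uIcc_of_le (by
          have := min_le_left a s; have := le_max_left a s; linarith)]
        exact ⟨by have := min_le_left a s; linarith, by have := le_max_left a s; linarith⟩)
    refine hc.continuousAt (Filter.mem_of_superset (Ioo_mem_nhds (a := min a s / 2)
      (b := max a s + 1) ?_ ?_) ?_)
    · have := min_le_right a s; have := lt_min ha0 hs; linarith
    · have := le_max_right a s; linarith
    · exact Ioo_subset_Icc_self.trans Icc_subset_uIcc
  have hYeq : EqOn Y (fun s => Y a * NormedSpace.exp (∫ t in a..s, ρ t)) (Ioi 0) := by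
    refine Measure.eqOn_open_of_ae_eq (μ := volume) ?_ isOpen_Ioi
      (fun s hs => (hY s hs).continuousAt.continuousWithinAt) fun s hs => ?_
    · filter_upwards [hgood, ae_restrict_mem measurableSet_Ioi] with s hs hs0
      rw [hexp s hs0, hexp a ha0, hQ' a ha s hs ha0 hs0, NormedSpace.exp_add]
    · exact (continuousAt_const.mul ((NormedSpace.exp_continuous.continuousAt).comp
        (hcont s hs))).continuousWithinAt
  have hleb : ∀ᵐ s, ∀ n : ℕ, s ∈ uIcc (1 / (n + 1 : ℝ)) (n + 1) →
      ∀ c ∈ uIcc (1 / (n + 1 : ℝ)) (n + 1), HasDerivAt (fun x => ∫ t in c..x, ρ t) (ρ s) s :=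
    ae_all_iff.2 fun n => (hρ _ _ (by positivity) (by positivity)).ae_hasDerivAt_integral
  filter_upwards [ae_restrict_of_ae hleb, ae_restrict_mem measurableSet_Ioi] with s hs hs0
  obtain ⟨n, hn⟩ := exists_nat_ge (max (max a s) (max (1 / a) (1 / s)))
  have hmem : ∀ x : ℝ, 0 < x → x ≤ n → 1 / x ≤ n → x ∈ uIcc (1 / (n + 1 : ℝ)) (n + 1) := by
    intro x hx h1 h2
    refine Icc_subset_uIcc ⟨?_, by linarith⟩
    rw [div_le_iff₀ (by positivity)]
    rw [div_le_iff₀ hx] at h2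
    nlinarith
  simp only [max_le_iff] at hn
  have hd := hs n (hmem s hs0 hn.1.2 hn.2.2) a (hmem a ha0 hn.1.1 hn.2.1)
  have he : HasDerivAt (fun x => Y a * NormedSpace.exp (∫ t in a..x, ρ t))
      (Y a * (NormedSpace.exp (∫ t in a..s, ρ t) * ρ s)) s := by
    have h1 := (hasFDerivAt_exp (𝕂 := ℝ) (x := ∫ t in a..s, ρ t)).comp_hasDerivAt s hd
    exact (h1.const_mul (Y a)).congr_deriv (by simp)
  refine (he.congr_of_eventuallyEq (hYeq.eventuallyEq_of_mem (Ioi_mem_nhds hs0))).congr_deriv ?_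
  rw [hYeq hs0, mul_assoc]

end Logarithm

section Increments

variable {ι : Type*} [MeasurableSpace ι] [Countable ι] [MeasurableSingletonClass ι]
  {A : Type*} [NormedAddCommGroup A] [NormedSpace ℂ A]

/-- For a kernel `k(s, y)` on the rays that is homogeneous of degree `-1` in the two ray parameters,
the increments of `s ↦ ∫ k(s, y) G(y) dy` are the integrals, with respect to `ds / s`, of
`∫ k(s, y) s'∂_{s'}G(y) dy`. Scaling `s'` by `s` moves the whole dependence on `s` into `G`. -/
theorem integral_kernel_sub_eq [CompleteSpace A] {k : ℝ → ι × ℝ → ℂ} {G DG : ι × ℝ → A}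
    (hk : ∀ (r s : ℝ) (y : ι × ℝ), 0 < r → 0 < s → 0 < y.2 → (r : ℂ) * k (r * s) (y.1, r * y.2) = k s y)
    (hkm : Measurable (Function.uncurry k))
    (hG : ∀ i s, 0 < s → HasDerivAt (fun r => G (i, r)) ((s⁻¹ : ℝ) • DG (i, s)) s)
    (hDm : StronglyMeasurable DG) (hDi : ∀ i, IntegrableOn (fun s => DG (i, s)) (Ioi 0))
    {a b : ℝ} (ha : 0 < a) (hab : a ≤ b)
    (hI : Integrable (fun w : ℝ × (ι × ℝ) => k w.1 w.2 • DG w.2)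
      ((volume.restrict (Ioc a b)).prod (rayMeasure ι)))
    (hQa : Integrable (fun y => k a y • G y) (rayMeasure ι))
    (hQb : Integrable (fun y => k b y • G y) (rayMeasure ι)) :
    ∫ y, k b y • G y ∂rayMeasure ι - ∫ y, k a y • G y ∂rayMeasure ι =
      ∫ s in a..b, (s⁻¹ : ℝ) • ∫ y, k s y • DG y ∂rayMeasure ι := by
  have hb : 0 < b := ha.trans_le hab
  have hk1 : ∀ (s : ℝ) (y : ι × ℝ), 0 < s → 0 < y.2 → k 1 y = (s : ℂ) * k s (y.1, s * y.2) := by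
    intro s y hs hy
    have := hk s 1 y hs one_pos hy
    rw [mul_one] at this
    exact this.symm
  -- the integrand after scaling
  set Ψ : ℝ × (ι × ℝ) → A := fun w =>
    k 1 w.2 • (w.1⁻¹ : ℝ) • DG (w.2.1, w.1 * w.2.2) with hΨ
  have hΨm : StronglyMeasurable Ψ := by
    have h1 : Measurable fun w : ℝ × (ι × ℝ) => k 1 w.2 :=
      hkm.comp (measurable_const.prodMk measurable_snd)
    have h2 : Measurable fun w : ℝ × (ι × ℝ) => ((w.2.1, w.1 * w.2.2) : ι × ℝ) := by fun_prop
    exact h1.stronglyMeasurable.smul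
      (measurable_fst.inv.stronglyMeasurable.smul (hDm.comp_measurable h2))
  have hscale : ∀ s, 0 < s → ∀ y : ι × ℝ, 0 < y.2 → Ψ (s, y) =
      (fun y : ι × ℝ => k s y • DG y) (y.1, s * y.2) := by
    intro s hs y hy
    simp only [hΨ]
    rw [hk1 s y hs hy, mul_comm, mul_smul, ← Complex.coe_smul, smul_smul ((s : ℂ)), Complex.ofReal_inv,
      mul_inv_cancel₀ (by exact_mod_cast hs.ne'), one_smul]
  have hpos : ∀ᵐ s ∂volume.restrict (Ioc a b), 0 < s := by
    filter_upwards [ae_restrict_mem measurableSet_Ioc] with s hs using ha.trans hs.1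
  have hΨs : ∀ s, 0 < s → (fun y => Ψ (s, y)) =ᵐ[rayMeasure ι]
      fun y => (fun y : ι × ℝ => k s y • DG y) (y.1, s * y.2) := fun s hs => by
    filter_upwards [ae_rayMeasure_pos] with y hy using hscale s hs y hy
  have hΨI : Integrable Ψ ((volume.restrict (Ioc a b)).prod (rayMeasure ι)) := by
    rw [integrable_prod_iff hΨm.aestronglyMeasurable]
    constructor
    · filter_upwards [hI.prod_right_ae, hpos] with s hs hs0
      exact (integrable_rayMeasure_comp_mul hs hs0).congr (hΨs s hs0).symm
    · have h1 := hI.norm.integral_prod_left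
      have h2 : Integrable (fun s : ℝ => s⁻¹ * ∫ y, ‖k s y • DG y‖ ∂rayMeasure ι)
          (volume.restrict (Ioc a b)) := by
        refine h1.bdd_mul (c := a⁻¹) measurable_inv.aestronglyMeasurable ?_
        filter_upwards [ae_restrict_mem measurableSet_Ioc] with s hs
        rw [norm_inv, Real.norm_of_nonneg (ha.trans hs.1).le]
        exact inv_anti₀ ha hs.1.le
      refine h2.congr ?_
      filter_upwards [hpos, hI.prod_right_ae] with s hs hs1
      have := integral_rayMeasure_comp_mul hs1.norm hs
      rw [smul_eq_mul] at this
      rw [← this]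
      refine integral_congr_ae ?_
      filter_upwards [hΨs s hs] with y hy
      rw [hy]
  have hL : ∫ s in Ioc a b, ∫ y, Ψ (s, y) ∂rayMeasure ι =
      ∫ s in a..b, (s⁻¹ : ℝ) • ∫ y, k s y • DG y ∂rayMeasure ι := by
    rw [intervalIntegral.integral_of_le hab]
    refine integral_congr_ae ?_
    filter_upwards [hpos, hI.prod_right_ae] with s hs hs1
    rw [← integral_rayMeasure_comp_mul hs1 hs]
    exact integral_congr_ae (hΨs s hs)
  rw [← hL, integral_integral_swap hΨI]
  have hinner : ∀ᵐ y ∂rayMeasure ι, ∫ s in Ioc a b, Ψ (s, y) =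
      k 1 y • G (y.1, b * y.2) - k 1 y • G (y.1, a * y.2) := by
    filter_upwards [ae_rayMeasure_pos] with y hy
    rw [← smul_sub]
    simp only [hΨ]
    rw [integral_smul, ← intervalIntegral.integral_of_le hab]
    congr 1
    refine intervalIntegral.integral_eq_sub_of_hasDerivAt (f := fun s => G (y.1, s * y.2))
      (fun s hs => ?_) ?_
    · have hs0 : 0 < s := by
        rw [uIcc_of_le hab] at hs; exact ha.trans_le hs.1
      refine ((hG y.1 (s * y.2) (by positivity)).scomp s (hasDerivAt_mul_const y.2)).congr_deriv ?_
      rw [smul_smul]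
      congr 1
      field_simp
    · rw [intervalIntegrable_iff_integrableOn_Ioc_of_le hab]
      have h1 : IntegrableOn (fun s => DG (y.1, s * y.2)) (Ioi 0) := by
        have := (integrableOn_Ioi_comp_mul_left_iff (fun s => DG (y.1, s)) 0 hy).2
          (by rw [mul_zero]; exact hDi y.1)
        simpa only [mul_comm] using this
      have h2 := h1.mono_set (Ioc_subset_Ioi_self.trans (Ioi_subset_Ioi ha.le) : Ioc a b ⊆ Ioi 0)
      refine Integrable.bdd_smul (𝕜 := ℝ) (φ := fun s => s⁻¹) h2 a⁻¹
        measurable_inv.aestronglyMeasurable ?_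
      filter_upwards [ae_restrict_mem measurableSet_Ioc] with s hs
      rw [norm_inv, Real.norm_of_nonneg (ha.trans hs.1).le]
      exact inv_anti₀ ha hs.1.le
  rw [integral_congr_ae hinner]
  have hQ : ∀ s, 0 < s → Integrable (fun y => k s y • G y) (rayMeasure ι) →
      Integrable (fun y : ι × ℝ => k 1 y • G (y.1, s * y.2)) (rayMeasure ι) ∧
      ∫ y, k 1 y • G (y.1, s * y.2) ∂rayMeasure ι = ∫ y, k s y • G y ∂rayMeasure ι := by
    intro s hs hi
    have e : (fun y : ι × ℝ => k 1 y • G (y.1, s * y.2)) =ᵐ[rayMeasure ι]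
        fun y => (s : ℝ) • (fun y : ι × ℝ => k s y • G y) (y.1, s * y.2) := by
      filter_upwards [ae_rayMeasure_pos] with y hy
      rw [hk1 s y hs hy, mul_smul, Complex.coe_smul]
    refine ⟨((integrable_rayMeasure_comp_mul hi hs).smul s).congr e.symm, ?_⟩
    rw [integral_congr_ae e, integral_smul, integral_rayMeasure_comp_mul hi hs, smul_smul,
      mul_inv_cancel₀ hs.ne', one_smul]
  rw [integral_sub (hQ b hb hQb).1 (hQ a ha hQa).1, (hQ b hb hQb).2, (hQ a ha hQa).2]

end Increments

/-! ### The integral equations with values in a commutative Banach algebra -/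

theorem lin_add (γ : Lat m) (v w : Cpx m) : lin γ (v + w) = lin γ v + lin γ w := by
  simp [lin, mul_add, Finset.sum_add_distrib]

theorem lin_smul (γ : Lat m) (r : ℂ) (v : Cpx m) : lin γ (r • v) = r * lin γ v := by
  simp only [lin, Pi.smul_apply, smul_eq_mul, Finset.mul_sum]
  exact Finset.sum_congr rfl fun _ _ => by ring

theorem lin_single (γ : Lat m) (a : Fin m) : lin γ (Pi.single a 1) = (γ a : ℂ) := by
  simp [lin, Pi.single_apply]

/-- `lin γ` as a continuous linear functional. -/
def linL (γ : Lat m) : Cpx m →L[ℂ] ℂ :=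
  LinearMap.toContinuousLinearMap
    { toFun := lin γ
      map_add' := lin_add γ
      map_smul' := fun r v => lin_smul γ r v }

@[simp] theorem linL_apply (γ : Lat m) (v : Cpx m) : linL γ v = lin γ v := rfl

theorem pairing_swap {ω : Matrix (Fin m) (Fin m) ℤ} (hω : ω.transpose = -ω) (γ γ' : Lat m) :
    pairing ω γ' γ = -pairing ω γ γ' := by
  have h : ∀ a b, ω b a = -ω a b := fun a b => by
    have := congrFun (congrFun hω a) b
    simpa using this
  unfold pairing
  rw [Finset.sum_comm, ← Finset.sum_neg_distrib]
  refine Finset.sum_congr rfl fun a _ => ?_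
  rw [← Finset.sum_neg_distrib]
  refine Finset.sum_congr rfl fun b _ => ?_
  rw [h]; ring

section Kernel

variable {ι : Type*}

/-- The kernel of the integral equations in the ray parameters, divided by both central charges:
`⟨γ, γ'⟩ / (2πi) / (s Z_{γ'} - s' Z_γ)` at `x = (γ, s)`, `y = (γ', s')`. It is symmetric in `x`
and `y`. -/
def rayKern (ω : Matrix (Fin m) (Fin m) ℤ) (q : ι → Lat m) (x y : ι × ℝ) (z : Cpx m) : ℂ :=
  (pairing ω (q x.1) (q y.1) : ℂ) / (2 * Real.pi * I) /
    (x.2 * lin (q y.1) z - y.2 * lin (q x.1) z)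

theorem rayKern_symm {ω : Matrix (Fin m) (Fin m) ℤ} (hω : ω.transpose = -ω) (q : ι → Lat m)
    (x y : ι × ℝ) (z : Cpx m) : rayKern ω q y x z = rayKern ω q x y z := by
  unfold rayKern
  rw [pairing_swap hω (q x.1) (q y.1), ← neg_sub (x.2 * lin (q y.1) z), div_neg]
  push_cast
  ring

theorem rayKern_mul (ω : Matrix (Fin m) (Fin m) ℤ) (q : ι → Lat m) (r : ℝ) (hr : r ≠ 0)
    (i : ι) (s : ℝ) (y : ι × ℝ) (z : Cpx m) :
    (r : ℂ) * rayKern ω q (i, r * s) (y.1, r * y.2) z = rayKern ω q (i, s) y z := by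
  unfold rayKern
  have : ((r * s : ℝ) : ℂ) * lin (q y.1) z - ((r * y.2 : ℝ) : ℂ) * lin (q i) z =
      r * (s * lin (q y.1) z - y.2 * lin (q i) z) := by push_cast; ring
  simp only [this]
  have hr' : (r : ℂ) ≠ 0 := by exact_mod_cast hr
  rw [← div_div _ (r : ℂ), div_right_comm _ (r : ℂ), mul_div_cancel₀ _ hr']

variable [MeasurableSpace ι] [Countable ι] [MeasurableSingletonClass ι]

theorem measurable_quotient_kernel (f : ι → ι → ℂ) (g : ι → ℂ) :
    Measurable fun w : (ι × ℝ) × (ι × ℝ) =>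
      f w.1.1 w.2.1 / (w.1.2 * g w.2.1 - w.2.2 * g w.1.1) := by
  have h1 : Measurable fun v : ι × ι => f v.1 v.2 := measurable_of_countable _
  have h2 : Measurable g := measurable_of_countable _
  have h3 : Measurable fun w : (ι × ℝ) × (ι × ℝ) => f w.1.1 w.2.1 := by
    have h : Measurable fun w : (ι × ℝ) × (ι × ℝ) => (w.1.1, w.2.1) := by fun_prop
    exact h1.comp h
  fun_prop

theorem measurable_rayKern (ω : Matrix (Fin m) (Fin m) ℤ) (q : ι → Lat m) (z : Cpx m) :
    Measurable fun w : (ι × ℝ) × (ι × ℝ) => rayKern ω q w.1 w.2 z :=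
  measurable_quotient_kernel (fun i j => (pairing ω (q i) (q j) : ℂ) / (2 * Real.pi * I))
    fun i => lin (q i) z

theorem measurable_lin (q : ι → Lat m) (z : Cpx m) : Measurable fun x : ι × ℝ => lin (q x.1) z :=
  (measurable_of_countable fun i => lin (q i) z).comp measurable_fst

/-- The integral operator on the rays with kernel `rayKern`. -/
def rayConv {A : Type*} [NormedAddCommGroup A] [NormedSpace ℂ A] (ω : Matrix (Fin m) (Fin m) ℤ)
    (q : ι → Lat m) (z : Cpx m) (u : ι × ℝ → A) (x : ι × ℝ) : A :=
  ∫ y, rayKern ω q x y z • u y ∂rayMeasure ι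

end Kernel

section Core

variable {ι : Type*} [MeasurableSpace ι] [Countable ι] [MeasurableSingletonClass ι]
  {A : Type*} [NormedCommRing A] [NormedAlgebra ℂ A]

/-- The weighted unknown `c(γ) g(X_γ)` at the point `x = (γ, s)` of the rays. -/
def wt (c : ι → A) (g : A → A) (X : ι → ℝ → Cpx m × Cpx m → A) (x : ι × ℝ)
    (p : Cpx m × Cpx m) : A :=
  c x.1 * g (X x.1 x.2 p)

/-- The scaling derivative `s ∂_s` of `wt`. -/
def wtD (c : ι → A) (g : A → A) (X : ι → ℝ → Cpx m × Cpx m → A) (x : ι × ℝ)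
    (p : Cpx m × Cpx m) : A :=
  c x.1 * (x.2 • deriv (fun r : ℝ => g (X x.1 r p)) x.2)

/-- The logarithmic derivative `c X g'(X)`, by which `d log X` has to be multiplied to give the
differential of `wt`. -/
def fac (c : ι → A) (g : A → A) (X : ι → ℝ → Cpx m × Cpx m → A) (x : ι × ℝ)
    (p : Cpx m × Cpx m) : A :=
  c x.1 * (fderiv ℂ g (X x.1 x.2 p) 1 * X x.1 x.2 p)

/-- Solutions of the integral equations over an open set `B` of parameters `(z, θ)`, with values in
a commutative Banach algebra `A` and weights `c i ∈ A`, for charges `q i` that are all active, with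
majorants that are uniform on all of `B`: `N` for the weighted unknown and its scaling derivative,
`N'` for the weighted values of `h`, and `κ` for the kernel. At the values `X` of the solution, `g`
and `h` have derivatives that are multiplications by elements of `A`, and `x h'(x) = g(x)`. -/
structure UniformSolution (ω : Matrix (Fin m) (Fin m) ℤ) (q : ι → Lat m) (σ : ι → ℂ) (c : ι → A)
    (g h : A → A) (B : Set (Cpx m × Cpx m)) (X : ι → ℝ → Cpx m × Cpx m → A)
    (N N' : ι × ℝ → ℝ) (κ : ι × ℝ → ι × ℝ → ℝ) : Prop where
  skew : ω.transpose = -ω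
  isOpen : IsOpen B
  support : ∃ C : ℝ, 0 ≤ C ∧ ∀ p ∈ B, ∀ i, (∀ a, ‖(q i a : ℂ)‖ ≤ C * ‖lin (q i) p.1‖) ∧
    1 ≤ C * ‖lin (q i) p.1‖
  offWalls : ∀ p ∈ B, ∀ i j, pairing ω (q i) (q j) ≠ 0 → ∀ s s' : ℝ, 0 < s → 0 < s' →
    (s : ℂ) * lin (q j) p.1 - s' * lin (q i) p.1 ≠ 0
  sigma_ne_zero : ∀ i, σ i ≠ 0
  regular : ∀ p ∈ B, ∀ i, ∀ s : ℝ, 0 < s → ∃ φ ψ : A,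
    HasFDerivAt g (φ • (1 : A →L[ℂ] A)) (X i s p) ∧
    HasFDerivAt h (ψ • (1 : A →L[ℂ] A)) (X i s p) ∧ ψ * X i s p = g (X i s p)
  ne_zero : ∀ p ∈ B, ∀ x : ι × ℝ, 0 < x.2 → wt c g X x p ≠ 0
  tba : ∀ p ∈ B, ∀ i, ∀ s : ℝ, 0 < s → X i s p =
    (σ i * exp (2 * Real.pi * I * lin (q i) p.2 - 2 * Real.pi * s)) • NormedSpace.exp
      (∑' j, ∫ s' in Ioi (0 : ℝ),
        (lin (q i) p.1 * rayKern ω q (i, s) (j, s') p.1) • wt c g X (j, s') p)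
  holomorphic : ∀ i, ∀ s : ℝ, 0 < s → DifferentiableOn ℂ (X i s) B
  differentiable : ∀ p ∈ B, ∀ i, ∀ s : ℝ, 0 < s → DifferentiableAt ℝ (fun r => X i r p) s
  bound_wt : ∀ p ∈ B, ∀ x : ι × ℝ, 0 < x.2 → ‖wt c g X x p‖ ≤ N x
  bound_wtD : ∀ p ∈ B, ∀ x : ι × ℝ, 0 < x.2 → ‖wtD c g X x p‖ ≤ N x
  bound_h : ∀ p ∈ B, ∀ x : ι × ℝ, 0 < x.2 → ‖c x.1 * h (X x.1 x.2 p)‖ ≤ N' x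
  bound_kern : ∀ p ∈ B, ∀ x y : ι × ℝ, 0 < x.2 → 0 < y.2 → ‖rayKern ω q x y p.1‖ ≤ κ x y
  integrable : Integrable (fun x => (1 + x.2) * N x) (rayMeasure ι)
  integrable_h : Integrable N' (rayMeasure ι)
  integrable_prod : Integrable (fun w : (ι × ℝ) × (ι × ℝ) =>
    (1 + w.1.2) * (N w.1 * κ w.1 w.2 * N w.2)) ((rayMeasure ι).prod (rayMeasure ι))

/-- Functions on the rays that are bounded by a multiple of the majorant `N`. -/
def Adm (N : ι × ℝ → ℝ) (u : ι × ℝ → A) : Prop :=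
  AEStronglyMeasurable u (rayMeasure ι) ∧ ∃ C, 0 ≤ C ∧ ∀ᵐ x ∂rayMeasure ι, ‖u x‖ ≤ C * N x

/-- Variations `u` of the weighted unknown that solve the linearized integral equation with
inhomogeneity `r`: the variation of `log X` is `r + Z ∫ K u`. -/
def IsTangent (ω : Matrix (Fin m) (Fin m) ℤ) (q : ι → Lat m) (c : ι → A) (g : A → A)
    (X : ι → ℝ → Cpx m × Cpx m → A) (N : ι × ℝ → ℝ) (p : Cpx m × Cpx m)
    (u : ι × ℝ → A) (r : ι × ℝ → ℂ) : Prop :=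
  Adm N u ∧ Measurable r ∧
    (∃ C, 0 ≤ C ∧ ∀ x : ι × ℝ, 0 < x.2 → ‖r x / lin (q x.1) p.1‖ ≤ C * (1 + x.2)) ∧
    ∀ᵐ x ∂rayMeasure ι,
      u x = fac c g X x p * (algebraMap ℂ A (r x) + lin (q x.1) p.1 • rayConv ω q p.1 u x)

variable {ω : Matrix (Fin m) (Fin m) ℤ} {q : ι → Lat m} {σ : ι → ℂ} {c : ι → A} {g h : A → A}
  {B : Set (Cpx m × Cpx m)} {X : ι → ℝ → Cpx m × Cpx m → A} {N N' : ι × ℝ → ℝ}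
  {κ : ι × ℝ → ι × ℝ → ℝ}

namespace UniformSolution

variable (S : UniformSolution ω q σ c g h B X N N' κ) {p : Cpx m × Cpx m}

include S

theorem lin_ne_zero (hp : p ∈ B) (i : ι) : lin (q i) p.1 ≠ 0 := by
  obtain ⟨C, -, hC⟩ := S.support
  intro h0
  have := (hC p hp i).2
  rw [h0, norm_zero, mul_zero] at this
  linarith

theorem N_pos (hp : p ∈ B) {x : ι × ℝ} (hx : 0 < x.2) : 0 < N x :=
  (norm_pos_iff.2 (S.ne_zero p hp x hx)).trans_le (S.bound_wt p hp x hx)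

theorem kern_nonneg (hp : p ∈ B) {x y : ι × ℝ} (hx : 0 < x.2) (hy : 0 < y.2) : 0 ≤ κ x y :=
  (norm_nonneg _).trans (S.bound_kern p hp x y hx hy)

theorem integrable_kern (hp : p ∈ B) :
    ∀ᵐ x ∂rayMeasure ι, Integrable (fun y => κ x y * N y) (rayMeasure ι) := by
  filter_upwards [S.integrable_prod.prod_right_ae, ae_rayMeasure_pos] with x hx hx0
  have hN := (S.N_pos hp hx0).ne'
  have h1 : (1 + x.2) * N x ≠ 0 := by
    have := S.N_pos hp hx0; positivity
  refine (hx.const_mul ((1 + x.2) * N x)⁻¹).congr (Filter.Eventually.of_forall fun y => ?_)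
  field_simp

theorem integrable_N : Integrable N (rayMeasure ι) := by
  have hm : Measurable fun x : ι × ℝ => (1 + x.2)⁻¹ :=
    (measurable_const.add measurable_snd).inv
  refine (S.integrable.bdd_mul (c := 1) hm.aestronglyMeasurable ?_).congr ?_
  · filter_upwards [ae_rayMeasure_pos] with x hx
    rw [norm_inv, Real.norm_of_nonneg (by positivity)]
    exact inv_le_one_of_one_le₀ (by linarith)
  · filter_upwards [ae_rayMeasure_pos] with x hx
    have : 1 + x.2 ≠ 0 := by positivity
    field_simp

/-- A coefficient of growth at most `1 + s` times an admissible function is integrable. -/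
theorem integrable_smul (hp : p ∈ B) {u : ι × ℝ → A} (hu : Adm N u) {a : ι × ℝ → ℂ}
    (ha : Measurable a) {C : ℝ} (hC : ∀ x : ι × ℝ, 0 < x.2 → ‖a x‖ ≤ C * (1 + x.2)) :
    Integrable (fun x => a x • u x) (rayMeasure ι) := by
  obtain ⟨hm, C', hC'0, hC'⟩ := hu
  refine (S.integrable.const_mul (C * C')).mono' (ha.aestronglyMeasurable.smul hm) ?_
  filter_upwards [hC', ae_rayMeasure_pos] with x hx hx0
  have hN := S.N_pos hp hx0
  rw [norm_smul]
  calc ‖a x‖ * ‖u x‖ ≤ (C * (1 + x.2)) * (C' * N x) :=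
        mul_le_mul (hC x hx0) hx (norm_nonneg _) ((norm_nonneg _).trans (hC x hx0))
    _ = _ := by ring

theorem integrable_kern_smul (hp : p ∈ B) {u : ι × ℝ → A} (hu : Adm N u) {x : ι × ℝ}
    (hx0 : 0 < x.2) (hx : Integrable (fun y => κ x y * N y) (rayMeasure ι)) :
    Integrable (fun y => rayKern ω q x y p.1 • u y) (rayMeasure ι) := by
  obtain ⟨hm, C', hC'0, hC'⟩ := hu
  refine (hx.const_mul C').mono'
    (((measurable_rayKern ω q p.1).comp measurable_prodMk_left).aestronglyMeasurable.smul hm) ?_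
  filter_upwards [hC', ae_rayMeasure_pos] with y hy hy0
  rw [norm_smul]
  calc _ ≤ κ x y * (C' * N y) := mul_le_mul (S.bound_kern p hp x y hx0 hy0) hy (norm_nonneg _)
        (S.kern_nonneg hp hx0 hy0)
    _ = _ := by ring

theorem integrable_pair (hp : p ∈ B) {u v : ι × ℝ → A} (hu : Adm N u) (hv : Adm N v)
    {a : ι × ℝ → ℂ} (ha : Measurable a) {C : ℝ}
    (hC : ∀ x : ι × ℝ, 0 < x.2 → ‖a x‖ ≤ C * (1 + x.2)) :
    Integrable (fun w : (ι × ℝ) × (ι × ℝ) => (a w.1 * rayKern ω q w.1 w.2 p.1) • (u w.1 * v w.2))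
      ((rayMeasure ι).prod (rayMeasure ι)) := by
  obtain ⟨hm, C', hC'0, hC'⟩ := hu
  obtain ⟨hm', C'', hC''0, hC''⟩ := hv
  refine (S.integrable_prod.const_mul (C * (C' * C''))).mono'
    (((ha.comp measurable_fst).mul (measurable_rayKern ω q p.1)).aestronglyMeasurable.smul
      (hm.comp_fst.mul hm'.comp_snd)) ?_
  have h1 : ∀ᵐ w ∂(rayMeasure ι).prod (rayMeasure ι), 0 < w.1.2 ∧ ‖u w.1‖ ≤ C' * N w.1 :=
    Measure.quasiMeasurePreserving_fst.ae (ae_rayMeasure_pos.and hC')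
  have h2 : ∀ᵐ w ∂(rayMeasure ι).prod (rayMeasure ι), 0 < w.2.2 ∧ ‖v w.2‖ ≤ C'' * N w.2 :=
    Measure.quasiMeasurePreserving_snd.ae (ae_rayMeasure_pos.and hC'')
  filter_upwards [h1, h2] with w hw1 hw2
  have hN1 := S.N_pos hp hw1.1
  have hN2 := S.N_pos hp hw2.1
  rw [norm_smul, norm_mul]
  calc _ ≤ ((C * (1 + w.1.2)) * κ w.1 w.2) * ((C' * N w.1) * (C'' * N w.2)) := by
        refine mul_le_mul (mul_le_mul (hC _ hw1.1) (S.bound_kern p hp _ _ hw1.1 hw2.1)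
          (norm_nonneg _) ((norm_nonneg _).trans (hC _ hw1.1))) ?_ (norm_nonneg _)
          (mul_nonneg ((norm_nonneg _).trans (hC _ hw1.1)) (S.kern_nonneg hp hw1.1 hw2.1))
        exact (norm_mul_le _ _).trans (mul_le_mul hw1.2 hw2.2 (norm_nonneg _) (by positivity))
    _ = _ := by ring

variable [CompleteSpace A]

theorem integral_mul_rayConv (hp : p ∈ B) {u v : ι × ℝ → A} (hu : Adm N u) (hv : Adm N v)
    {a : ι × ℝ → ℂ} (ha : Measurable a) {C : ℝ}
    (hC : ∀ x : ι × ℝ, 0 < x.2 → ‖a x‖ ≤ C * (1 + x.2)) :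
    Integrable (fun x => a x • (u x * rayConv ω q p.1 v x)) (rayMeasure ι) ∧
    ∫ x, a x • (u x * rayConv ω q p.1 v x) ∂rayMeasure ι =
      ∫ w, (a w.1 * rayKern ω q w.1 w.2 p.1) • (u w.1 * v w.2)
        ∂(rayMeasure ι).prod (rayMeasure ι) := by
  have hI := S.integrable_pair hp hu hv ha hC
  have e : (fun x => ∫ y, (a x * rayKern ω q x y p.1) • (u x * v y) ∂rayMeasure ι)
      =ᵐ[rayMeasure ι] fun x => a x • (u x * rayConv ω q p.1 v x) := by
    filter_upwards [S.integrable_kern hp, ae_rayMeasure_pos] with x hx hx0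
    have h1 := S.integrable_kern_smul hp hv hx0 hx
    have h2 := (ContinuousLinearMap.mul ℂ A (u x)).integral_comp_comm h1
    simp only [ContinuousLinearMap.mul_apply'] at h2
    rw [rayConv, ← h2, ← integral_smul]
    refine integral_congr_ae (Filter.Eventually.of_forall fun y => ?_)
    simp only [mul_smul, mul_smul_comm]
  refine ⟨hI.integral_prod_left.congr e, ?_⟩
  rw [integral_prod _ hI]
  exact (integral_congr_ae e).symm

/-- The integral operator is symmetric. -/
theorem integral_mul_rayConv_comm (hp : p ∈ B) {u v : ι × ℝ → A} (hu : Adm N u)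
    (hv : Adm N v) :
    ∫ x, u x * rayConv ω q p.1 v x ∂rayMeasure ι =
      ∫ x, v x * rayConv ω q p.1 u x ∂rayMeasure ι := by
  have h : ∀ x : ι × ℝ, 0 < x.2 → ‖(1 : ℂ)‖ ≤ 1 * (1 + x.2) := fun x hx => by
    rw [norm_one]; linarith
  have h1 := (S.integral_mul_rayConv hp hu hv (a := fun _ => 1) measurable_const h).2
  have h2 := (S.integral_mul_rayConv hp hv hu (a := fun _ => 1) measurable_const h).2
  simp only [one_smul, one_mul] at h1 h2
  rw [h1, h2, ← integral_prod_swap]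
  refine integral_congr_ae (Filter.Eventually.of_forall fun w => ?_)
  simp only [Prod.fst_swap, Prod.snd_swap]
  rw [rayKern_symm S.skew, mul_comm]

/-- Green's formula at a point of the rays. -/
theorem tangent_wronskian (hp : p ∈ B) {u v : ι × ℝ → A} {r t : ι × ℝ → ℂ}
    (hu : IsTangent ω q c g X N p u r) (hv : IsTangent ω q c g X N p v t) :
    ∀ᵐ x ∂rayMeasure ι, u x * rayConv ω q p.1 v x - v x * rayConv ω q p.1 u x =
      (r x / lin (q x.1) p.1) • v x - (t x / lin (q x.1) p.1) • u x := by
  filter_upwards [hu.2.2.2, hv.2.2.2] with x hx hy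
  have hZ := S.lin_ne_zero hp x.1
  have key : u x * (algebraMap ℂ A (t x) + lin (q x.1) p.1 • rayConv ω q p.1 v x) =
      v x * (algebraMap ℂ A (r x) + lin (q x.1) p.1 • rayConv ω q p.1 u x) := by
    have e1 := congrArg (· * (algebraMap ℂ A (t x) + lin (q x.1) p.1 • rayConv ω q p.1 v x)) hx
    have e2 := congrArg (· * (algebraMap ℂ A (r x) + lin (q x.1) p.1 • rayConv ω q p.1 u x)) hy
    rw [e1, e2]; ring
  rw [mul_add, mul_add, mul_smul_comm, mul_smul_comm, ← Algebra.commutes, ← Algebra.commutes,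
    ← Algebra.smul_def, ← Algebra.smul_def] at key
  have k2 : lin (q x.1) p.1 • (u x * rayConv ω q p.1 v x - v x * rayConv ω q p.1 u x) =
      r x • v x - t x • u x := by
    rw [smul_sub, sub_eq_sub_iff_add_eq_add, add_comm, key, add_comm]
  rw [← inv_smul_smul₀ hZ (u x * rayConv ω q p.1 v x - v x * rayConv ω q p.1 u x), k2, smul_sub,
    smul_smul, smul_smul, div_eq_inv_mul, div_eq_inv_mul]

/-- Reciprocity: the linearized problem is symmetric, so inhomogeneities and responses may be
exchanged in pairings. -/
theorem reciprocity (hp : p ∈ B) {u v : ι × ℝ → A} {r t : ι × ℝ → ℂ}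
    (hu : IsTangent ω q c g X N p u r) (hv : IsTangent ω q c g X N p v t) :
    ∫ x, (r x / lin (q x.1) p.1) • v x ∂rayMeasure ι =
      ∫ x, (t x / lin (q x.1) p.1) • u x ∂rayMeasure ι := by
  obtain ⟨hua, hrm, ⟨C, hC0, hC⟩, -⟩ := id hu
  obtain ⟨hva, htm, ⟨C', hC'0, hC'⟩, -⟩ := id hv
  have hq := measurable_lin q p.1
  have i1 := S.integrable_smul hp hva (a := fun x => r x / lin (q x.1) p.1) (hrm.div hq) hC
  have i2 := S.integrable_smul hp hua (a := fun x => t x / lin (q x.1) p.1) (htm.div hq) hC'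
  have h : ∀ x : ι × ℝ, 0 < x.2 → ‖(1 : ℂ)‖ ≤ 1 * (1 + x.2) := fun x hx => by
    rw [norm_one]; linarith
  have j1 := (S.integral_mul_rayConv hp hua hva (a := fun _ => 1) measurable_const h).1
  have j2 := (S.integral_mul_rayConv hp hva hua (a := fun _ => 1) measurable_const h).1
  simp only [one_smul] at j1 j2
  rw [← sub_eq_zero, ← integral_sub i1 i2, ← integral_congr_ae (S.tangent_wronskian hp hu hv),
    integral_sub j1 j2, S.integral_mul_rayConv_comm hp hua hva, sub_self]

theorem ofReal_div_bound (hp : p ∈ B) : ∃ C : ℝ, 0 ≤ C ∧ ∀ x : ι × ℝ, 0 < x.2 →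
    ‖(x.2 : ℂ) / lin (q x.1) p.1‖ ≤ C * (1 + x.2) := by
  obtain ⟨C, hC0, hC⟩ := S.support
  refine ⟨C, hC0, fun x hx => ?_⟩
  have hZ : 0 < ‖lin (q x.1) p.1‖ := norm_pos_iff.2 (S.lin_ne_zero hp x.1)
  rw [norm_div, Complex.norm_of_nonneg hx.le, div_le_iff₀ hZ]
  have := (hC p hp x.1).2
  nlinarith

/-- The pairing of two tangent vectors through `⟨γ, γ'⟩ / (Z_γ Z_{γ'})`. This kernel is the
commutator of `rayKern` with the multiplication by `s / Z`, up to the factor `2πi`. -/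
theorem commutator (hp : p ∈ B) {u v : ι × ℝ → A} {r t : ι × ℝ → ℂ}
    (hu : IsTangent ω q c g X N p u r) (hv : IsTangent ω q c g X N p v t) :
    ∫ w, ((pairing ω (q w.1.1) (q w.2.1) : ℂ) / (lin (q w.1.1) p.1 * lin (q w.2.1) p.1)) •
        (u w.1 * v w.2) ∂(rayMeasure ι).prod (rayMeasure ι) =
      (2 * Real.pi * I : ℂ) • ∫ x, ((x.2 : ℂ) / lin (q x.1) p.1) •
        ((r x / lin (q x.1) p.1) • v x - (t x / lin (q x.1) p.1) • u x) ∂rayMeasure ι := by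
  obtain ⟨hua, -⟩ := id hu
  obtain ⟨hva, -⟩ := id hv
  obtain ⟨C, hC0, hC⟩ := S.ofReal_div_bound hp
  have hs : Measurable fun x : ι × ℝ => (x.2 : ℂ) / lin (q x.1) p.1 :=
    (Complex.measurable_ofReal.comp measurable_snd).div (measurable_lin q p.1)
  obtain ⟨j1, e1⟩ := S.integral_mul_rayConv hp hua hva hs hC
  obtain ⟨j2, e2⟩ := S.integral_mul_rayConv hp hva hua hs hC
  have k1 := S.integrable_pair hp hua hva hs hC
  have k2 : Integrable (fun w : (ι × ℝ) × (ι × ℝ) => ((w.swap.1.2 : ℂ) / lin (q w.swap.1.1) p.1 *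
      rayKern ω q w.swap.1 w.swap.2 p.1) • (v w.swap.1 * u w.swap.2))
      ((rayMeasure ι).prod (rayMeasure ι)) := (S.integrable_pair hp hva hua hs hC).swap
  have hw : ∫ x, ((x.2 : ℂ) / lin (q x.1) p.1) •
        ((r x / lin (q x.1) p.1) • v x - (t x / lin (q x.1) p.1) • u x) ∂rayMeasure ι =
      ∫ x, (((x.2 : ℂ) / lin (q x.1) p.1) • (u x * rayConv ω q p.1 v x) -
        ((x.2 : ℂ) / lin (q x.1) p.1) • (v x * rayConv ω q p.1 u x)) ∂rayMeasure ι := by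
    refine integral_congr_ae ?_
    filter_upwards [S.tangent_wronskian hp hu hv] with x hx
    rw [← hx, smul_sub]
  rw [hw, integral_sub j1 j2, e1, e2, ← integral_prod_swap (fun w : (ι × ℝ) × (ι × ℝ) =>
    ((w.1.2 : ℂ) / lin (q w.1.1) p.1 * rayKern ω q w.1 w.2 p.1) • (v w.1 * u w.2)),
    ← integral_sub k1 k2, ← integral_smul]
  refine integral_congr_ae ?_
  have h1 : ∀ᵐ w ∂(rayMeasure ι).prod (rayMeasure ι), 0 < w.1.2 :=
    Measure.quasiMeasurePreserving_fst.ae ae_rayMeasure_pos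
  have h2 : ∀ᵐ w ∂(rayMeasure ι).prod (rayMeasure ι), 0 < w.2.2 :=
    Measure.quasiMeasurePreserving_snd.ae ae_rayMeasure_pos
  filter_upwards [h1, h2] with w hw1 hw2
  simp only [Prod.fst_swap, Prod.snd_swap]
  rw [rayKern_symm S.skew q w.1 w.2, mul_comm (v w.2), ← sub_smul, smul_smul, ← sub_mul]
  congr 1
  have hZ1 := S.lin_ne_zero hp w.1.1
  have hZ2 := S.lin_ne_zero hp w.2.1
  have hpi : (2 * Real.pi * I : ℂ) ≠ 0 := by simp [Real.pi_ne_zero]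
  rcases eq_or_ne (pairing ω (q w.1.1) (q w.2.1)) 0 with h0 | h0
  · simp [rayKern, h0]
  · have hd := S.offWalls p hp _ _ h0 _ _ hw1 hw2
    rw [rayKern, div_sub_div _ _ hZ1 hZ2, mul_comm (lin (q w.1.1) p.1) (w.2.2 : ℂ)]
    field_simp
    exact (div_self (by convert hd using 1; ring)).symm

end UniformSolution

end Core

/-! ### Variations of a solution -/

section Variations

variable {ι : Type*} [MeasurableSpace ι] [Countable ι] [MeasurableSingletonClass ι]
  {A : Type*} [NormedCommRing A] [NormedAlgebra ℂ A]
  {ω : Matrix (Fin m) (Fin m) ℤ} {q : ι → Lat m} {σ : ι → ℂ} {c : ι → A} {g h : A → A}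
  {B : Set (Cpx m × Cpx m)} {X : ι → ℝ → Cpx m × Cpx m → A} {N N' : ι × ℝ → ℝ}
  {κ : ι × ℝ → ι × ℝ → ℝ}

namespace UniformSolution

variable (S : UniformSolution ω q σ c g h B X N N' κ) {p : Cpx m × Cpx m}

include S

theorem differentiableOn_wt {x : ι × ℝ} (hx : 0 < x.2) :
    DifferentiableOn ℂ (wt c g X x) B := by
  intro p hp
  obtain ⟨φ, ψ, h1, -, -⟩ := S.regular p hp x.1 x.2 hx
  have h2 := ((S.holomorphic x.1 x.2 hx).differentiableAt (S.isOpen.mem_nhds hp)).hasFDerivAt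
  have h3 : DifferentiableAt ℂ (fun p => g (X x.1 x.2 p)) p :=
    (h1.comp p h2).differentiableAt
  exact (h3.const_mul (c x.1)).differentiableWithinAt

theorem differentiableAt_ray (hp : p ∈ B) (i : ι) {s : ℝ} (hs : 0 < s) :
    DifferentiableAt ℝ (fun r => g (X i r p)) s := by
  obtain ⟨φ, ψ, h1, -, -⟩ := S.regular p hp i s hs
  exact ((h1.restrictScalars ℝ).comp_hasDerivAt s
    (S.differentiable p hp i s hs).hasDerivAt).differentiableAt

theorem hasDerivAt_wt (hp : p ∈ B) (i : ι) {s : ℝ} (hs : 0 < s) :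
    HasDerivAt (fun r => wt c g X (i, r) p) ((s⁻¹ : ℝ) • wtD c g X (i, s) p) s := by
  refine ((S.differentiableAt_ray hp i hs).hasDerivAt.const_mul (c i)).congr_deriv ?_
  rw [wtD, ← mul_smul_comm, smul_smul, inv_mul_cancel₀ hs.ne', one_smul]

theorem adm_wt (hp : p ∈ B) : Adm N (fun x => wt c g X x p) := by
  refine ⟨aestronglyMeasurable_rayMeasure_iff.2 fun i => ?_, 1, zero_le_one, ?_⟩
  · exact ContinuousOn.aestronglyMeasurable (fun s hs =>
      (S.hasDerivAt_wt hp i hs).continuousAt.continuousWithinAt) measurableSet_Ioi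
  · filter_upwards [ae_rayMeasure_pos] with x hx
    rw [one_mul]
    exact S.bound_wt p hp x hx

variable [CompleteSpace A]

theorem stronglyMeasurable_wtD :
    StronglyMeasurable (fun x => wtD c g X x p) := by
  have h1 : ∀ i, StronglyMeasurable fun s => wtD c g X (i, s) p := fun i =>
    (stronglyMeasurable_id.smul (stronglyMeasurable_deriv fun r => g (X i r p))).const_mul (c i)
  borelize A
  rw [stronglyMeasurable_iff_measurable_separable]
  constructor
  · exact measurable_from_prod_countable_right fun i => (h1 i).measurable
  · have : range (fun x => wtD c g X x p) = ⋃ i, range fun s => wtD c g X (i, s) p := by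
      ext a; simp
    rw [this]
    exact TopologicalSpace.IsSeparable.iUnion fun i => (h1 i).isSeparable_range

theorem adm_wtD (hp : p ∈ B) : Adm N (fun x => wtD c g X x p) := by
  refine ⟨S.stronglyMeasurable_wtD.aestronglyMeasurable, 1, zero_le_one, ?_⟩
  filter_upwards [ae_rayMeasure_pos] with x hx
  rw [one_mul]
  exact S.bound_wtD p hp x hx

theorem ae_differentiableOn_wt :
    ∀ᵐ x ∂rayMeasure ι, DifferentiableOn ℂ (fun p => wt c g X x p) B := by
  filter_upwards [ae_rayMeasure_pos] with x hx using S.differentiableOn_wt hx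

theorem adm_fderiv_wt (hp : p ∈ B) (v : Cpx m × Cpx m) :
    Adm N (fun x => fderiv ℂ (wt c g X x) p v) := by
  obtain ⟨r, hr, hrB⟩ := Metric.isOpen_iff.1 S.isOpen p hp
  refine ⟨aestronglyMeasurable_fderiv_apply S.isOpen (fun p hp => (S.adm_wt hp).1)
    S.ae_differentiableOn_wt hp v, 2 / r * ‖v‖, by positivity, ?_⟩
  filter_upwards [ae_rayMeasure_pos] with x hx
  have := norm_fderiv_apply_le_of_ball hr ((S.differentiableOn_wt hx).mono hrB)
    (fun w hw => S.bound_wt w (hrB hw) x hx) v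
  refine this.trans (le_of_eq ?_)
  ring

/-- At almost every point of the rays the exponent of the integral equation is an absolutely
convergent integral. -/
theorem X_eq (hp : p ∈ B) {x : ι × ℝ} (hx0 : 0 < x.2)
    (hx : Integrable (fun y => κ x y * N y) (rayMeasure ι)) :
    X x.1 x.2 p = (σ x.1 * exp (2 * Real.pi * I * lin (q x.1) p.2 - 2 * Real.pi * x.2)) •
      NormedSpace.exp (lin (q x.1) p.1 • rayConv ω q p.1 (fun y => wt c g X y p) x) := by
  have h1 := S.integrable_kern_smul hp (S.adm_wt hp) hx0 hx
  have h2 := integral_rayMeasure (h1.fun_smul (lin (q x.1) p.1))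
  rw [S.tba p hp x.1 x.2 hx0, rayConv, ← integral_smul, h2]
  simp only [smul_smul]

theorem hasFDerivAt_rayKern (hp : p ∈ B) {x y : ι × ℝ} (hx : 0 < x.2) (hy : 0 < y.2) :
    HasFDerivAt (fun p : Cpx m × Cpx m => rayKern ω q x y p.1)
      ((-((pairing ω (q x.1) (q y.1) : ℂ) / (2 * Real.pi * I)) /
        (x.2 * lin (q y.1) p.1 - y.2 * lin (q x.1) p.1) ^ 2) •
        (((x.2 : ℂ) • linL (q y.1) - (y.2 : ℂ) • linL (q x.1)).comp
          (ContinuousLinearMap.fst ℂ (Cpx m) (Cpx m)))) p := by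
  rcases eq_or_ne (pairing ω (q x.1) (q y.1)) 0 with h0 | h0
  · have h1 : (fun p : Cpx m × Cpx m => rayKern ω q x y p.1) = fun _ => 0 := by
      funext p
      simp [rayKern, h0]
    rw [h1, h0]
    refine (hasFDerivAt_const (𝕜 := ℂ) (0 : ℂ) p).congr_fderiv ?_
    rw [Int.cast_zero, zero_div, neg_zero, zero_div]
    ext v
    · exact (zero_mul _).symm
    · exact (zero_mul _).symm
  · have hd := S.offWalls p hp _ _ h0 _ _ hx hy
    have h1 : HasFDerivAt (fun p : Cpx m × Cpx m =>
        (x.2 : ℂ) * lin (q y.1) p.1 - y.2 * lin (q x.1) p.1)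
        (((x.2 : ℂ) • linL (q y.1) - (y.2 : ℂ) • linL (q x.1)).comp
          (ContinuousLinearMap.fst ℂ (Cpx m) (Cpx m))) p :=
      (((x.2 : ℂ) • linL (q y.1) - (y.2 : ℂ) • linL (q x.1)).comp
          (ContinuousLinearMap.fst ℂ (Cpx m) (Cpx m))).hasFDerivAt
    have h2 := (hasDerivAt_inv hd).comp_hasFDerivAt p h1
    have h3 := h2.const_mul ((pairing ω (q x.1) (q y.1) : ℂ) / (2 * Real.pi * I))
    simp only [Function.comp_def] at h3
    refine (h3.congr_fderiv ?_)
    rw [smul_smul]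
    congr 1
    field_simp

theorem differentiableOn_kern_smul {x y : ι × ℝ} (hx : 0 < x.2) (hy : 0 < y.2) :
    DifferentiableOn ℂ (fun p : Cpx m × Cpx m => rayKern ω q x y p.1 • wt c g X y p) B :=
  fun _ hp => (((S.hasFDerivAt_rayKern hp hx hy).differentiableAt.smul
    ((S.differentiableOn_wt hy).differentiableAt (S.isOpen.mem_nhds hp)))).differentiableWithinAt

theorem rayConv_wt_holomorphic (hp : p ∈ B) {x : ι × ℝ} (hx0 : 0 < x.2)
    (hx : Integrable (fun y => κ x y * N y) (rayMeasure ι)) :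
    DifferentiableAt ℂ (fun p : Cpx m × Cpx m => rayConv ω q p.1 (fun y => wt c g X y p) x) p ∧
    ∀ v, Integrable (fun y => fderiv ℂ (fun p : Cpx m × Cpx m =>
        rayKern ω q x y p.1 • wt c g X y p) p v) (rayMeasure ι) ∧
      fderiv ℂ (fun p : Cpx m × Cpx m => rayConv ω q p.1 (fun y => wt c g X y p) x) p v =
        ∫ y, fderiv ℂ (fun p : Cpx m × Cpx m =>
          rayKern ω q x y p.1 • wt c g X y p) p v ∂rayMeasure ι := by
  refine hasFDerivAt_integral_of_holomorphic (μ := rayMeasure ι)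
    (Φ := fun p y => rayKern ω q x y p.1 • wt c g X y p) S.isOpen
    (fun _ hp => (S.integrable_kern_smul hp (S.adm_wt hp) hx0 hx).aestronglyMeasurable)
    ?_ ?_ hx hp
  · filter_upwards [ae_rayMeasure_pos] with y hy using S.differentiableOn_kern_smul hx0 hy
  · filter_upwards [ae_rayMeasure_pos] with y hy _ hp
    rw [norm_smul]
    exact mul_le_mul (S.bound_kern _ hp x y hx0 hy) (S.bound_wt _ hp y hy) (norm_nonneg _)
      (S.kern_nonneg hp hx0 hy)

theorem fderiv_kern_smul (hp : p ∈ B) {x y : ι × ℝ} (hx : 0 < x.2) (hy : 0 < y.2)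
    (v : Cpx m × Cpx m) :
    fderiv ℂ (fun p : Cpx m × Cpx m => rayKern ω q x y p.1 • wt c g X y p) p v =
      rayKern ω q x y p.1 • fderiv ℂ (wt c g X y) p v +
      ((-((pairing ω (q x.1) (q y.1) : ℂ) / (2 * Real.pi * I)) /
        (x.2 * lin (q y.1) p.1 - y.2 * lin (q x.1) p.1) ^ 2) *
        (x.2 * lin (q y.1) v.1 - y.2 * lin (q x.1) v.1)) • wt c g X y p := by
  rw [((S.hasFDerivAt_rayKern hp hx hy).fun_smul
    ((S.differentiableOn_wt hy).differentiableAt (S.isOpen.mem_nhds hp)).hasFDerivAt).fderiv]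
  simp

/-- The chain rule for the weighted unknown, in terms of the variation of `log X`. -/
theorem fderiv_wt (hp : p ∈ B) {x : ι × ℝ} (hx0 : 0 < x.2)
    (hx : Integrable (fun y => κ x y * N y) (rayMeasure ι)) (v : Cpx m × Cpx m) :
    fderiv ℂ (wt c g X x) p v = fac c g X x p *
      (algebraMap ℂ A (2 * Real.pi * I * lin (q x.1) v.2) +
        (lin (q x.1) p.1 • fderiv ℂ (fun p : Cpx m × Cpx m =>
            rayConv ω q p.1 (fun y => wt c g X y p) x) p v +
          lin (q x.1) v.1 • rayConv ω q p.1 (fun y => wt c g X y p) x)) ∧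
    fderiv ℂ (X x.1 x.2) p v = X x.1 x.2 p *
      (algebraMap ℂ A (2 * Real.pi * I * lin (q x.1) v.2) +
        (lin (q x.1) p.1 • fderiv ℂ (fun p : Cpx m × Cpx m =>
            rayConv ω q p.1 (fun y => wt c g X y p) x) p v +
          lin (q x.1) v.1 • rayConv ω q p.1 (fun y => wt c g X y p) x)) := by
  have hQ := (S.rayConv_wt_holomorphic hp hx0 hx).1.hasFDerivAt
  have hl1 : HasFDerivAt (fun p : Cpx m × Cpx m => lin (q x.1) p.1)
      ((linL (q x.1)).comp (ContinuousLinearMap.fst ℂ (Cpx m) (Cpx m))) p :=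
    ((linL (q x.1)).comp (ContinuousLinearMap.fst ℂ (Cpx m) (Cpx m))).hasFDerivAt
  have hl2 : HasFDerivAt (fun p : Cpx m × Cpx m => lin (q x.1) p.2)
      ((linL (q x.1)).comp (ContinuousLinearMap.snd ℂ (Cpx m) (Cpx m))) p :=
    ((linL (q x.1)).comp (ContinuousLinearMap.snd ℂ (Cpx m) (Cpx m))).hasFDerivAt
  have hE := (hasFDerivAt_exp (𝕂 := ℂ) (x := lin (q x.1) p.1 • rayConv ω q p.1
    (fun y => wt c g X y p) x)).comp p (hl1.fun_smul hQ)
  have hs := (((hl2.const_mul (2 * Real.pi * I : ℂ)).sub_const (2 * Real.pi * x.2 : ℂ)).cexp.const_mul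
    (σ x.1))
  have hX' := hs.fun_smul hE
  have hX : HasFDerivAt (X x.1 x.2) _ p := hX'.congr_of_eventuallyEq (by
    filter_upwards [S.isOpen.mem_nhds hp] with p' hp'
    exact S.X_eq hp' hx0 hx)
  have hXv : fderiv ℂ (X x.1 x.2) p v = X x.1 x.2 p *
      (algebraMap ℂ A (2 * Real.pi * I * lin (q x.1) v.2) +
        (lin (q x.1) p.1 • fderiv ℂ (fun p : Cpx m × Cpx m =>
            rayConv ω q p.1 (fun y => wt c g X y p) x) p v +
          lin (q x.1) v.1 • rayConv ω q p.1 (fun y => wt c g X y p) x)) := by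
    rw [hX.fderiv, S.X_eq hp hx0 hx]
    simp only [add_apply, smul_apply,
      ContinuousLinearMap.comp_apply, ContinuousLinearMap.smulRight_apply,
      ContinuousLinearMap.coe_fst', ContinuousLinearMap.coe_snd', linL_apply,
      one_apply_eq_self, Function.comp_apply, Algebra.algebraMap_eq_smul_one,
      smul_eq_mul, mul_add, smul_mul_assoc, mul_smul_comm, smul_add, mul_one]
    module
  refine ⟨?_, hXv⟩
  obtain ⟨φ, ψ, h1, -, -⟩ := S.regular p hp x.1 x.2 hx0
  have hφ : fderiv ℂ g (X x.1 x.2 p) 1 = φ := by rw [h1.fderiv]; simp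
  have h2 := (h1.comp p hX.differentiableAt.hasFDerivAt).const_mul (c x.1)
  have h3 : HasFDerivAt (wt c g X x) _ p := h2
  rw [h3.fderiv, fac, hφ]
  simp only [smul_apply, ContinuousLinearMap.comp_apply, hXv,
    one_apply_eq_self, smul_eq_mul]
  ring

omit [CompleteSpace A] in
theorem lin_div_bound (w : Cpx m) :
    ∃ C : ℝ, 0 ≤ C ∧ ∀ p ∈ B, ∀ i, ‖lin (q i) w / lin (q i) p.1‖ ≤ C := by
  obtain ⟨C, hC0, hC⟩ := S.support
  refine ⟨C * ∑ a, ‖w a‖, by positivity, fun p hp i => ?_⟩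
  have hZ : 0 < ‖lin (q i) p.1‖ := norm_pos_iff.2 (S.lin_ne_zero hp i)
  rw [norm_div, div_le_iff₀ hZ]
  calc ‖lin (q i) w‖ ≤ ∑ a, C * ‖lin (q i) p.1‖ * ‖w a‖ := by
        refine (norm_sum_le _ _).trans (Finset.sum_le_sum fun a _ => ?_)
        rw [norm_mul]
        exact mul_le_mul_of_nonneg_right ((hC p hp i).1 a) (norm_nonneg _)
    _ = _ := by rw [← Finset.mul_sum]; ring

theorem fderiv_rayConv_theta (hp : p ∈ B) {x : ι × ℝ} (hx0 : 0 < x.2)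
    (hx : Integrable (fun y => κ x y * N y) (rayMeasure ι)) (w : Cpx m) :
    fderiv ℂ (fun p : Cpx m × Cpx m => rayConv ω q p.1 (fun y => wt c g X y p) x) p (0, w) =
      rayConv ω q p.1 (fun y => fderiv ℂ (wt c g X y) p (0, w)) x := by
  rw [((S.rayConv_wt_holomorphic hp hx0 hx).2 (0, w)).2]
  refine integral_congr_ae ?_
  filter_upwards [ae_rayMeasure_pos] with y hy
  have h0 : ∀ i, lin (q i) (0 : Cpx m) = 0 := fun i => (linL (q i)).map_zero
  rw [S.fderiv_kern_smul hp hx0 hy]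
  simp [h0]

/-- The angular variations solve the linearized equation with inhomogeneity `2πi d θ_γ`. -/
theorem isTangent_theta (hp : p ∈ B) (w : Cpx m) :
    IsTangent ω q c g X N p (fun x => fderiv ℂ (wt c g X x) p (0, w))
      (fun x => 2 * Real.pi * I * lin (q x.1) w) := by
  obtain ⟨C, hC0, hC⟩ := S.lin_div_bound w
  refine ⟨S.adm_fderiv_wt hp _, (measurable_lin q w).const_mul _,
    ⟨2 * Real.pi * C, by positivity, fun x hx => ?_⟩, ?_⟩
  · have h2 : ‖(2 * Real.pi * I : ℂ)‖ = 2 * Real.pi := by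
      simp [abs_of_pos Real.pi_pos]
    rw [mul_div_assoc, norm_mul, h2]
    have hpi := Real.pi_pos
    calc 2 * Real.pi * ‖lin (q x.1) w / lin (q x.1) p.1‖ ≤ 2 * Real.pi * C := by
          gcongr; exact hC p hp x.1
      _ ≤ 2 * Real.pi * C * (1 + x.2) := le_mul_of_one_le_right (by positivity) (by linarith)
  · filter_upwards [S.integrable_kern hp, ae_rayMeasure_pos] with x hx hx0
    rw [(S.fderiv_wt hp hx0 hx (0, w)).1, S.fderiv_rayConv_theta hp hx0 hx w]
    have h0 : lin (q x.1) (0 : Cpx m) = 0 := (linL (q x.1)).map_zero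
    simp only [h0, zero_smul, add_zero]

end UniformSolution

end Variations

section Variations

variable {ι : Type*} [MeasurableSpace ι] [Countable ι] [MeasurableSingletonClass ι]
  {A : Type*} [NormedCommRing A] [NormedAlgebra ℂ A]
  {ω : Matrix (Fin m) (Fin m) ℤ} {q : ι → Lat m} {σ : ι → ℂ} {c : ι → A} {g h : A → A}
  {B : Set (Cpx m × Cpx m)} {X : ι → ℝ → Cpx m × Cpx m → A} {N N' : ι × ℝ → ℝ}
  {κ : ι × ℝ → ι × ℝ → ℝ}

theorem integrable_rayMeasure_section {β F : Type*} [MeasurableSpace β] [NormedAddCommGroup F]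
    {μ : Measure β} [SFinite μ] {f : (ι × ℝ) × β → F} (hf : Integrable f ((rayMeasure ι).prod μ))
    (i : ι) : Integrable (fun w : ℝ × β => f ((i, w.1), w.2))
      ((volume.restrict (Ioi (0 : ℝ))).prod μ) := by
  rw [rayMeasure, Measure.prod_sum_left] at hf
  have h1 := hf.mono_measure (Measure.le_sum _ i)
  have h2 := Measure.map_prod_map (volume.restrict (Ioi (0 : ℝ))) μ
    (measurableEmbedding_prodMk_left i).measurable measurable_id
  rw [Measure.map_id] at h2
  rw [h2] at h1
  exact ((measurableEmbedding_prodMk_left i).prodMap MeasurableEmbedding.id).integrable_map_iff.1 h1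

namespace UniformSolution

variable (S : UniformSolution ω q σ c g h B X N N' κ) {p : Cpx m × Cpx m}

include S

variable [CompleteSpace A]

theorem measurable_kern_left (i : ι) (z : Cpx m) :
    Measurable (Function.uncurry fun (s : ℝ) (y : ι × ℝ) => lin (q i) z * rayKern ω q (i, s) y z) := by
  have h : Measurable fun w : ℝ × (ι × ℝ) => (((i, w.1), w.2) : (ι × ℝ) × (ι × ℝ)) := by fun_prop
  exact ((measurable_rayKern ω q z).comp h).const_mul _

/-- On compact pieces of a single ray the double integral of the kernel against the majorant
converges: there the unknown is bounded away from zero, hence so is its majorant. -/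
theorem integrable_kern_wtD (hp : p ∈ B) (i : ι) {a b : ℝ} (ha : 0 < a) (hab : a ≤ b) :
    Integrable (fun w : ℝ × (ι × ℝ) =>
      (lin (q i) p.1 * rayKern ω q (i, w.1) w.2 p.1) • wtD c g X w.2 p)
      ((volume.restrict (Ioc a b)).prod (rayMeasure ι)) := by
  have hcont : ContinuousOn (fun s => ‖wt c g X (i, s) p‖) (Icc a b) := fun s hs =>
    (S.hasDerivAt_wt hp i (ha.trans_le hs.1)).continuousAt.norm.continuousWithinAt
  obtain ⟨s₀, hs₀, hmin⟩ := isCompact_Icc.exists_isMinOn (nonempty_Icc.2 hab) hcont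
  set δ := ‖wt c g X (i, s₀) p‖ with hδ
  have hδ0 : 0 < δ := norm_pos_iff.2 (S.ne_zero p hp (i, s₀) (ha.trans_le hs₀.1))
  have hle : (volume.restrict (Ioc a b)).prod (rayMeasure ι) ≤
      (volume.restrict (Ioi (0 : ℝ))).prod (rayMeasure ι) :=
    Measure.prod_mono (Measure.restrict_mono
      (Ioc_subset_Ioi_self.trans (Ioi_subset_Ioi ha.le)) le_rfl) le_rfl
  have h1 := (integrable_rayMeasure_section S.integrable_prod i).mono_measure hle
  refine (h1.const_mul (‖lin (q i) p.1‖ / δ)).mono'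
    ((S.measurable_kern_left i p.1).aestronglyMeasurable.smul
      (S.stronglyMeasurable_wtD.comp_measurable measurable_snd).aestronglyMeasurable) ?_
  have e1 : ∀ᵐ w ∂(volume.restrict (Ioc a b)).prod (rayMeasure ι), w.1 ∈ Ioc a b :=
    Measure.quasiMeasurePreserving_fst.ae (ae_restrict_mem measurableSet_Ioc)
  have e2 : ∀ᵐ w ∂(volume.restrict (Ioc a b)).prod (rayMeasure ι), 0 < w.2.2 :=
    Measure.quasiMeasurePreserving_snd.ae ae_rayMeasure_pos
  filter_upwards [e1, e2] with w hw1 hw2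
  have hw0 : 0 < w.1 := ha.trans hw1.1
  have hN : δ ≤ N (i, w.1) := (hmin ⟨hw1.1.le, hw1.2⟩).trans (S.bound_wt p hp (i, w.1) hw0)
  have hκ := S.kern_nonneg hp (x := (i, w.1)) (y := w.2) hw0 hw2
  have hN2 := S.N_pos hp hw2
  rw [norm_smul, norm_mul]
  calc ‖lin (q i) p.1‖ * ‖rayKern ω q (i, w.1) w.2 p.1‖ * ‖wtD c g X w.2 p‖
      ≤ ‖lin (q i) p.1‖ * κ (i, w.1) w.2 * N w.2 := by
        gcongr
        · exact S.bound_kern p hp (i, w.1) w.2 hw0 hw2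
        · exact S.bound_wtD p hp w.2 hw2
    _ = ‖lin (q i) p.1‖ / δ * (1 * (δ * κ (i, w.1) w.2 * N w.2)) := by field_simp
    _ ≤ ‖lin (q i) p.1‖ / δ * ((1 + w.1) * (N (i, w.1) * κ (i, w.1) w.2 * N w.2)) := by
        gcongr
        linarith

/-- The scaling derivative along the rays solves the linearized equation with inhomogeneity
`-2π s`. -/
theorem isTangent_scale (hp : p ∈ B) :
    IsTangent ω q c g X N p (fun x => wtD c g X x p) (fun x => -(2 * Real.pi * x.2)) := by
  obtain ⟨C, hC0, hC⟩ := S.ofReal_div_bound hp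
  have hm : Measurable fun x : ι × ℝ => -(2 * Real.pi * x.2 : ℂ) :=
    ((Complex.measurable_ofReal.comp measurable_snd).const_mul _).neg
  refine ⟨S.adm_wtD hp, hm, ⟨2 * Real.pi * C, by positivity, fun x hx => ?_⟩, ?_⟩
  · have h2 : ‖(2 * Real.pi : ℂ)‖ = 2 * Real.pi := by simp [abs_of_pos Real.pi_pos]
    rw [neg_div, norm_neg, mul_div_assoc, norm_mul, h2, mul_assoc (2 * Real.pi)]
    exact mul_le_mul_of_nonneg_left (hC x hx) (by positivity)
  rw [ae_rayMeasure_iff]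
  intro i
  -- the exponent of the integral equation, its exponential, and the expected derivative
  set Q : ℝ → A := fun s => ∑' j, ∫ s' in Ioi (0 : ℝ),
    (lin (q i) p.1 * rayKern ω q (i, s) (j, s') p.1) • wt c g X (j, s') p with hQdef
  set x₀ : ℝ → ℂ := fun s =>
    σ i * exp (2 * Real.pi * I * lin (q i) p.2 - 2 * Real.pi * s) with hx₀
  have hx₀0 : ∀ s, x₀ s ≠ 0 := fun s => mul_ne_zero (S.sigma_ne_zero i) (exp_ne_zero _)
  have hx₀d : ∀ s : ℝ, HasDerivAt x₀ (x₀ s * -(2 * Real.pi)) s := by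
    intro s
    have h1 : HasDerivAt (fun s : ℝ => 2 * Real.pi * I * lin (q i) p.2 - 2 * Real.pi * (s : ℂ))
        (-(2 * Real.pi)) s := by
      simpa using ((Complex.ofRealCLM.hasDerivAt (x := s)).const_mul
        (2 * Real.pi : ℂ)).const_sub (2 * Real.pi * I * lin (q i) p.2)
    exact (h1.cexp.const_mul (σ i)).congr_deriv (by rw [hx₀]; ring)
  have hXQ : ∀ s, 0 < s → X i s p = x₀ s • NormedSpace.exp (Q s) := fun s hs => S.tba p hp i s hs
  set k : ℝ → ι × ℝ → ℂ := fun s y => lin (q i) p.1 * rayKern ω q (i, s) y p.1 with hk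
  set ρ : ℝ → A := fun s => (s⁻¹ : ℝ) • ∫ y, k s y • wtD c g X y p ∂rayMeasure ι with hρ
  have hρi : ∀ a b, 0 < a → a ≤ b → IntervalIntegrable ρ volume a b := by
    intro a b ha hab
    rw [intervalIntegrable_iff_integrableOn_Ioc_of_le hab]
    refine Integrable.bdd_smul (𝕜 := ℝ) (φ := fun s => s⁻¹)
      (S.integrable_kern_wtD hp i ha hab).integral_prod_left a⁻¹
      measurable_inv.aestronglyMeasurable ?_
    filter_upwards [ae_restrict_mem measurableSet_Ioc] with s hs
    rw [norm_inv, Real.norm_of_nonneg (ha.trans hs.1).le]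
    exact inv_anti₀ ha hs.1.le
  have hgoodI : ∀ s, 0 < s → Integrable (fun y => κ (i, s) y * N y) (rayMeasure ι) →
      Integrable (fun y => k s y • wt c g X y p) (rayMeasure ι) := by
    intro s hs hi
    refine ((S.integrable_kern_smul hp (S.adm_wt hp) (x := (i, s)) hs hi).smul
      (lin (q i) p.1)).congr (Filter.Eventually.of_forall fun y => ?_)
    simp only [hk, mul_smul, Pi.smul_apply]
  have hgood := ae_rayMeasure_iff.1 (S.integrable_kern hp) i
  have hY := ae_hasDerivAt_of_exp (Y := fun s => NormedSpace.exp (Q s)) (Q := Q) (ρ := ρ)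
    (fun s hs => by
      have h1 : DifferentiableAt ℝ (fun s => (x₀ s)⁻¹ • X i s p) s :=
        ((hx₀d s).differentiableAt.fun_inv (hx₀0 s)).smul (S.differentiable p hp i s hs)
      refine h1.congr_of_eventuallyEq ?_
      filter_upwards [Ioi_mem_nhds hs] with r hr
      rw [hXQ r hr, inv_smul_smul₀ (hx₀0 r)])
    (fun s _ => rfl)
    (fun a b ha hb => by
      rcases le_total a b with hab | hab
      · exact hρi a b ha hab
      · exact (hρi b a hb hab).symm)
    (good := {s | Integrable (fun y => κ (i, s) y * N y) (rayMeasure ι)}) hgood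
    (fun a ha b hb ha0 hb0 hab => by
      have hQ : ∀ s, 0 < s → Integrable (fun y => κ (i, s) y * N y) (rayMeasure ι) →
          Q s = ∫ y, k s y • wt c g X y p ∂rayMeasure ι := fun s hs hi =>
        (integral_rayMeasure (hgoodI s hs hi)).symm
      rw [hQ a ha0 ha, hQ b hb0 hb]
      refine integral_kernel_sub_eq (k := k) (G := fun y => wt c g X y p)
        (DG := fun y => wtD c g X y p) ?_ (S.measurable_kern_left i p.1)
        (fun j s hs => S.hasDerivAt_wt hp j hs) S.stronglyMeasurable_wtD ?_ ha0 hab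
        (S.integrable_kern_wtD hp i ha0 hab) (hgoodI a ha0 ha) (hgoodI b hb0 hb)
      · intro r s y hr _ _
        rw [hk]
        simp only
        rw [← rayKern_mul ω q r hr.ne' i s y p.1]
        ring
      · intro j
        have := S.adm_wtD hp
        have h1 := S.integrable_smul hp this (a := fun _ => 1) measurable_const (C := 1)
          (fun x hx => by rw [norm_one]; linarith)
        simp only [one_smul] at h1
        exact (integrable_rayMeasure_iff.1 h1).1 j)
  filter_upwards [hY, hgood, ae_restrict_mem measurableSet_Ioi] with s hs hgs hs0
  have hs0' : (0 : ℝ) < s := hs0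
  obtain ⟨φ, ψ, h1, -, -⟩ := S.regular p hp i s hs0
  have hφ : fderiv ℂ g (X i s p) 1 = φ := by rw [h1.fderiv]; simp
  have hXd : HasDerivAt (fun r => X i r p)
      (x₀ s • (NormedSpace.exp (Q s) * ρ s) + (x₀ s * -(2 * Real.pi)) • NormedSpace.exp (Q s)) s :=
    ((hx₀d s).fun_smul hs).congr_of_eventuallyEq (by
      filter_upwards [Ioi_mem_nhds hs0'] with r hr using hXQ r hr)
  have hgd := ((h1.restrictScalars ℝ).comp_hasDerivAt s hXd).deriv
  have hρs : s • ρ s = lin (q i) p.1 • rayConv ω q p.1 (fun x => wtD c g X x p) (i, s) := by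
    rw [hρ]
    simp only
    rw [smul_smul, mul_inv_cancel₀ hs0'.ne', one_smul, rayConv, ← integral_smul]
    simp only [hk, mul_smul]
  rw [wtD, fac]
  simp only
  rw [← hρs, hφ, hXQ s hs0']
  have : deriv (fun r => g (X i r p)) s = φ * (x₀ s • (NormedSpace.exp (Q s) * ρ s) +
      (x₀ s * -(2 * Real.pi)) • NormedSpace.exp (Q s)) := by
    have e : (fun r => g (X i r p)) = g ∘ fun r => X i r p := rfl
    rw [e, hgd]
    simp
  rw [this, ← Complex.coe_smul s, ← Complex.coe_smul s]
  simp only [Algebra.algebraMap_eq_smul_one, mul_add, smul_mul_assoc, mul_smul_comm, smul_add,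
    mul_one, mul_assoc]
  module

end UniformSolution

end Variations

section Variations

variable {ι : Type*} [MeasurableSpace ι] [Countable ι] [MeasurableSingletonClass ι]
  {A : Type*} [NormedCommRing A] [NormedAlgebra ℂ A]
  {ω : Matrix (Fin m) (Fin m) ℤ} {q : ι → Lat m} {σ : ι → ℂ} {c : ι → A} {g h : A → A}
  {B : Set (Cpx m × Cpx m)} {X : ι → ℝ → Cpx m × Cpx m → A} {N N' : ι × ℝ → ℝ}
  {κ : ι × ℝ → ι × ℝ → ℝ}

omit [Countable ι] [MeasurableSingletonClass ι] [NormedAlgebra ℂ A] in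
theorem Adm.add {u v : ι × ℝ → A} (hu : Adm N u) (hv : Adm N v) :
    Adm N (fun x => u x + v x) := by
  obtain ⟨hm, C, hC0, hC⟩ := hu
  obtain ⟨hm', C', hC0', hC'⟩ := hv
  refine ⟨hm.add hm', C + C', by positivity, ?_⟩
  filter_upwards [hC, hC'] with x h1 h2
  calc _ ≤ ‖u x‖ + ‖v x‖ := norm_add_le _ _
    _ ≤ _ := by rw [add_mul]; exact add_le_add h1 h2

omit [Countable ι] [MeasurableSingletonClass ι] in
theorem Adm.smul {u : ι × ℝ → A} (hu : Adm N u) {a : ι × ℝ → ℂ} (ha : Measurable a) {C : ℝ}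
    (hC0 : 0 ≤ C) (hC : ∀ x, ‖a x‖ ≤ C) : Adm N (fun x => a x • u x) := by
  obtain ⟨hm, C', hC0', hC'⟩ := hu
  refine ⟨ha.aestronglyMeasurable.smul hm, C * C', by positivity, ?_⟩
  filter_upwards [hC'] with x h1
  rw [norm_smul, mul_assoc]
  exact mul_le_mul (hC x) h1 (norm_nonneg _) hC0

namespace UniformSolution

variable (S : UniformSolution ω q σ c g h B X N N' κ) {p : Cpx m × Cpx m}

include S

variable [CompleteSpace A]

/-- The variation of the weighted unknown with `z`, at a fixed point `t` of the `t`-plane instead of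
a fixed ray parameter. -/
theorem adm_zvar (hp : p ∈ B) (e : Cpx m) : Adm N (fun x =>
    fderiv ℂ (wt c g X x) p (e, 0) + (lin (q x.1) e / lin (q x.1) p.1) • wtD c g X x p) := by
  obtain ⟨C, hC0, hC⟩ := S.lin_div_bound e
  exact (S.adm_fderiv_wt hp _).add ((S.adm_wtD hp).smul
    ((measurable_lin q e).div (measurable_lin q p.1)) hC0 fun x => hC p hp x.1)

/-- The dependence of the kernel on `z` amounts to a motion of the ray parameters. The resulting
total derivative `∂_{s'}(s' K g(X))` integrates to zero on each ray. -/
theorem fderiv_rayConv_z (hp : p ∈ B) {x : ι × ℝ} (hx0 : 0 < x.2)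
    (hx : Integrable (fun y => κ x y * N y) (rayMeasure ι)) (e : Cpx m) :
    lin (q x.1) p.1 • fderiv ℂ (fun p : Cpx m × Cpx m =>
        rayConv ω q p.1 (fun y => wt c g X y p) x) p (e, 0) +
      lin (q x.1) e • rayConv ω q p.1 (fun y => wt c g X y p) x +
      lin (q x.1) e • rayConv ω q p.1 (fun y => wtD c g X y p) x =
    lin (q x.1) p.1 • rayConv ω q p.1 (fun y => fderiv ℂ (wt c g X y) p (e, 0) +
      (lin (q y.1) e / lin (q y.1) p.1) • wtD c g X y p) x := by
  have hZ := S.lin_ne_zero hp x.1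
  obtain ⟨i1, e1⟩ := (S.rayConv_wt_holomorphic hp hx0 hx).2 (e, 0)
  have i2 := S.integrable_kern_smul hp (S.adm_wt hp) hx0 hx
  have i3 := S.integrable_kern_smul hp (S.adm_wtD hp) hx0 hx
  have i4 := S.integrable_kern_smul hp (S.adm_zvar hp e) hx0 hx
  rw [e1, ← sub_eq_zero]
  simp only [rayConv]
  have j1 := (i1.fun_smul (lin (q x.1) p.1)).fun_add (i2.fun_smul (lin (q x.1) e))
  have j2 := j1.fun_add (i3.fun_smul (lin (q x.1) e))
  have hI := j2.sub' (i4.fun_smul (lin (q x.1) p.1))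
  rw [← integral_smul, ← integral_smul, ← integral_smul, ← integral_smul,
    ← integral_add (i1.fun_smul _) (i2.fun_smul _), ← integral_add j1 (i3.fun_smul _),
    ← integral_sub j2 (i4.fun_smul _)]
  refine (integral_rayMeasure hI).trans ?_
  refine (tsum_congr fun j => ?_).trans tsum_zero
  -- the total derivative on the ray of the charge `j`
  set b : ℂ := -(lin (q x.1) p.1 * (lin (q j) e / lin (q j) p.1 - lin (q x.1) e / lin (q x.1) p.1))
    with hb
  set P : ℂ := (pairing ω (q x.1) (q j) : ℂ) / (2 * Real.pi * I) with hP
  have hZj := S.lin_ne_zero hp j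
  have hu : ∀ s', 0 < s' → HasDerivAt
      (fun s' : ℝ => b • (rayKern ω q x (j, s') p.1 • wt c g X (j, s') p))
      (b • (rayKern ω q x (j, s') p.1 • ((s'⁻¹ : ℝ) • wtD c g X (j, s') p) +
        (P * lin (q x.1) p.1 / (x.2 * lin (q j) p.1 - s' * lin (q x.1) p.1) ^ 2) •
          wt c g X (j, s') p)) s' := by
    intro s' hs'
    have hK : HasDerivAt (fun s' : ℝ => rayKern ω q x (j, s') p.1)
        (P * lin (q x.1) p.1 / (x.2 * lin (q j) p.1 - s' * lin (q x.1) p.1) ^ 2) s' := by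
      rcases eq_or_ne (pairing ω (q x.1) (q j)) 0 with h0 | h0
      · have h1 : (fun s' : ℝ => rayKern ω q x (j, s') p.1) = fun _ => 0 := by
          funext s'
          simp [rayKern, h0]
        rw [h1, hP, h0]
        simpa using hasDerivAt_const s' (0 : ℂ)
      · have hd := S.offWalls p hp _ _ h0 _ _ hx0 hs'
        have h1 : HasDerivAt (fun s' : ℝ => (x.2 : ℂ) * lin (q j) p.1 - s' * lin (q x.1) p.1)
            (-lin (q x.1) p.1) s' := by
          simpa using ((Complex.ofRealCLM.hasDerivAt (x := s')).mul_const
            (lin (q x.1) p.1)).const_sub ((x.2 : ℂ) * lin (q j) p.1)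
        refine ((h1.fun_inv hd).const_mul P).congr_deriv ?_
        ring
    exact (hK.fun_smul (S.hasDerivAt_wt hp j hs')).const_smul b
  have hfun : ∀ s', 0 < s' → b • (rayKern ω q x (j, s') p.1 • wt c g X (j, s') p) +
      s' • (b • (rayKern ω q x (j, s') p.1 • ((s'⁻¹ : ℝ) • wtD c g X (j, s') p) +
        (P * lin (q x.1) p.1 / (x.2 * lin (q j) p.1 - s' * lin (q x.1) p.1) ^ 2) •
          wt c g X (j, s') p)) =
      lin (q x.1) p.1 • fderiv ℂ (fun p : Cpx m × Cpx m =>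
          rayKern ω q x (j, s') p.1 • wt c g X (j, s') p) p (e, 0) +
        lin (q x.1) e • (rayKern ω q x (j, s') p.1 • wt c g X (j, s') p) +
        lin (q x.1) e • (rayKern ω q x (j, s') p.1 • wtD c g X (j, s') p) -
        lin (q x.1) p.1 • (rayKern ω q x (j, s') p.1 • (fderiv ℂ (wt c g X (j, s')) p (e, 0) +
          (lin (q j) e / lin (q j) p.1) • wtD c g X (j, s') p)) := by
    intro s' hs'
    have hs0 : (s' : ℂ) ≠ 0 := by exact_mod_cast hs'.ne'
    rw [S.fderiv_kern_smul hp hx0 (y := (j, s')) hs']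
    simp only [← Complex.coe_smul, smul_add, smul_smul, Complex.ofReal_inv]
    have c1 : (s' : ℂ) * (b * (rayKern ω q x (j, s') p.1 * (s' : ℂ)⁻¹)) =
        b * rayKern ω q x (j, s') p.1 := by field_simp
    have c2 : b * rayKern ω q x (j, s') p.1 = lin (q x.1) e * rayKern ω q x (j, s') p.1 -
        lin (q x.1) p.1 * (rayKern ω q x (j, s') p.1 * (lin (q j) e / lin (q j) p.1)) := by
      rw [hb]
      have : lin (q x.1) p.1 * (lin (q x.1) e / lin (q x.1) p.1) = lin (q x.1) e :=
        mul_div_cancel₀ _ hZ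
      linear_combination (rayKern ω q x (j, s') p.1) * this
    have c3 : b * rayKern ω q x (j, s') p.1 + (s' : ℂ) * (b * (P * lin (q x.1) p.1 /
        (x.2 * lin (q j) p.1 - s' * lin (q x.1) p.1) ^ 2)) =
        lin (q x.1) p.1 * (-P / (x.2 * lin (q j) p.1 - s' * lin (q x.1) p.1) ^ 2 *
          (x.2 * lin (q j) e - s' * lin (q x.1) e)) +
        lin (q x.1) e * rayKern ω q x (j, s') p.1 := by
      have hK : rayKern ω q x (j, s') p.1 =
          P / (x.2 * lin (q j) p.1 - s' * lin (q x.1) p.1) := rfl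
      rw [hK]
      rcases eq_or_ne P 0 with h0 | h0
      · simp [h0]
      · have h0' : pairing ω (q x.1) (q j) ≠ 0 := by
          rintro h; apply h0; rw [hP, h]; simp
        have hd := S.offWalls p hp _ _ h0' _ _ hx0 hs'
        rw [hb]
        field_simp
        ring
    rw [c1]
    have e3 := congrArg (fun a : ℂ => a • wt c g X (j, s') p) c3
    have e2 := congrArg (fun a : ℂ => a • wtD c g X (j, s') p) c2
    simp only [add_smul, sub_smul] at e3 e2
    rw [e2]
    linear_combination (exp := 1) e3
  have hint := (integrable_rayMeasure_iff.1 hI).1 j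
  have := integral_Ioi_add_smul_deriv_eq_zero hu
    (((integrable_rayMeasure_iff.1 i2).1 j).fun_smul b)
    (hint.congr_fun (fun s' hs' => (hfun s' hs').symm) measurableSet_Ioi)
  rw [← this]
  exact setIntegral_congr_fun measurableSet_Ioi fun s' hs' => (hfun s' hs').symm

/-- The variations with `z` at fixed `t` solve the linearized equation with inhomogeneity
`-2π s d log Z_γ`. -/
theorem isTangent_z (hp : p ∈ B) (e : Cpx m) :
    IsTangent ω q c g X N p (fun x =>
        fderiv ℂ (wt c g X x) p (e, 0) + (lin (q x.1) e / lin (q x.1) p.1) • wtD c g X x p)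
      (fun x => -(2 * Real.pi * x.2) * (lin (q x.1) e / lin (q x.1) p.1)) := by
  obtain ⟨-, hm, ⟨C, hC0, hC⟩, hS⟩ := S.isTangent_scale hp
  obtain ⟨C', hC0', hC'⟩ := S.lin_div_bound e
  refine ⟨S.adm_zvar hp e, hm.mul ((measurable_lin q e).div (measurable_lin q p.1)),
    ⟨C * C', by positivity, fun x hx => ?_⟩, ?_⟩
  · rw [mul_div_right_comm, norm_mul, show C * C' * (1 + x.2) = C * (1 + x.2) * C' by ring]
    exact mul_le_mul (hC x hx) (hC' p hp x.1) (norm_nonneg _) (by positivity)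
  · filter_upwards [S.integrable_kern hp, ae_rayMeasure_pos, hS] with x hx hx0 hSx
    have hZ := S.lin_ne_zero hp x.1
    rw [(S.fderiv_wt hp hx0 hx (e, 0)).1, hSx, ← S.fderiv_rayConv_z hp hx0 hx e]
    have h0 : lin (q x.1) (0 : Cpx m) = 0 := (linL (q x.1)).map_zero
    have hd : lin (q x.1) e / lin (q x.1) p.1 * lin (q x.1) p.1 = lin (q x.1) e :=
      div_mul_cancel₀ _ hZ
    simp only [h0, mul_zero, map_zero, zero_add, Algebra.algebraMap_eq_smul_one]
    rw [← mul_smul_comm, ← mul_add]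
    congr 1
    rw [smul_add, smul_smul, smul_smul, hd, mul_comm]
    abel

end UniformSolution

end Variations

/-! ### The potentials -/

section Potentials

variable {ι : Type*} [MeasurableSpace ι] [Countable ι] [MeasurableSingletonClass ι]
  {A : Type*} [NormedCommRing A] [NormedAlgebra ℂ A]

/-- The derivative of the Plebański potential in the angular direction `w`:
`∑_γ c(γ) w_γ ∫ dt/t² g(X_γ)`, where `w_γ = lin γ w`. -/
def anglePot (q : ι → Lat m) (c : ι → A) (g : A → A) (X : ι → ℝ → Cpx m × Cpx m → A) (w : Cpx m)
    (p : Cpx m × Cpx m) : A :=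
  ∫ x, (-I * (lin (q x.1) w / lin (q x.1) p.1)) • wt c g X x p ∂rayMeasure ι

/-- The Joyce potential, as an integral over the space of rays. -/
def joycePot (c : ι → A) (g : A → A) (X : ι → ℝ → Cpx m × Cpx m → A)
    (p : Cpx m × Cpx m) : A :=
  ∫ x, (-I) • wt c g X x p ∂rayMeasure ι

/-- The Plebański potential, as an integral over the space of rays. -/
def plebPot (ω : Matrix (Fin m) (Fin m) ℤ) (q : ι → Lat m) (c : ι → A) (g h : A → A)
    (X : ι → ℝ → Cpx m × Cpx m → A) (p : Cpx m × Cpx m) : A :=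
  (1 / (2 * Real.pi * I) : ℂ) • ∫ x, ((1 / (I * lin (q x.1) p.1)) • (c x.1 * h (X x.1 x.2 p)) -
    (1 / (2 * I)) • (wt c g X x p * rayConv ω q p.1 (fun y => wt c g X y p) x)) ∂rayMeasure ι

variable {ω : Matrix (Fin m) (Fin m) ℤ} {q : ι → Lat m} {σ : ι → ℂ} {c : ι → A} {g h : A → A}
  {B : Set (Cpx m × Cpx m)} {X : ι → ℝ → Cpx m × Cpx m → A} {N N' : ι × ℝ → ℝ}
  {κ : ι × ℝ → ι × ℝ → ℝ}

namespace UniformSolution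

variable (S : UniformSolution ω q σ c g h B X N N' κ) {p : Cpx m × Cpx m}

include S

variable [CompleteSpace A]

theorem integrable_charge_smul (hp : p ∈ B) {u : ι × ℝ → A} (hu : Adm N u) {k : ι → ℂ} {C : ℝ}
    (hC0 : 0 ≤ C) (hC : ∀ i, ‖k i‖ ≤ C) :
    Integrable (fun x : ι × ℝ => k x.1 • u x) (rayMeasure ι) :=
  S.integrable_smul hp hu ((measurable_of_countable k).comp measurable_fst) (C := C)
    fun x hx => (hC x.1).trans (le_mul_of_one_le_right hC0 (by linarith))

/-- Integration by parts on each ray. -/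
theorem integral_charge_smul_wtD (hp : p ∈ B) {k : ι → ℂ} {C : ℝ} (hC0 : 0 ≤ C)
    (hC : ∀ i, ‖k i‖ ≤ C) :
    ∫ x : ι × ℝ, k x.1 • wtD c g X x p ∂rayMeasure ι =
      -∫ x : ι × ℝ, k x.1 • wt c g X x p ∂rayMeasure ι := by
  have i1 := S.integrable_charge_smul hp (S.adm_wt hp) hC0 hC
  have i2 := S.integrable_charge_smul hp (S.adm_wtD hp) hC0 hC
  have hI := i1.fun_add i2
  rw [eq_neg_iff_add_eq_zero, add_comm, ← integral_add i1 i2, integral_rayMeasure hI]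
  refine (tsum_congr fun j => ?_).trans tsum_zero
  have hfun : ∀ s : ℝ, 0 < s → k j • wt c g X (j, s) p +
      s • (k j • ((s⁻¹ : ℝ) • wtD c g X (j, s) p)) =
      k j • wt c g X (j, s) p + k j • wtD c g X (j, s) p := fun s hs => by
    rw [smul_comm s (k j), smul_smul s, mul_inv_cancel₀ hs.ne', one_smul]
  rw [← integral_Ioi_add_smul_deriv_eq_zero
    (fun s hs => (S.hasDerivAt_wt hp j hs).const_smul (k j))
    ((integrable_rayMeasure_iff.1 i1).1 j)
    (((integrable_rayMeasure_iff.1 hI).1 j).congr_fun (fun s hs => (hfun s hs).symm)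
      measurableSet_Ioi)]
  exact setIntegral_congr_fun measurableSet_Ioi fun s hs => (hfun s hs).symm

theorem hasFDerivAt_lin_div (hp : p ∈ B) (w : Cpx m) (i : ι) :
    HasFDerivAt (fun p : Cpx m × Cpx m => -I * (lin (q i) w / lin (q i) p.1))
      ((I * lin (q i) w / lin (q i) p.1 ^ 2) •
        (linL (q i)).comp (ContinuousLinearMap.fst ℂ (Cpx m) (Cpx m))) p := by
  have hZ := S.lin_ne_zero hp i
  have h1 : HasFDerivAt (fun p : Cpx m × Cpx m => lin (q i) p.1)
      ((linL (q i)).comp (ContinuousLinearMap.fst ℂ (Cpx m) (Cpx m))) p :=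
    ((linL (q i)).comp (ContinuousLinearMap.fst ℂ (Cpx m) (Cpx m))).hasFDerivAt
  have h2 : HasDerivAt (fun ζ : ℂ => -I * (lin (q i) w / ζ))
      (I * lin (q i) w / lin (q i) p.1 ^ 2) (lin (q i) p.1) := by
    have := ((hasDerivAt_inv hZ).const_mul (lin (q i) w)).const_mul (-I)
    simp only [← div_eq_mul_inv] at this
    exact this.congr_deriv (by ring)
  exact HasDerivAt.comp_hasFDerivAt (h₂ := fun ζ : ℂ => -I * (lin (q i) w / ζ))
    (f := fun p : Cpx m × Cpx m => lin (q i) p.1) p h2 h1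

theorem fderiv_lin_div_smul (hp : p ∈ B) (w : Cpx m) {x : ι × ℝ} (hx : 0 < x.2)
    (v : Cpx m × Cpx m) :
    fderiv ℂ (fun p : Cpx m × Cpx m =>
        (-I * (lin (q x.1) w / lin (q x.1) p.1)) • wt c g X x p) p v =
      (-I * (lin (q x.1) w / lin (q x.1) p.1)) • fderiv ℂ (wt c g X x) p v +
        (I * lin (q x.1) w / lin (q x.1) p.1 ^ 2 * lin (q x.1) v.1) • wt c g X x p := by
  rw [((S.hasFDerivAt_lin_div hp w x.1).fun_smul
    ((S.differentiableOn_wt hx).differentiableAt (S.isOpen.mem_nhds hp)).hasFDerivAt).fderiv]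
  simp

theorem anglePot_holomorphic (hp : p ∈ B) (w : Cpx m) :
    DifferentiableAt ℂ (anglePot q c g X w) p ∧ ∀ v,
      Integrable (fun x => fderiv ℂ (fun p : Cpx m × Cpx m =>
        (-I * (lin (q x.1) w / lin (q x.1) p.1)) • wt c g X x p) p v) (rayMeasure ι) ∧
      fderiv ℂ (anglePot q c g X w) p v = ∫ x, fderiv ℂ (fun p : Cpx m × Cpx m =>
        (-I * (lin (q x.1) w / lin (q x.1) p.1)) • wt c g X x p) p v ∂rayMeasure ι := by
  obtain ⟨C, hC0, hC⟩ := S.lin_div_bound w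
  have hC' : ∀ p ∈ B, ∀ i, ‖-I * (lin (q i) w / lin (q i) p.1)‖ ≤ C := fun p hp i => by
    rw [norm_mul, norm_neg, norm_I, one_mul]; exact hC p hp i
  refine hasFDerivAt_integral_of_holomorphic (μ := rayMeasure ι)
    (Φ := fun p x => (-I * (lin (q x.1) w / lin (q x.1) p.1)) • wt c g X x p) (b := fun x => C * N x)
    S.isOpen (fun p hp => (S.integrable_charge_smul hp (S.adm_wt hp) hC0
      (hC' p hp)).aestronglyMeasurable) ?_ ?_ (S.integrable_N.const_mul C) hp
  · filter_upwards [ae_rayMeasure_pos] with x hx p hp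
    exact ((S.hasFDerivAt_lin_div hp w x.1).differentiableAt.smul ((S.differentiableOn_wt
      hx).differentiableAt (S.isOpen.mem_nhds hp))).differentiableWithinAt
  · filter_upwards [ae_rayMeasure_pos] with x hx p hp
    rw [norm_smul]
    exact mul_le_mul (hC' p hp x.1) (S.bound_wt p hp x hx) (norm_nonneg _) hC0

theorem fderiv_anglePot_theta (hp : p ∈ B) (w v : Cpx m) :
    fderiv ℂ (anglePot q c g X w) p (0, v) =
      ∫ x, (-I * (lin (q x.1) w / lin (q x.1) p.1)) • fderiv ℂ (wt c g X x) p (0, v)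
        ∂rayMeasure ι := by
  rw [((S.anglePot_holomorphic hp w).2 (0, v)).2]
  refine integral_congr_ae ?_
  filter_upwards [ae_rayMeasure_pos] with x hx
  have h0 : lin (q x.1) (0 : Cpx m) = 0 := (linL (q x.1)).map_zero
  rw [S.fderiv_lin_div_smul hp w hx]
  simp [h0]

theorem integrable_lin_div_smul (hp : p ∈ B) {u : ι × ℝ → A} (hu : Adm N u) (w : Cpx m) :
    Integrable (fun x : ι × ℝ => (lin (q x.1) w / lin (q x.1) p.1) • u x) (rayMeasure ι) := by
  obtain ⟨C, hC0, hC⟩ := S.lin_div_bound w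
  exact S.integrable_charge_smul hp hu (k := fun i => lin (q i) w / lin (q i) p.1) hC0 (hC p hp)

/-- The second angular derivatives are symmetric, as a case of reciprocity. -/
theorem fderiv_anglePot_theta_comm (hp : p ∈ B) (w v : Cpx m) :
    fderiv ℂ (anglePot q c g X w) p (0, v) = fderiv ℂ (anglePot q c g X v) p (0, w) := by
  have h := S.reciprocity hp (S.isTangent_theta hp w) (S.isTangent_theta hp v)
  rw [S.fderiv_anglePot_theta hp, S.fderiv_anglePot_theta hp]
  simp only [mul_div_assoc, mul_smul, integral_smul] at h ⊢
  have h2 : (2 * Real.pi * I : ℂ) ≠ 0 := by simp [Real.pi_ne_zero]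
  rw [smul_right_injective A two_ne_zero |>.eq_iff,
    (smul_right_injective A (Complex.ofReal_ne_zero.2 Real.pi_ne_zero)).eq_iff,
    (smul_right_injective A I_ne_zero).eq_iff] at h
  rw [h]

/-- The derivative in `z` is a pairing of the angular tangent vector with the inhomogeneity of the
`z`-tangent vector. -/
theorem fderiv_anglePot_z (hp : p ∈ B) (w e : Cpx m) :
    fderiv ℂ (anglePot q c g X w) p (e, 0) =
      ∫ x, ((x.2 : ℂ) / lin (q x.1) p.1) • ((lin (q x.1) e / lin (q x.1) p.1) •
        fderiv ℂ (wt c g X x) p (0, w)) ∂rayMeasure ι := by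
  obtain ⟨C, hC0, hC⟩ := S.lin_div_bound w
  obtain ⟨C', hC0', hC'⟩ := S.lin_div_bound e
  set k : ι → ℂ := fun i => I * (lin (q i) w / lin (q i) p.1 * (lin (q i) e / lin (q i) p.1)) with hk
  have hkC : ∀ i, ‖k i‖ ≤ C * C' := fun i => by
    rw [hk]
    simp only [norm_mul, norm_I, one_mul]
    exact mul_le_mul (hC p hp i) (hC' p hp i) (norm_nonneg _) hC0
  have i1 := S.integrable_charge_smul hp (S.adm_wt hp) (by positivity) hkC
  have i2 := S.integrable_charge_smul hp (S.adm_wtD hp) (by positivity) hkC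
  have i3 := (S.integrable_lin_div_smul hp (S.adm_fderiv_wt hp (e, 0)) w).fun_smul (-I)
  have hrec := S.reciprocity hp (S.isTangent_theta hp w) (S.isTangent_z hp e)
  have h1 : ∫ x : ι × ℝ, (2 * Real.pi * I * lin (q x.1) w / lin (q x.1) p.1) •
      (fderiv ℂ (wt c g X x) p (e, 0) +
        (lin (q x.1) e / lin (q x.1) p.1) • wtD c g X x p) ∂rayMeasure ι =
      (-(2 * Real.pi) : ℂ) • fderiv ℂ (anglePot q c g X w) p (e, 0) := by
    rw [((S.anglePot_holomorphic hp w).2 (e, 0)).2]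
    have e1 : ∫ x : ι × ℝ, fderiv ℂ (fun p : Cpx m × Cpx m =>
        (-I * (lin (q x.1) w / lin (q x.1) p.1)) • wt c g X x p) p (e, 0) ∂rayMeasure ι =
        ∫ x : ι × ℝ, ((-I) • ((lin (q x.1) w / lin (q x.1) p.1) • fderiv ℂ (wt c g X x) p (e, 0)) +
          k x.1 • wt c g X x p) ∂rayMeasure ι := by
      refine integral_congr_ae ?_
      filter_upwards [ae_rayMeasure_pos] with x hx
      rw [S.fderiv_lin_div_smul hp w hx, mul_smul]
      congr 2
      rw [hk]
      have hZ := S.lin_ne_zero hp x.1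
      field_simp
    rw [e1, integral_add i3 i1, ← neg_neg (∫ x : ι × ℝ, k x.1 • wt c g X x p ∂rayMeasure ι),
      ← S.integral_charge_smul_wtD hp (by positivity) hkC, ← sub_eq_add_neg, ← integral_sub i3 i2,
      ← integral_smul]
    refine integral_congr_ae (Filter.Eventually.of_forall fun x => ?_)
    simp only [hk, smul_add, smul_sub, smul_smul]
    rw [sub_eq_add_neg, ← neg_smul]
    congr 2 <;> ring
  have h2 : ∫ x : ι × ℝ, (-(2 * Real.pi * x.2) * (lin (q x.1) e / lin (q x.1) p.1) /
      lin (q x.1) p.1) • fderiv ℂ (wt c g X x) p (0, w) ∂rayMeasure ι =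
      (-(2 * Real.pi) : ℂ) • ∫ x, ((x.2 : ℂ) / lin (q x.1) p.1) •
        ((lin (q x.1) e / lin (q x.1) p.1) • fderiv ℂ (wt c g X x) p (0, w)) ∂rayMeasure ι := by
    rw [← integral_smul]
    refine integral_congr_ae (Filter.Eventually.of_forall fun x => ?_)
    simp only [smul_smul]
    congr 1
    ring
  rw [h1, h2] at hrec
  have hpi : (-(2 * Real.pi) : ℂ) ≠ 0 := by simp [Real.pi_ne_zero]
  exact smul_right_injective A hpi hrec

/-- Homogeneity: `∂_θ W` has degree `-1` under a common rescaling of the central charges. -/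
theorem fderiv_anglePot_euler (hp : p ∈ B) (w : Cpx m) :
    fderiv ℂ (anglePot q c g X w) p (p.1, 0) = -anglePot q c g X w p := by
  obtain ⟨C, hC0, hC⟩ := S.lin_div_bound w
  have hrec := S.reciprocity hp (S.isTangent_theta hp w) (S.isTangent_scale hp)
  simp only [mul_div_assoc, mul_smul, integral_smul, neg_div, neg_smul, integral_neg] at hrec
  rw [S.integral_charge_smul_wtD hp (k := fun i => lin (q i) w / lin (q i) p.1) hC0 (hC p hp)]
    at hrec
  rw [S.fderiv_anglePot_z hp, anglePot]
  simp only [div_self (S.lin_ne_zero hp _), one_smul, mul_smul, integral_smul]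
  simp only [smul_neg, neg_inj] at hrec
  rw [(smul_right_injective A two_ne_zero).eq_iff,
    (smul_right_injective A (Complex.ofReal_ne_zero.2 Real.pi_ne_zero)).eq_iff] at hrec
  rw [← hrec, neg_smul, neg_neg]

/-- Plebański's heavenly equation for the angular potentials, from the commutator identity. -/
theorem fderiv_anglePot_z_sub (hp : p ∈ B) (w e : Cpx m) :
    fderiv ℂ (anglePot q c g X w) p (e, 0) - fderiv ℂ (anglePot q c g X e) p (w, 0) =
      (1 / (2 * Real.pi * I) ^ 2 : ℂ) • ∑ b, ∑ d, (ω b d : ℂ) •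
        (fderiv ℂ (anglePot q c g X w) p (0, Pi.single b 1) *
          fderiv ℂ (anglePot q c g X e) p (0, Pi.single d 1)) := by
  obtain ⟨C, hC0, hC⟩ := S.ofReal_div_bound hp
  have hC' : ∀ v : Cpx m, ∃ C : ℝ, ∀ x : ι × ℝ, 0 < x.2 → ‖(x.2 : ℂ) / lin (q x.1) p.1 *
      (lin (q x.1) v / lin (q x.1) p.1)‖ ≤ C * (1 + x.2) := fun v => by
    obtain ⟨C', hC0', hC'⟩ := S.lin_div_bound v
    refine ⟨C * C', fun x hx => ?_⟩
    rw [norm_mul, show C * C' * (1 + x.2) = C * (1 + x.2) * C' by ring]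
    exact mul_le_mul (hC x hx) (hC' p hp x.1) (norm_nonneg _) (by positivity)
  have hm : ∀ v : Cpx m, Measurable fun x : ι × ℝ => (x.2 : ℂ) / lin (q x.1) p.1 *
      (lin (q x.1) v / lin (q x.1) p.1) := fun v =>
    ((Complex.measurable_ofReal.comp measurable_snd).div (measurable_lin q p.1)).mul
      ((measurable_lin q v).div (measurable_lin q p.1))
  have hi : ∀ v v' : Cpx m, Integrable (fun x : ι × ℝ => ((x.2 : ℂ) / lin (q x.1) p.1 *
      (lin (q x.1) v / lin (q x.1) p.1)) • fderiv ℂ (wt c g X x) p (0, v')) (rayMeasure ι) :=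
    fun v v' => by
      obtain ⟨C', hC'⟩ := hC' v
      exact S.integrable_smul hp (S.adm_fderiv_wt hp (0, v')) (hm v) hC'
  have hpi : (2 * Real.pi * I : ℂ) ≠ 0 := by simp [Real.pi_ne_zero]
  have hcom := S.commutator hp (S.isTangent_theta hp w) (S.isTangent_theta hp e)
  have h1 : ∫ x, ((x.2 : ℂ) / lin (q x.1) p.1) •
        ((2 * Real.pi * I * lin (q x.1) w / lin (q x.1) p.1) • fderiv ℂ (wt c g X x) p (0, e) -
          (2 * Real.pi * I * lin (q x.1) e / lin (q x.1) p.1) • fderiv ℂ (wt c g X x) p (0, w))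
        ∂rayMeasure ι =
      -(2 * Real.pi * I : ℂ) • (fderiv ℂ (anglePot q c g X w) p (e, 0) -
        fderiv ℂ (anglePot q c g X e) p (w, 0)) := by
    rw [S.fderiv_anglePot_z hp, S.fderiv_anglePot_z hp]
    simp only [smul_smul]
    rw [← integral_sub (hi e w) (hi w e), ← integral_smul]
    refine integral_congr_ae (Filter.Eventually.of_forall fun x => ?_)
    module
  have hj : ∀ (b : Fin m) (v : Cpx m), Integrable (fun x : ι × ℝ => (lin (q x.1) (Pi.single b 1) /
      lin (q x.1) p.1) • fderiv ℂ (wt c g X x) p (0, v)) (rayMeasure ι) := fun b v =>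
    S.integrable_lin_div_smul hp (S.adm_fderiv_wt hp (0, v)) (Pi.single b 1)
  have hJ : ∀ (b : Fin m) (v : Cpx m), ∫ x : ι × ℝ, (lin (q x.1) (Pi.single b 1) /
      lin (q x.1) p.1) • fderiv ℂ (wt c g X x) p (0, v) ∂rayMeasure ι =
      I • fderiv ℂ (anglePot q c g X v) p (0, Pi.single b 1) := fun b v => by
    rw [S.fderiv_anglePot_theta_comm hp, S.fderiv_anglePot_theta hp]
    simp only [mul_smul, integral_smul]
    rw [smul_smul]
    simp
  have h2 : ∫ y : (ι × ℝ) × (ι × ℝ), ((pairing ω (q y.1.1) (q y.2.1) : ℂ) /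
      (lin (q y.1.1) p.1 * lin (q y.2.1) p.1)) •
        (fderiv ℂ (wt c g X y.1) p (0, w) * fderiv ℂ (wt c g X y.2) p (0, e))
        ∂(rayMeasure ι).prod (rayMeasure ι) =
      -∑ b, ∑ d, (ω b d : ℂ) • (fderiv ℂ (anglePot q c g X w) p (0, Pi.single b 1) *
          fderiv ℂ (anglePot q c g X e) p (0, Pi.single d 1)) := by
    have e1 : ∀ y : (ι × ℝ) × (ι × ℝ), ((pairing ω (q y.1.1) (q y.2.1) : ℂ) /
      (lin (q y.1.1) p.1 * lin (q y.2.1) p.1)) •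
        (fderiv ℂ (wt c g X y.1) p (0, w) * fderiv ℂ (wt c g X y.2) p (0, e)) =
        ∑ b, ∑ d, (ω b d : ℂ) •
          (((lin (q y.1.1) (Pi.single b 1) / lin (q y.1.1) p.1) •
            fderiv ℂ (wt c g X y.1) p (0, w)) *
          ((lin (q y.2.1) (Pi.single d 1) / lin (q y.2.1) p.1) •
            fderiv ℂ (wt c g X y.2) p (0, e))) := fun y => by
      simp only [smul_mul_smul_comm, smul_smul, ← Finset.sum_smul, lin_single]
      congr 1
      simp only [pairing, Int.cast_sum, Int.cast_mul, Finset.sum_div]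
      refine Finset.sum_congr rfl fun b _ => Finset.sum_congr rfl fun d _ => ?_
      ring
    simp only [e1]
    have hI := fun b d => ((hj b w).mul_prod (hj d e)).fun_smul (ω b d : ℂ)
    rw [integral_finsetSum _ fun b _ => integrable_finsetSum _ fun d _ => hI b d,
      ← Finset.sum_neg_distrib]
    refine Finset.sum_congr rfl fun b _ => ?_
    rw [integral_finsetSum _ fun d _ => hI b d, ← Finset.sum_neg_distrib]
    refine Finset.sum_congr rfl fun d _ => ?_
    have := integral_prod_bilin (ContinuousLinearMap.mul ℂ A) (hj b w) (hj d e)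
    simp only [ContinuousLinearMap.mul_apply'] at this
    rw [integral_smul, this, hJ, hJ, smul_mul_smul_comm, I_mul_I, neg_one_smul, smul_neg]
  rw [h1, h2, neg_smul, smul_neg, neg_inj, smul_smul, ← pow_two] at hcom
  rw [hcom, smul_smul, one_div, inv_mul_cancel₀ (pow_ne_zero 2 hpi), one_smul]

end UniformSolution

end Potentials

section Potentials

variable {ι : Type*} [MeasurableSpace ι] [Countable ι] [MeasurableSingletonClass ι]
  {A : Type*} [NormedCommRing A] [NormedAlgebra ℂ A]
  {ω : Matrix (Fin m) (Fin m) ℤ} {q : ι → Lat m} {σ : ι → ℂ} {c : ι → A} {g h : A → A}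
  {B : Set (Cpx m × Cpx m)} {X : ι → ℝ → Cpx m × Cpx m → A} {N N' : ι × ℝ → ℝ}
  {κ : ι × ℝ → ι × ℝ → ℝ}

namespace UniformSolution

variable (S : UniformSolution ω q σ c g h B X N N' κ) {p : Cpx m × Cpx m}

include S

variable [CompleteSpace A]

theorem joycePot_holomorphic (hp : p ∈ B) :
    DifferentiableAt ℂ (joycePot c g X) p ∧ ∀ v,
      fderiv ℂ (joycePot c g X) p v =
        (-I) • ∫ x, fderiv ℂ (wt c g X x) p v ∂rayMeasure ι := by
  have h1 := hasFDerivAt_integral_of_holomorphic (μ := rayMeasure ι)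
    (Φ := fun p x => wt c g X x p) S.isOpen (fun p hp => (S.adm_wt hp).1) S.ae_differentiableOn_wt
    (ae_rayMeasure_pos.mono fun x hx p hp => S.bound_wt p hp x hx) S.integrable_N hp
  have e : joycePot c g X = fun p => (-I) • ∫ x, wt c g X x p ∂rayMeasure ι := by
    funext p
    rw [joycePot, integral_smul]
  rw [e]
  refine ⟨h1.1.fun_const_smul _, fun v => ?_⟩
  rw [fderiv_fun_const_smul h1.1, smul_apply, (h1.2 v).2]

theorem joycePot_eq_anglePot (hp : p ∈ B) : joycePot c g X p = anglePot q c g X p.1 p := by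
  refine integral_congr_ae (Filter.Eventually.of_forall fun x => ?_)
  simp only [div_self (S.lin_ne_zero hp x.1), mul_one]

theorem anglePot_eq_sum (hp : p ∈ B) (w : Cpx m) :
    anglePot q c g X w p = ∑ a, w a • anglePot q c g X (Pi.single a 1) p := by
  have hI := fun a : Fin m => ((S.integrable_lin_div_smul hp (S.adm_wt hp)
    (Pi.single a 1)).fun_smul (-I)).fun_smul (w a)
  simp only [anglePot, mul_smul]
  simp only [← integral_smul]
  rw [← integral_finsetSum _ fun a _ => hI a]
  refine integral_congr_ae (Filter.Eventually.of_forall fun x => ?_)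
  simp only [smul_smul, ← Finset.sum_smul, lin_single]
  congr 1
  rw [lin, Finset.sum_div, Finset.mul_sum]
  exact Finset.sum_congr rfl fun a _ => by ring

theorem fderiv_joycePot_theta (hp : p ∈ B) (v : Cpx m) :
    fderiv ℂ (joycePot c g X) p (0, v) = fderiv ℂ (anglePot q c g X p.1) p (0, v) := by
  rw [(S.joycePot_holomorphic hp).2, S.fderiv_anglePot_theta hp, ← integral_smul]
  refine integral_congr_ae (Filter.Eventually.of_forall fun x => ?_)
  simp only [div_self (S.lin_ne_zero hp x.1), mul_one]

theorem fderiv_joycePot_z (hp : p ∈ B) (e : Cpx m) :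
    fderiv ℂ (joycePot c g X) p (e, 0) =
      fderiv ℂ (anglePot q c g X p.1) p (e, 0) + anglePot q c g X e p := by
  rw [(S.joycePot_holomorphic hp).2, ((S.anglePot_holomorphic hp p.1).2 (e, 0)).2,
    ← integral_smul]
  have i1 := ((S.anglePot_holomorphic hp p.1).2 (e, 0)).1
  have i2 := (S.integrable_lin_div_smul hp (S.adm_wt hp) e).fun_smul (-I)
  simp only [smul_smul] at i2
  rw [anglePot, ← integral_add i1 i2]
  refine integral_congr_ae ?_
  filter_upwards [ae_rayMeasure_pos] with x hx
  have hZ := S.lin_ne_zero hp x.1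
  rw [S.fderiv_lin_div_smul hp _ hx, add_assoc, ← add_smul, div_self hZ]
  have : I * lin (q x.1) p.1 / lin (q x.1) p.1 ^ 2 * lin (q x.1) e +
      -I * (lin (q x.1) e / lin (q x.1) p.1) = 0 := by
    field_simp
    ring
  rw [this, zero_smul, add_zero, mul_one]

/-- The isomonodromy equation for the potentials: the heavenly equation, contracted with `z`. -/
theorem fderiv_joycePot_eq (hp : p ∈ B) (e : Cpx m) :
    fderiv ℂ (joycePot c g X) p (e, 0) =
      (1 / (2 * Real.pi * I) ^ 2 : ℂ) • ∑ b, ∑ d, (ω b d : ℂ) •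
        (fderiv ℂ (joycePot c g X) p (0, Pi.single b 1) *
          fderiv ℂ (anglePot q c g X e) p (0, Pi.single d 1)) := by
  simp only [S.fderiv_joycePot_theta hp]
  rw [← S.fderiv_anglePot_z_sub hp, S.fderiv_joycePot_z hp, S.fderiv_anglePot_euler hp,
    sub_neg_eq_add]

theorem norm_rayConv_wt_le (hp : p ∈ B) {x : ι × ℝ} (hx0 : 0 < x.2)
    (hx : Integrable (fun y => κ x y * N y) (rayMeasure ι)) :
    ‖rayConv ω q p.1 (fun y => wt c g X y p) x‖ ≤ ∫ y, κ x y * N y ∂rayMeasure ι := by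
  refine norm_integral_le_of_norm_le hx ?_
  filter_upwards [ae_rayMeasure_pos] with y hy
  rw [norm_smul]
  exact mul_le_mul (S.bound_kern p hp x y hx0 hy) (S.bound_wt p hp y hy) (norm_nonneg _)
    (S.kern_nonneg hp hx0 hy)

theorem differentiableAt_X (hp : p ∈ B) {x : ι × ℝ} (hx : 0 < x.2) :
    DifferentiableAt ℂ (X x.1 x.2) p :=
  (S.holomorphic x.1 x.2 hx).differentiableAt (S.isOpen.mem_nhds hp)

theorem aestronglyMeasurable_h (hp : p ∈ B) :
    AEStronglyMeasurable (fun x : ι × ℝ => c x.1 * h (X x.1 x.2 p)) (rayMeasure ι) := by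
  refine aestronglyMeasurable_rayMeasure_iff.2 fun i =>
    ContinuousOn.aestronglyMeasurable (fun s hs => ?_) measurableSet_Ioi
  obtain ⟨φ, ψ, -, h2, -⟩ := S.regular p hp i s hs
  exact (continuousAt_const.mul (ContinuousAt.comp (f := fun r => X i r p) (g := h) h2.continuousAt
    (S.differentiable p hp i s hs).continuousAt)).continuousWithinAt

/-- The integrand of the Plebański potential. -/
theorem plebPot_integrand (hp : p ∈ B) {x : ι × ℝ} (hx0 : 0 < x.2)
    (hx : Integrable (fun y => κ x y * N y) (rayMeasure ι)) :
    DifferentiableAt ℂ (fun p : Cpx m × Cpx m => (1 / (I * lin (q x.1) p.1)) •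
        (c x.1 * h (X x.1 x.2 p)) -
      (1 / (2 * I) : ℂ) • (wt c g X x p * rayConv ω q p.1 (fun y => wt c g X y p) x)) p ∧
    ∀ w, fderiv ℂ (fun p : Cpx m × Cpx m => (1 / (I * lin (q x.1) p.1)) •
        (c x.1 * h (X x.1 x.2 p)) -
      (1 / (2 * I) : ℂ) • (wt c g X x p * rayConv ω q p.1 (fun y => wt c g X y p) x)) p (0, w) =
      (2 * Real.pi * (lin (q x.1) w / lin (q x.1) p.1)) • wt c g X x p +
        (1 / (2 * I) : ℂ) • (wt c g X x p *
            rayConv ω q p.1 (fun y => fderiv ℂ (wt c g X y) p (0, w)) x -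
          fderiv ℂ (wt c g X x) p (0, w) * rayConv ω q p.1 (fun y => wt c g X y p) x) := by
  obtain ⟨φ, ψ, -, h2, h3⟩ := S.regular p hp x.1 x.2 hx0
  have hZ := S.lin_ne_zero hp x.1
  have hX := (S.differentiableAt_X hp hx0).hasFDerivAt
  have hG := ((S.differentiableOn_wt hx0).differentiableAt (S.isOpen.mem_nhds hp)).hasFDerivAt
  have hQ := (S.rayConv_wt_holomorphic hp hx0 hx).1.hasFDerivAt
  have hK : HasFDerivAt (fun p : Cpx m × Cpx m => 1 / (I * lin (q x.1) p.1))
      ((I / lin (q x.1) p.1 ^ 2) •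
        (linL (q x.1)).comp (ContinuousLinearMap.fst ℂ (Cpx m) (Cpx m))) p := by
    have h1 : HasFDerivAt (fun p : Cpx m × Cpx m => lin (q x.1) p.1)
        ((linL (q x.1)).comp (ContinuousLinearMap.fst ℂ (Cpx m) (Cpx m))) p :=
      ((linL (q x.1)).comp (ContinuousLinearMap.fst ℂ (Cpx m) (Cpx m))).hasFDerivAt
    have h2 : HasDerivAt (fun ζ : ℂ => 1 / (I * ζ))
        (I / lin (q x.1) p.1 ^ 2) (lin (q x.1) p.1) := by
      have := (hasDerivAt_inv hZ).const_mul (1 / I)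
      refine (this.congr_deriv ?_).congr_of_eventuallyEq (Filter.Eventually.of_forall fun ζ => ?_)
      · simp; ring
      · simp [mul_comm]
    exact HasDerivAt.comp_hasFDerivAt (h₂ := fun ζ : ℂ => 1 / (I * ζ))
      (f := fun p : Cpx m × Cpx m => lin (q x.1) p.1) p h2 h1
  have hH : HasFDerivAt (fun p => c x.1 * h (X x.1 x.2 p)) _ p := (h2.comp p hX).const_mul (c x.1)
  have hD := (hK.fun_smul hH).fun_sub ((hG.fun_mul hQ).fun_const_smul (1 / (2 * I) : ℂ))
  refine ⟨hD.differentiableAt, fun w => ?_⟩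
  have h0 : lin (q x.1) (0 : Cpx m) = 0 := (linL (q x.1)).map_zero
  have hc : c x.1 * (ψ * (X x.1 x.2 p * (algebraMap ℂ A (2 * Real.pi * I * lin (q x.1) w) +
      lin (q x.1) p.1 • rayConv ω q p.1 (fun y => fderiv ℂ (wt c g X y) p (0, w)) x))) =
      (2 * Real.pi * I * lin (q x.1) w) • wt c g X x p + lin (q x.1) p.1 • (wt c g X x p *
        rayConv ω q p.1 (fun y => fderiv ℂ (wt c g X y) p (0, w)) x) := by
    rw [← mul_assoc ψ, h3, ← mul_assoc, ← wt, mul_add, mul_smul_comm, ← Algebra.commutes,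
      ← Algebra.smul_def]
  rw [HasFDerivAt.fderiv hD]
  have hXw := (S.fderiv_wt hp hx0 hx (0, w)).2
  simp only [h0, zero_smul, add_zero] at hXw
  rw [S.fderiv_rayConv_theta hp hx0 hx] at hXw
  simp only [sub_apply, add_apply,
    smul_apply, ContinuousLinearMap.smulRight_apply,
    ContinuousLinearMap.comp_apply, ContinuousLinearMap.coe_fst', linL_apply, h0,
    smul_eq_mul, S.fderiv_rayConv_theta hp hx0 hx,
    one_apply_eq_self, hXw, hc]
  rw [mul_comm _ (fderiv ℂ (wt c g X x) p (0, w))]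
  have c1 : 1 / (I * lin (q x.1) p.1) * (2 * Real.pi * I * lin (q x.1) w) =
      2 * Real.pi * (lin (q x.1) w / lin (q x.1) p.1) := by field_simp
  have c2 : 1 / (I * lin (q x.1) p.1) * lin (q x.1) p.1 = 1 / (2 * I) + 1 / (2 * I) := by
    field_simp; norm_num
  rw [smul_add, smul_smul, smul_smul, c1, c2]
  module

theorem integrable_plebPot (hp : p ∈ B) :
    Integrable (fun x => (1 / (I * lin (q x.1) p.1)) • (c x.1 * h (X x.1 x.2 p)) -
      (1 / (2 * I) : ℂ) • (wt c g X x p * rayConv ω q p.1 (fun y => wt c g X y p) x))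
      (rayMeasure ι) := by
  obtain ⟨C, hC0, hC⟩ := S.support
  have hCZ : ∀ i, ‖1 / (I * lin (q i) p.1)‖ ≤ C := fun i => by
    have hZ : 0 < ‖lin (q i) p.1‖ := norm_pos_iff.2 (S.lin_ne_zero hp i)
    rw [norm_div, norm_one, norm_mul, norm_I, one_mul, div_le_iff₀ hZ]
    exact (hC p hp i).2
  have j1 := (S.integral_mul_rayConv hp (S.adm_wt hp) (S.adm_wt hp) (a := fun _ => 1)
    measurable_const (C := 1) fun x hx => by rw [norm_one]; linarith).1
  simp only [one_smul] at j1
  refine Integrable.sub' ((S.integrable_h.const_mul C).mono' ((measurable_const.div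
    (measurable_const.mul (measurable_lin q p.1))).aestronglyMeasurable.smul
      (S.aestronglyMeasurable_h hp)) ?_) (j1.fun_smul _)
  filter_upwards [ae_rayMeasure_pos] with x hx0
  rw [norm_smul]
  exact mul_le_mul (hCZ x.1) (S.bound_h p hp x hx0) (norm_nonneg _) hC0

/-- The angular derivatives of the Plebański potential are the linear expressions `anglePot`: the
quadratic term contributes half the difference of two pairings, which agree since the integral
operator is symmetric. -/
theorem plebPot_holomorphic (hp : p ∈ B) :
    DifferentiableAt ℂ (plebPot ω q c g h X) p ∧
      ∀ w, fderiv ℂ (plebPot ω q c g h X) p (0, w) = anglePot q c g X w p := by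
  obtain ⟨C, hC0, hC⟩ := S.support
  have hCZ : ∀ p ∈ B, ∀ i, ‖1 / (I * lin (q i) p.1)‖ ≤ C := fun p hp i => by
    have hZ : 0 < ‖lin (q i) p.1‖ := norm_pos_iff.2 (S.lin_ne_zero hp i)
    rw [norm_div, norm_one, norm_mul, norm_I, one_mul, div_le_iff₀ hZ]
    exact (hC p hp i).2
  have hone : ∀ x : ι × ℝ, 0 < x.2 → ‖(1 : ℂ)‖ ≤ 1 * (1 + x.2) := fun x hx => by
    rw [norm_one]; linarith
  have hb : Integrable (fun x => N x * ∫ y, κ x y * N y ∂rayMeasure ι) (rayMeasure ι) := by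
    have hm : Measurable fun x : ι × ℝ => (1 + x.2)⁻¹ :=
      (measurable_const.add measurable_snd).inv
    refine (S.integrable_prod.integral_prod_left.bdd_mul (c := 1) hm.aestronglyMeasurable ?_).congr
      ?_
    · filter_upwards [ae_rayMeasure_pos] with x hx
      rw [norm_inv, Real.norm_of_nonneg (by positivity)]
      exact inv_le_one_of_one_le₀ (by linarith)
    · filter_upwards [ae_rayMeasure_pos] with x hx
      have : 1 + x.2 ≠ 0 := by positivity
      simp only [mul_assoc, integral_const_mul]
      rw [inv_mul_cancel_left₀ this]
  have hgood := S.integrable_kern hp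
  have key := hasFDerivAt_integral_of_holomorphic (μ := rayMeasure ι)
    (Φ := fun p x => (1 / (I * lin (q x.1) p.1)) • (c x.1 * h (X x.1 x.2 p)) -
      (1 / (2 * I) : ℂ) • (wt c g X x p * rayConv ω q p.1 (fun y => wt c g X y p) x))
    (b := fun x => C * N' x + ‖(1 / (2 * I) : ℂ)‖ * (N x * ∫ y, κ x y * N y ∂rayMeasure ι))
    S.isOpen (fun p hp => ?_) ?_ ?_ ((S.integrable_h.const_mul C).add (hb.const_mul _)) hp
  · refine ⟨key.1.fun_const_smul _, fun w => ?_⟩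
    have hA := S.adm_fderiv_wt hp (0, w)
    have i1 := (S.integrable_lin_div_smul hp (S.adm_wt hp) w).fun_smul (2 * Real.pi : ℂ)
    have i2 := (S.integral_mul_rayConv hp (S.adm_wt hp) hA (a := fun _ => 1)
      measurable_const hone).1
    have i3 := (S.integral_mul_rayConv hp hA (S.adm_wt hp) (a := fun _ => 1)
      measurable_const hone).1
    simp only [one_smul] at i2 i3
    have e1 : ∫ x, fderiv ℂ (fun p : Cpx m × Cpx m => (1 / (I * lin (q x.1) p.1)) •
        (c x.1 * h (X x.1 x.2 p)) -
      (1 / (2 * I) : ℂ) • (wt c g X x p * rayConv ω q p.1 (fun y => wt c g X y p) x)) p (0, w)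
        ∂rayMeasure ι = ∫ x, ((2 * Real.pi : ℂ) • ((lin (q x.1) w / lin (q x.1) p.1) • wt c g X x p) +
        (1 / (2 * I) : ℂ) • (wt c g X x p *
            rayConv ω q p.1 (fun y => fderiv ℂ (wt c g X y) p (0, w)) x -
          fderiv ℂ (wt c g X x) p (0, w) * rayConv ω q p.1 (fun y => wt c g X y p) x))
        ∂rayMeasure ι := by
      refine integral_congr_ae ?_
      filter_upwards [ae_rayMeasure_pos, hgood] with x hx0 hx
      rw [(S.plebPot_integrand hp hx0 hx).2, smul_smul]
    have e2 : plebPot ω q c g h X = fun p => (1 / (2 * Real.pi * I) : ℂ) •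
        ∫ x, ((1 / (I * lin (q x.1) p.1)) • (c x.1 * h (X x.1 x.2 p)) -
    (1 / (2 * I) : ℂ) • (wt c g X x p * rayConv ω q p.1 (fun y => wt c g X y p) x)) ∂rayMeasure ι := rfl
    rw [e2, fderiv_fun_const_smul key.1, smul_apply, (key.2 _).2, e1,
      integral_add i1 ((i2.sub' i3).fun_smul _), integral_smul, integral_smul, integral_sub i2 i3,
      S.integral_mul_rayConv_comm hp hA (S.adm_wt hp), sub_self, smul_zero, add_zero, anglePot,
      smul_smul]
    have hpi : (Real.pi : ℂ) ≠ 0 := Complex.ofReal_ne_zero.2 Real.pi_ne_zero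
    have e3 : (1 / (2 * Real.pi * I) : ℂ) * (2 * Real.pi) = -I := by
      rw [show (-I : ℂ) = 1 / I by simp]
      field_simp
    rw [e3]
    simp only [mul_smul, integral_smul]
  · exact (S.integrable_plebPot hp).1
  · filter_upwards [ae_rayMeasure_pos, hgood] with x hx0 hx p hp
    exact (S.plebPot_integrand hp hx0 hx).1.differentiableWithinAt
  · filter_upwards [ae_rayMeasure_pos, hgood] with x hx0 hx p hp
    refine (norm_sub_le _ _).trans (add_le_add ?_ ?_)
    · rw [norm_smul]
      exact mul_le_mul (hCZ p hp x.1) (S.bound_h p hp x hx0) (norm_nonneg _) hC0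
    · rw [norm_smul]
      refine mul_le_mul_of_nonneg_left ((norm_mul_le _ _).trans ?_) (norm_nonneg _)
      exact mul_le_mul (S.bound_wt p hp x hx0) (S.norm_rayConv_wt_le hp hx0 hx) (norm_nonneg _)
        (S.N_pos hp hx0).le

end UniformSolution

end Potentials

/-! ### Convergent solutions -/

theorem rayPoint_mem_bpsRay {Z : ℂ} (hZ : Z ≠ 0) {s : ℝ} (hs : 0 < s) :
    rayPoint Z s ∈ bpsRay Z := by
  have hs' : (s : ℂ) ≠ 0 := by exact_mod_cast hs.ne'
  refine ⟨by simp [rayPoint, hZ, hs'], -s, by linarith, ?_⟩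
  rw [rayPoint]
  push_cast
  field_simp
  simp

theorem semiflat_rayPoint (σ : Lat m → ℂ) (γ : Lat m) (z θ : Cpx m) (hZ : lin γ z ≠ 0) {s : ℝ}
    (hs : 0 < s) : semiflat σ γ z θ (rayPoint (lin γ z) s) =
      σ γ * exp (2 * Real.pi * I * lin γ θ - 2 * Real.pi * s) := by
  have hs' : (s : ℂ) ≠ 0 := by exact_mod_cast hs.ne'
  have : lin γ z / rayPoint (lin γ z) s = -(I * s) := by
    rw [rayPoint]
    field_simp
    simp
  rw [semiflat, this]
  congr 2
  linear_combination (2 * Real.pi * s : ℂ) * I_sq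

theorem kern_rayPoint {ι : Type*} (ω : Matrix (Fin m) (Fin m) ℤ) (q : ι → Lat m) (i j : ι)
    (z : Cpx m) (hi : lin (q i) z ≠ 0) (hj : lin (q j) z ≠ 0) {s s' : ℝ} (hs : 0 < s)
    (hs' : 0 < s') :
    kern ω (q i) (q j) (rayPoint (lin (q i) z) s) (rayPoint (lin (q j) z) s') =
      I * lin (q i) z * lin (q j) z * rayKern ω q (i, s) (j, s') z := by
  have h1 : (s : ℂ) ≠ 0 := by exact_mod_cast hs.ne'
  have h2 : (s' : ℂ) ≠ 0 := by exact_mod_cast hs'.ne'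
  rw [kern, rayKern, rayPoint, rayPoint]
  simp only
  have hd : I * lin (q j) z / (s' : ℂ) - I * lin (q i) z / s =
      I * (s * lin (q j) z - s' * lin (q i) z) / (s * s') := by
    field_simp
  rw [hd]
  rcases eq_or_ne ((s : ℂ) * lin (q j) z - s' * lin (q i) z) 0 with h0 | h0
  · simp [h0]
  · field_simp

theorem not_aligned_sub_ne_zero {Z Z' : ℂ} (hZ : Z ≠ 0) (h : ¬ Aligned Z Z') {s s' : ℝ}
    (hs : 0 < s) (hs' : 0 < s') : (s : ℂ) * Z' - s' * Z ≠ 0 := by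
  intro h0
  apply h
  have h1 : (s : ℂ) ≠ 0 := by exact_mod_cast hs.ne'
  have e : Z' = ((s' / s : ℝ) : ℂ) * Z := by
    push_cast
    field_simp
    linear_combination h0
  have e2 : Z * (starRingEnd ℂ) Z' = ((s' / s * normSq Z : ℝ) : ℂ) := by
    rw [e, map_mul, conj_ofReal, mul_left_comm, mul_conj]
    push_cast
    ring
  have := normSq_pos.2 hZ
  refine ⟨by rw [e2, ofReal_im], ?_⟩
  rw [e2, ofReal_re]
  positivity

theorem norm_le_of_cast (γ : Lat m) (a : Fin m) : ‖(γ a : ℂ)‖ ≤ ‖γ‖ := by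
  have h := norm_le_pi_norm γ a
  rwa [Complex.norm_intCast, ← Int.norm_eq_abs]

theorem one_le_norm_charge {γ : Lat m} (hγ : γ ≠ 0) : 1 ≤ ‖γ‖ := by
  obtain ⟨a, ha⟩ := Function.ne_iff.1 hγ
  refine le_trans ?_ (norm_le_pi_norm γ a)
  rw [Int.norm_eq_abs]
  exact_mod_cast Int.one_le_abs ha

/-- The charges of nonzero weight. -/
abbrev Active (c : Lat m → ℂ) := {γ : Lat m // c γ ≠ 0}

/-- The unknowns as functions of the ray parameter. -/
def onRay (c : Lat m → ℂ) (X : Lat m → Cpx m → Cpx m → ℂ → ℂ) (i : Active c) (s : ℝ)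
    (p : Cpx m × Cpx m) : ℂ :=
  X i.1 p.1 p.2 (rayPoint (lin i.1 p.1) s)

section Convergent

variable {ω : Matrix (Fin m) (Fin m) ℤ} {σ c : Lat m → ℂ} {g h : ℂ → ℂ}
  {D : Set (Cpx m × Cpx m)} {X : Lat m → Cpx m → Cpx m → ℂ → ℂ}

theorem sumInt_eq_tsum_active (c : Lat m → ℂ) (z : Cpx m) (f : Lat m → ℂ → ℂ) :
    sumInt c z f = ∑' j : Active c, ∫ s in Ioi (0 : ℝ),
      c j.1 * (f j.1 (rayPoint (lin j.1 z) s) / (I * lin j.1 z)) := by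
  have h := tsum_subtype_eq_of_support_subset (f := fun γ => c γ * rayInt (lin γ z) (f γ))
    (s := {γ | c γ ≠ 0}) fun γ hγ h0 => hγ (by simp [h0])
  rw [sumInt, ← h]
  exact tsum_congr fun j => (integral_const_mul _ _).symm

namespace IsConvergentSolution

variable (H : IsConvergentSolution ω σ c g h D X)

include H

theorem charge_ne_zero {p : Cpx m × Cpx m} (hp : p ∈ D) {γ : Lat m} (hγ : c γ ≠ 0) : γ ≠ 0 := by
  rintro rfl
  obtain ⟨ε, hε, h⟩ := H.support
  have := h p hp 0 hγ
  simp [lin] at this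

theorem lin_ne_zero {p : Cpx m × Cpx m} (hp : p ∈ D) {γ : Lat m} (hγ : c γ ≠ 0) :
    lin γ p.1 ≠ 0 := by
  obtain ⟨ε, hε, h⟩ := H.support
  intro h0
  have := h p hp γ hγ
  rw [h0, norm_zero] at this
  have h2 := one_le_norm_charge (H.charge_ne_zero hp hγ)
  nlinarith

theorem sumInt_kern {p : Cpx m × Cpx m} (hp : p ∈ D) (i : Active c) {s : ℝ} (hs : 0 < s) :
    sumInt c p.1 (fun γ' t' => kern ω i.1 γ' (rayPoint (lin i.1 p.1) s) t' * g (X γ' p.1 p.2 t')) =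
      ∑' j : Active c, ∫ s' in Ioi (0 : ℝ),
        (lin i.1 p.1 * rayKern ω Subtype.val (i, s) (j, s') p.1) •
          wt (fun j : Active c => c j.1) g (onRay c X) (j, s') p := by
  rw [sumInt_eq_tsum_active]
  refine tsum_congr fun j => setIntegral_congr_fun measurableSet_Ioi fun s' hs' => ?_
  have hi := H.lin_ne_zero hp i.2
  have hj := H.lin_ne_zero hp j.2
  simp only [wt, onRay, smul_eq_mul]
  rw [kern_rayPoint ω Subtype.val i j p.1 hi hj hs hs']
  field_simp

/-- Near each point of `D` a convergent solution is a uniform one. -/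
theorem exists_uniformSolution (hω : ω.transpose = -ω) (hσ : ∀ γ, σ γ ≠ 0) (hD : IsOpen D)
    (hreg : ∀ p ∈ D, ∀ γ, c γ ≠ 0 → ∀ t ∈ bpsRay (lin γ p.1), ∃ φ ψ : ℂ,
      HasDerivAt g φ (X γ p.1 p.2 t) ∧ HasDerivAt h ψ (X γ p.1 p.2 t) ∧
      ψ * X γ p.1 p.2 t = g (X γ p.1 p.2 t) ∧ g (X γ p.1 p.2 t) ≠ 0)
    {p₀ : Cpx m × Cpx m} (hp₀ : p₀ ∈ D) : ∃ (B : Set (Cpx m × Cpx m)) (N N' : Active c × ℝ → ℝ)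
      (κ : Active c × ℝ → Active c × ℝ → ℝ), p₀ ∈ B ∧ B ⊆ D ∧
      UniformSolution ω Subtype.val (fun i : Active c => σ i.1) (fun i : Active c => c i.1) g h B
        (onRay c X) N N' κ := by
  obtain ⟨V, hV, M, M', κ, hM, hκ, i1, s1, i2, s2, i3, s3⟩ := H.dominated p₀ hp₀
  have hsub : interior V ∩ D ⊆ V ∩ D := inter_subset_inter_left _ interior_subset
  have hp₀V : p₀ ∈ V ∩ D := ⟨mem_of_mem_nhds hV, hp₀⟩
  have hray : ∀ p ∈ D, ∀ i : Active c, ∀ s : ℝ, 0 < s →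
      rayPoint (lin i.1 p.1) s ∈ bpsRay (lin i.1 p.1) := fun p hp i s hs =>
    rayPoint_mem_bpsRay (H.lin_ne_zero hp i.2) hs
  have hM0 : ∀ i : Active c, ∀ s : ℝ, 0 < s → 0 ≤ M i.1 s := fun i s hs =>
    (norm_nonneg _).trans (hM p₀ hp₀V i.1 i.2 s hs).1
  have hM0' : ∀ i : Active c, ∀ s : ℝ, 0 < s → 0 ≤ M' i.1 s := fun i s hs =>
    (norm_nonneg _).trans (hM p₀ hp₀V i.1 i.2 s hs).2.2
  have hκ0 : ∀ i j : Active c, ∀ s s' : ℝ, 0 < s → 0 < s' → 0 ≤ κ i.1 j.1 s s' :=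
    fun i j s s' hs hs' => (norm_nonneg _).trans (hκ p₀ hp₀V i.1 j.1 i.2 j.2 s s' hs hs')
  refine ⟨interior V ∩ D, fun x => ‖c x.1.1‖ * M x.1.1 x.2, fun x => ‖c x.1.1‖ * M' x.1.1 x.2,
    fun x y => κ x.1.1 y.1.1 x.2 y.2, ⟨mem_interior_iff_mem_nhds.2 hV, hp₀⟩, inter_subset_right,
    ?_⟩
  refine
    { skew := hω
      isOpen := isOpen_interior.inter hD
      support := ?_
      offWalls := fun p hp i j hij s s' hs hs' => not_aligned_sub_ne_zero
        (H.lin_ne_zero hp.2 i.2) (H.offWalls p hp.2 i.1 j.1 i.2 j.2 hij) hs hs'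
      sigma_ne_zero := fun i => hσ i.1
      regular := fun p hp i s hs => ?_
      ne_zero := fun p hp x hx => ?_
      tba := fun p hp i s hs => ?_
      holomorphic := fun i s hs => (H.holomorphic i.1 i.2 s hs).mono inter_subset_right
      differentiable := fun p hp i s hs => H.differentiable p hp.2 i.1 i.2 s hs
      bound_wt := fun p hp x hx => ?_
      bound_wtD := fun p hp x hx => ?_
      bound_h := fun p hp x hx => ?_
      bound_kern := fun p hp x y hx hy => ?_
      integrable := integrable_rayMeasure_iff.2 ⟨fun i => ?_, ?_⟩
      integrable_h := integrable_rayMeasure_iff.2 ⟨fun i => i2 i.1, ?_⟩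
      integrable_prod := integrable_rayMeasure_prod_iff.2 ⟨fun i j => ?_, ?_⟩ }
  · obtain ⟨ε, hε, h⟩ := H.support
    refine ⟨ε⁻¹, by positivity, fun p hp i => ?_⟩
    have h1 := h p hp.2 i.1 i.2
    have h2 : ‖i.1‖ ≤ ε⁻¹ * ‖lin i.1 p.1‖ := by
      rw [inv_mul_eq_div, le_div_iff₀ hε, mul_comm]
      exact h1.le
    exact ⟨fun a => (norm_le_of_cast i.1 a).trans h2,
      (one_le_norm_charge (H.charge_ne_zero hp.2 i.2)).trans h2⟩
  · obtain ⟨φ, ψ, h1, h2, h3, -⟩ := hreg p hp.2 i.1 i.2 _ (hray p hp.2 i s hs)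
    refine ⟨φ, ψ, h1.hasFDerivAt.congr_fderiv ?_, h2.hasFDerivAt.congr_fderiv ?_, h3⟩ <;>
    · ext
      simp
  · obtain ⟨φ, ψ, -, -, -, h4⟩ := hreg p hp.2 x.1.1 x.1.2 _ (hray p hp.2 x.1 x.2 hx)
    exact mul_ne_zero x.1.2 h4
  · have h1 := H.tba p hp.2 i.1 i.2 _ (hray p hp.2 i s hs)
    rw [semiflat_rayPoint σ i.1 p.1 p.2 (H.lin_ne_zero hp.2 i.2) hs, H.sumInt_kern hp.2 i hs] at h1
    rw [onRay, h1, smul_eq_mul, Complex.exp_eq_exp_ℂ]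
  · rw [wt, norm_mul]
    exact mul_le_mul_of_nonneg_left (hM p (hsub hp) x.1.1 x.1.2 x.2 hx).1 (norm_nonneg _)
  · rw [wtD, norm_mul]
    refine mul_le_mul_of_nonneg_left ?_ (norm_nonneg _)
    rw [← Complex.coe_smul]
    exact (hM p (hsub hp) x.1.1 x.1.2 x.2 hx).2.1
  · rw [norm_mul]
    exact mul_le_mul_of_nonneg_left (hM p (hsub hp) x.1.1 x.1.2 x.2 hx).2.2 (norm_nonneg _)
  · have hi := H.lin_ne_zero hp.2 x.1.2
    have hj := H.lin_ne_zero hp.2 y.1.2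
    have h1 := hκ p (hsub hp) x.1.1 y.1.1 x.1.2 y.1.2 x.2 y.2 hx hy
    have e : kern ω x.1.1 y.1.1 (rayPoint (lin x.1.1 p.1) x.2) (rayPoint (lin y.1.1 p.1) y.2) /
        (lin x.1.1 p.1 * lin y.1.1 p.1) = I * rayKern ω Subtype.val x y p.1 := by
      rw [kern_rayPoint ω Subtype.val x.1 y.1 p.1 hi hj hx hy]
      field_simp
    rw [e, norm_mul, norm_I, one_mul] at h1
    exact h1
  · refine (i1 i.1).congr_fun (fun s _ => ?_) measurableSet_Ioi
    ring
  · refine (s1.comp_injective Subtype.val_injective).congr fun i =>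
      setIntegral_congr_fun measurableSet_Ioi fun s hs => ?_
    have h1 := hM0 i s hs
    have h2 : (0 : ℝ) < s := hs
    simp only
    rw [Real.norm_of_nonneg (by positivity)]
    ring
  · refine (s2.comp_injective Subtype.val_injective).congr fun i =>
      setIntegral_congr_fun measurableSet_Ioi fun s hs => ?_
    have h1 := hM0' i s hs
    simp only
    rw [Real.norm_of_nonneg (by positivity)]
  · refine (i3 i.1 j.1).congr_fun (fun w _ => ?_) (measurableSet_Ioi.prod measurableSet_Ioi)
    ring
  · refine (s3.comp_injective (Subtype.val_injective.prodMap Subtype.val_injective)).congr fun i =>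
      setIntegral_congr_fun (measurableSet_Ioi.prod measurableSet_Ioi) fun w hw => ?_
    have h1 := hM0 i.1 w.1 hw.1
    have h1' := hM0 i.2 w.2 hw.2
    have h2 := hκ0 i.1 i.2 w.1 w.2 hw.1 hw.2
    have h3 : (0 : ℝ) < w.1 := hw.1
    simp only [Prod.map_fst, Prod.map_snd]
    rw [Real.norm_of_nonneg (by positivity)]
    ring

theorem potF_eq {B : Set (Cpx m × Cpx m)} {N N' : Active c × ℝ → ℝ}
    {κ : Active c × ℝ → Active c × ℝ → ℝ} (hBD : B ⊆ D)
    (S : UniformSolution ω Subtype.val (fun i : Active c => σ i.1) (fun i : Active c => c i.1) g h B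
        (onRay c X) N N' κ) {p : Cpx m × Cpx m} (hp : p ∈ B) :
    potF c g X p.1 p.2 = joycePot (fun i : Active c => c i.1) g (onRay c X) p := by
  have h1 := S.integrable_smul hp (S.adm_wt hp) (a := fun _ => -I) measurable_const (C := 1)
    fun x hx => by rw [norm_neg, norm_I]; linarith
  rw [potF, joycePot, sumInt_eq_tsum_active, integral_rayMeasure h1]
  refine tsum_congr fun j => setIntegral_congr_fun measurableSet_Ioi fun s hs => ?_
  have hj := H.lin_ne_zero (hBD hp) j.2
  simp only [wt, onRay, smul_eq_mul]
  rw [show (-I : ℂ) = 1 / I by simp]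
  field_simp

theorem potW_eq {B : Set (Cpx m × Cpx m)} {N N' : Active c × ℝ → ℝ}
    {κ : Active c × ℝ → Active c × ℝ → ℝ} (hBD : B ⊆ D)
    (S : UniformSolution ω Subtype.val (fun i : Active c => σ i.1) (fun i : Active c => c i.1) g h B
        (onRay c X) N N' κ) {p : Cpx m × Cpx m} (hp : p ∈ B) :
    potW ω c g h X p.1 p.2 =
      plebPot ω Subtype.val (fun i : Active c => c i.1) g h (onRay c X) p := by
  rw [potW, plebPot, sumInt_eq_tsum_active, integral_rayMeasure (S.integrable_plebPot hp),
    smul_eq_mul]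
  congr 1
  refine tsum_congr fun j => integral_congr_ae ?_
  filter_upwards [ae_restrict_mem measurableSet_Ioi,
    ae_rayMeasure_iff.1 (S.integrable_kern hp) j] with s hs hk
  have hj := H.lin_ne_zero (hBD hp) j.2
  have e := H.sumInt_kern (hBD hp) j hs
  have h1 := S.integrable_kern_smul hp (S.adm_wt hp) (x := (j, s)) hs hk
  have h2 := integral_rayMeasure (h1.fun_smul (lin j.1 p.1))
  rw [integral_smul, ← rayConv] at h2
  simp only [smul_smul] at h2
  rw [e, ← h2]
  simp only [wt, onRay, smul_eq_mul]
  field_simp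

end IsConvergentSolution

theorem dz_eq_fderiv {Φ : Cpx m → Cpx m → ℂ} {p : Cpx m × Cpx m} (a : Fin m)
    (hΦ : DifferentiableAt ℂ (fun p : Cpx m × Cpx m => Φ p.1 p.2) p) :
    dz a Φ p.1 p.2 = fderiv ℂ (fun p : Cpx m × Cpx m => Φ p.1 p.2) p (Pi.single a 1, 0) := by
  have h1 : HasFDerivAt (𝕜 := ℂ) (fun w : Cpx m => (w, p.2)) _ p.1 := hasFDerivAt_prodMk_left p.1 p.2
  have h2 := (hΦ.hasFDerivAt (x := p)).comp p.1 h1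
  exact congrArg (fun L : Cpx m →L[ℂ] ℂ => L (Pi.single a 1)) h2.fderiv

theorem dθ_eq_fderiv {Φ : Cpx m → Cpx m → ℂ} {p : Cpx m × Cpx m} (a : Fin m)
    (hΦ : DifferentiableAt ℂ (fun p : Cpx m × Cpx m => Φ p.1 p.2) p) :
    dθ a Φ p.1 p.2 = fderiv ℂ (fun p : Cpx m × Cpx m => Φ p.1 p.2) p (0, Pi.single a 1) := by
  have h1 : HasFDerivAt (𝕜 := ℂ) (fun w : Cpx m => (p.1, w)) _ p.2 := hasFDerivAt_prodMk_right p.1 p.2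
  have h2 := (hΦ.hasFDerivAt (x := p)).comp p.2 h1
  exact congrArg (fun L : Cpx m →L[ℂ] ℂ => L (Pi.single a 1)) h2.fderiv

/-- The potentials of a convergent solution satisfy the isomonodromy equation, and `F` is the
contraction of the angular derivatives of `W` with `z`. -/
theorem IsConvergentSolution.potentialEq (H : IsConvergentSolution ω σ c g h D X)
    (hω : ω.transpose = -ω) (hσ : ∀ γ, σ γ ≠ 0) (hD : IsOpen D)
    (hreg : ∀ p ∈ D, ∀ γ, c γ ≠ 0 → ∀ t ∈ bpsRay (lin γ p.1), ∃ φ ψ : ℂ,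
      HasDerivAt g φ (X γ p.1 p.2 t) ∧ HasDerivAt h ψ (X γ p.1 p.2 t) ∧
      ψ * X γ p.1 p.2 t = g (X γ p.1 p.2 t) ∧ g (X γ p.1 p.2 t) ≠ 0) :
    PotentialEq ω D (potF c g X) (potW ω c g h X) ∧ ∀ p ∈ D, potF c g X p.1 p.2 =
      ∑ a, p.1 a * dθ a (potW ω c g h X) p.1 p.2 := by
  set q : Active c → Lat m := Subtype.val
  set cr : Active c → ℂ := fun i => c i.1
  have key : ∀ p ∈ D,
      DifferentiableAt ℂ (fun p : Cpx m × Cpx m => potF c g X p.1 p.2) p ∧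
      DifferentiableAt ℂ (fun p : Cpx m × Cpx m => potW ω c g h X p.1 p.2) p ∧
      (∀ a, DifferentiableAt ℂ (fun p : Cpx m × Cpx m => dθ a (potW ω c g h X) p.1 p.2) p) ∧
      (∀ e, dz e (potF c g X) p.1 p.2 = 1 / (2 * Real.pi * I) ^ 2 *
        ∑ a, ∑ b, (ω a b : ℂ) * dθ a (potF c g X) p.1 p.2 *
          dθ b (dθ e (potW ω c g h X)) p.1 p.2) ∧
      potF c g X p.1 p.2 = ∑ a, p.1 a * dθ a (potW ω c g h X) p.1 p.2 := by
    intro p hp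
    obtain ⟨B, N, N', κ, hpB, hBD, S⟩ := H.exists_uniformSolution hω hσ hD hreg hp
    have hnhds : ∀ p' ∈ B, B ∈ 𝓝 p' := fun p' hp' => S.isOpen.mem_nhds hp'
    have eF : ∀ p' ∈ B, (fun p : Cpx m × Cpx m => potF c g X p.1 p.2) =ᶠ[𝓝 p']
        joycePot cr g (onRay c X) := fun p' hp' =>
      Filter.mem_of_superset (hnhds p' hp') fun p'' h'' => H.potF_eq hBD S h''
    have eW : ∀ p' ∈ B, (fun p : Cpx m × Cpx m => potW ω c g h X p.1 p.2) =ᶠ[𝓝 p']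
        plebPot ω q cr g h (onRay c X) := fun p' hp' =>
      Filter.mem_of_superset (hnhds p' hp') fun p'' h'' => H.potW_eq hBD S h''
    have dF : ∀ p' ∈ B, DifferentiableAt ℂ (fun p : Cpx m × Cpx m => potF c g X p.1 p.2) p' :=
      fun p' hp' => (S.joycePot_holomorphic hp').1.congr_of_eventuallyEq (eF p' hp')
    have dW : ∀ p' ∈ B, DifferentiableAt ℂ (fun p : Cpx m × Cpx m => potW ω c g h X p.1 p.2) p' :=
      fun p' hp' => (S.plebPot_holomorphic hp').1.congr_of_eventuallyEq (eW p' hp')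
    have eE : ∀ p' ∈ B, ∀ a, dθ a (potW ω c g h X) p'.1 p'.2 =
        anglePot q cr g (onRay c X) (Pi.single a 1) p' := fun p' hp' a => by
      rw [dθ_eq_fderiv a (dW p' hp'), (eW p' hp').fderiv_eq, (S.plebPot_holomorphic hp').2]
    have eE' : ∀ a, (fun p : Cpx m × Cpx m => dθ a (potW ω c g h X) p.1 p.2) =ᶠ[𝓝 p]
        anglePot q cr g (onRay c X) (Pi.single a 1) := fun a =>
      Filter.mem_of_superset (hnhds p hpB) fun p' hp' => eE p' hp' a
    have dE : ∀ a, DifferentiableAt ℂ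
        (fun p : Cpx m × Cpx m => dθ a (potW ω c g h X) p.1 p.2) p := fun a =>
      (S.anglePot_holomorphic hpB _).1.congr_of_eventuallyEq (eE' a)
    refine ⟨dF p hpB, dW p hpB, dE, fun e => ?_, ?_⟩
    · rw [dz_eq_fderiv e (dF p hpB), (eF p hpB).fderiv_eq, S.fderiv_joycePot_eq hpB, smul_eq_mul]
      simp only [dθ_eq_fderiv _ (dF p hpB), dθ_eq_fderiv _ (dE e), (eF p hpB).fderiv_eq,
        (eE' e).fderiv_eq, smul_eq_mul, mul_assoc]
      rfl
    · rw [H.potF_eq hBD S hpB, S.joycePot_eq_anglePot hpB, S.anglePot_eq_sum hpB]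
      simp only [eE p hpB, smul_eq_mul, q, cr]
  exact ⟨⟨fun p hp => (key p hp).1.differentiableWithinAt,
    fun p hp => (key p hp).2.1.differentiableWithinAt,
    fun a p hp => ((key p hp).2.2.1 a).differentiableWithinAt, fun p hp => (key p hp).2.2.2.1⟩,
    fun p hp => (key p hp).2.2.2.2⟩

end Convergent

/-! ### The dilogarithm -/

/-- On the segment from `0` to a point `x` outside the cut, the argument of the logarithm stays in
the slit plane. -/
theorem one_sub_mul_mem_slitPlane {x : ℂ} (hx : 1 - x ∈ slitPlane) {u : ℝ} (hu : u ∈ Icc (0 : ℝ) 1) :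
    1 - x * u ∈ slitPlane := by
  have h := starConvex_one_slitPlane hx (a := 1 - u) (b := u) (by linarith [hu.2]) hu.1 (by ring)
  convert h using 1
  simp only [real_smul]
  push_cast
  ring

theorem negLog_eq_zero_iff {x : ℂ} (hx : 1 - x ∈ slitPlane) : negLog x = 0 ↔ x = 0 := by
  constructor
  · intro h
    have h1 : log (1 - x) = 0 := by simpa [negLog] using h
    have h2 := exp_log (slitPlane_ne_zero hx)
    rw [h1, exp_zero] at h2
    linear_combination h2
  · rintro rfl
    simp [negLog]

theorem hasDerivAt_negLog {x : ℂ} (hx : 1 - x ∈ slitPlane) : HasDerivAt negLog (1 / (1 - x)) x := by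
  have h := (((hasDerivAt_id x).const_sub 1).clog hx).neg
  refine h.congr_deriv ?_
  simp [neg_div]

/-- The derivative `-log (1 - x) / x` of the dilogarithm outside its cut. The point `0` is left out
because there the quotient takes the junk value `0` instead of `1`. -/
theorem hasDerivAt_dilog {x : ℂ} (hx : 1 - x ∈ slitPlane) (hx0 : x ≠ 0) :
    HasDerivAt dilog (negLog x / x) x := by
  -- a compact neighbourhood on which the derivative of the integrand is bounded
  set Φ : ℂ → ℝ → ℂ := fun x u => log (1 - x * u) / u with hΦ
  set Φ' : ℂ → ℝ → ℂ := fun x u => -1 / (1 - x * u) with hΦ'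
  have hopen : IsOpen {y : ℂ | 1 - y ∈ slitPlane} :=
    isOpen_slitPlane.preimage (continuous_const.sub continuous_id)
  obtain ⟨ε, hε, hball⟩ := Metric.isOpen_iff.1 hopen x hx
  have hcb : Metric.closedBall x (ε / 2) ⊆ {y : ℂ | 1 - y ∈ slitPlane} :=
    (Metric.closedBall_subset_ball (by linarith)).trans hball
  have hcont : ContinuousOn (fun w : ℂ × ℝ => Φ' w.1 w.2)
      (Metric.closedBall x (ε / 2) ×ˢ Icc (0 : ℝ) 1) := by
    refine ContinuousOn.div continuousOn_const (by fun_prop) fun w hw => ?_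
    exact slitPlane_ne_zero (one_sub_mul_mem_slitPlane (hcb hw.1) hw.2)
  obtain ⟨C, hC⟩ := ((isCompact_closedBall x (ε / 2)).prod isCompact_Icc).exists_bound_of_continuousOn hcont
  have hIoc : Set.uIoc (0 : ℝ) 1 = Ioc 0 1 := uIoc_of_le zero_le_one
  have hder : ∀ u ∈ Ioc (0 : ℝ) 1, ∀ y ∈ Metric.ball x (ε / 2),
      HasDerivAt (fun y => Φ y u) (Φ' y u) y := by
    intro u hu y hy
    have hs := one_sub_mul_mem_slitPlane (hcb (Metric.ball_subset_closedBall hy))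
      (Ioc_subset_Icc_self hu)
    have hu0 : (u : ℂ) ≠ 0 := by exact_mod_cast hu.1.ne'
    have h := ((((hasDerivAt_id y).mul_const (u : ℂ)).const_sub 1).clog hs).div_const (u : ℂ)
    refine h.congr_deriv ?_
    simp only [hΦ', id]
    have := slitPlane_ne_zero hs
    field_simp
  have hmeas : ∀ y : ℂ, Measurable (Φ y) := fun y => by
    have : Measurable fun u : ℝ => (1 - y * u : ℂ) := by fun_prop
    exact (Complex.measurable_log.comp this).div Complex.measurable_ofReal
  -- the integrand extends continuously to `u = 0`
  have hint : IntervalIntegrable (Φ x) volume 0 1 := by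
    have hbd : ∀ u ∈ Ioc (0 : ℝ) 1, ‖Φ x u‖ ≤ C * ‖x‖ := by
      intro u hu
      have hu0 : 0 < u := hu.1
      have hseg : ∀ v ∈ Icc (0 : ℝ) u, HasDerivWithinAt (fun v : ℝ => log (1 - x * v))
          (-x / (1 - x * v)) (Icc 0 u) v := fun v hv => by
        have hs := one_sub_mul_mem_slitPlane hx (u := v) ⟨hv.1, hv.2.trans hu.2⟩
        have h := ((((Complex.ofRealCLM.hasDerivAt (x := v)).const_mul x).const_sub 1).clog_real hs)
        refine (h.congr_deriv ?_).hasDerivWithinAt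
        simp
      have h := norm_image_sub_le_of_norm_deriv_le_segment' hseg (C := C * ‖x‖) (fun v hv => by
        have := hC (x, v) ⟨Metric.mem_closedBall_self (by linarith), hv.1,
          hv.2.le.trans hu.2⟩
        rw [show -x / (1 - x * v) = Φ' x v * x by simp only [hΦ']; ring, norm_mul]
        exact mul_le_mul_of_nonneg_right this (norm_nonneg _)) u (right_mem_Icc.2 hu0.le)
      simp only [ofReal_zero, mul_zero, sub_zero, log_one] at h
      rw [hΦ, norm_div, Complex.norm_of_nonneg hu0.le, div_le_iff₀ hu0]
      exact h
    rw [intervalIntegrable_iff, hIoc]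
    refine Measure.integrableOn_of_bounded (M := C * ‖x‖) (by simp)
      (hmeas x).aestronglyMeasurable ?_
    filter_upwards [ae_restrict_mem measurableSet_Ioc] with u hu using hbd u hu
  have key := (intervalIntegral.hasDerivAt_integral_of_dominated_loc_of_deriv_le (μ := volume)
    (F := Φ) (F' := Φ') (x₀ := x) (s := Metric.ball x (ε / 2)) (bound := fun _ => C)
    (a := 0) (b := 1) (Metric.ball_mem_nhds x (by linarith))
    (Filter.Eventually.of_forall fun y => (hmeas y).aestronglyMeasurable) hint
    (by fun_prop) ?_ intervalIntegrable_const ?_).2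
  · have hFTC : ∫ u in (0 : ℝ)..1, Φ' x u = log (1 - x) / x := by
      have h := intervalIntegral.integral_eq_sub_of_hasDerivAt (a := 0) (b := 1)
        (f := fun v : ℝ => log (1 - x * v) / x) (f' := fun v => Φ' x v) (fun v hv => by
          rw [uIcc_of_le zero_le_one] at hv
          have hs := one_sub_mul_mem_slitPlane hx hv
          have h := ((((Complex.ofRealCLM.hasDerivAt (x := v)).const_mul x).const_sub
            1).clog_real hs).div_const x
          refine h.congr_deriv ?_
          have := slitPlane_ne_zero hs
          simp only [hΦ']
          simp
          field_simp) (by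
          refine ContinuousOn.intervalIntegrable ?_
          rw [uIcc_of_le zero_le_one]
          exact hcont.comp (f := fun v : ℝ => (x, v)) (by fun_prop) fun v hv =>
            ⟨Metric.mem_closedBall_self (by linarith), hv⟩)
      simpa using h
    rw [hFTC] at key
    refine key.neg.congr_deriv ?_
    rw [negLog, neg_div]
  · refine Filter.Eventually.of_forall fun u hu y hy => ?_
    rw [hIoc] at hu
    exact hC (y, u) ⟨Metric.ball_subset_closedBall hy, Ioc_subset_Icc_self hu⟩
  · refine Filter.Eventually.of_forall fun u hu y hy => ?_
    rw [hIoc] at hu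
    exact hder u hu y hy

section Convergent

variable {ω : Matrix (Fin m) (Fin m) ℤ} {σ c : Lat m → ℂ}
  {D : Set (Cpx m × Cpx m)} {X : Lat m → Cpx m → Cpx m → ℂ → ℂ}

theorem IsConvergentSolution.X_ne_zero {g h : ℂ → ℂ} (H : IsConvergentSolution ω σ c g h D X)
    (hσ : ∀ γ, σ γ ≠ 0) {p : Cpx m × Cpx m} (hp : p ∈ D) {γ : Lat m} (hγ : c γ ≠ 0) {t : ℂ}
    (ht : t ∈ bpsRay (lin γ p.1)) : X γ p.1 p.2 t ≠ 0 := by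
  rw [H.tba p hp γ hγ t ht]
  exact mul_ne_zero (mul_ne_zero (hσ γ) (exp_ne_zero _)) (exp_ne_zero _)

theorem IsConvergentSolution.potentialEq_id (H : IsConvergentSolution ω σ c id id D X)
    (hω : ω.transpose = -ω) (hσ : ∀ γ, σ γ ≠ 0) (hD : IsOpen D) :
    PotentialEq ω D (potF c id X) (potW ω c id id X) ∧ ∀ p ∈ D, potF c id X p.1 p.2 =
      ∑ a, p.1 a * dθ a (potW ω c id id X) p.1 p.2 :=
  H.potentialEq hω hσ hD fun _ hp _ hγ _ ht => ⟨1, 1, hasDerivAt_id _, hasDerivAt_id _,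
    one_mul _, H.X_ne_zero hσ hp hγ ht⟩

theorem IsConvergentSolution.potentialEq_negLog
    (H : IsConvergentSolution ω σ c negLog dilog D X) (hω : ω.transpose = -ω)
    (hσ : ∀ γ, σ γ ≠ 0) (hD : IsOpen D)
    (hX : ∀ p ∈ D, ∀ γ, c γ ≠ 0 → ∀ t ∈ bpsRay (lin γ p.1), 1 - X γ p.1 p.2 t ∈ slitPlane) :
    PotentialEq ω D (potF c negLog X) (potW ω c negLog dilog X) ∧
      ∀ p ∈ D, potF c negLog X p.1 p.2 =
        ∑ a, p.1 a * dθ a (potW ω c negLog dilog X) p.1 p.2 :=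
  H.potentialEq hω hσ hD fun p hp γ hγ t ht => by
    have h0 := H.X_ne_zero hσ hp hγ ht
    have h1 := hX p hp γ hγ t ht
    exact ⟨_, _, hasDerivAt_negLog h1, hasDerivAt_dilog h1 h0, div_mul_cancel₀ _ h0,
      fun h => h0 ((negLog_eq_zero_iff h1).1 h)⟩

/-- A shift of `θ` that preserves the unknowns preserves both potentials. -/
theorem pot_congr (ω : Matrix (Fin m) (Fin m) ℤ) (c : Lat m → ℂ) (g h : ℂ → ℂ)
    (X : Lat m → Cpx m → Cpx m → ℂ → ℂ) {z θ θ' : Cpx m} (hz : ∀ γ, c γ ≠ 0 → lin γ z ≠ 0)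
    (hX : ∀ γ, c γ ≠ 0 → ∀ t ∈ bpsRay (lin γ z), X γ z θ t = X γ z θ' t) :
    potF c g X z θ = potF c g X z θ' ∧ potW ω c g h X z θ = potW ω c g h X z θ' := by
  have hs : ∀ f f' : Lat m → ℂ → ℂ, (∀ γ, c γ ≠ 0 → ∀ t ∈ bpsRay (lin γ z), f γ t = f' γ t) →
      sumInt c z f = sumInt c z f' := by
    intro f f' hf
    refine tsum_congr fun γ => ?_
    by_cases hγ : c γ = 0
    · simp [hγ]
    · congr 1
      refine setIntegral_congr_fun measurableSet_Ioi fun s hs => ?_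
      rw [hf γ hγ _ (rayPoint_mem_bpsRay (hz γ hγ) hs)]
  constructor
  · refine hs _ _ fun γ hγ t ht => ?_
    rw [hX γ hγ t ht]
  · rw [potW, potW]
    congr 1
    refine hs _ _ fun γ hγ t ht => ?_
    rw [hX γ hγ t ht]
    congr 2
    refine hs _ _ fun γ' hγ' t' ht' => ?_
    rw [hX γ' hγ' t' ht']

end Convergent

/-! ### Fourier modes on the real torus -/

/-- A directional derivative of a holomorphic function of several variables is holomorphic: it is a
Cauchy integral over a circle in the given direction. -/
theorem differentiableOn_fderiv_apply {P : Type*} [NormedAddCommGroup P] [NormedSpace ℂ P]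
    [FiniteDimensional ℂ P] {f : P → ℂ} {B : Set P} (hB : IsOpen B) (hf : DifferentiableOn ℂ f B) (v : P) :
    DifferentiableOn ℂ (fun p => fderiv ℂ f p v) B := by
  intro p hp
  obtain ⟨r, hr, hrB⟩ : ∃ r > 0, Metric.ball p r ⊆ B ∩ {y | ‖f y‖ < ‖f p‖ + 1} := by
    have h1 : B ∩ {y | ‖f y‖ < ‖f p‖ + 1} ∈ 𝓝 p := by
      refine Filter.inter_mem (hB.mem_nhds hp) ?_
      have hc := ((hf.differentiableAt (hB.mem_nhds hp)).continuousAt).norm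
      exact hc.eventually_lt continuousAt_const (by simp)
    exact Metric.mem_nhds_iff.1 h1
  set R : ℝ := r / 2 / (‖v‖ + 1) with hR
  have hv : 0 < ‖v‖ + 1 := by positivity
  have hR0 : 0 < R := by positivity
  have hRv : R * ‖v‖ < r / 2 := by
    rw [hR, div_mul_eq_mul_div, div_lt_iff₀ hv]
    nlinarith
  have hmem : ∀ w ∈ Metric.ball p (r / 2), ∀ ζ ∈ Metric.closedBall (0 : ℂ) R,
      w + ζ • v ∈ Metric.ball p r := by
    intro w hw ζ hζ
    rw [mem_ball_iff_norm] at hw ⊢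
    rw [mem_closedBall_zero_iff] at hζ
    calc ‖w + ζ • v - p‖ = ‖(w - p) + ζ • v‖ := by congr 1; abel
      _ ≤ ‖w - p‖ + ‖ζ • v‖ := norm_add_le _ _
      _ < r / 2 + r / 2 := by
        refine add_lt_add hw ?_
        rw [norm_smul]
        exact (mul_le_mul_of_nonneg_right hζ (norm_nonneg _)).trans_lt hRv
      _ = r := by ring
  have hfd : ∀ y ∈ Metric.ball p r, DifferentiableAt ℂ f y := fun y hy =>
    hf.differentiableAt (hB.mem_nhds (hrB hy).1)
  set Φ : P → ℝ → ℂ := fun w t => deriv (circleMap 0 R) t •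
    (((circleMap 0 R t - 0) ^ 2)⁻¹ • f (w + circleMap 0 R t • v)) with hΦ
  have hcirc : ∀ t, circleMap 0 R t ∈ Metric.closedBall (0 : ℂ) R := fun t =>
    Metric.sphere_subset_closedBall (circleMap_mem_sphere 0 hR0.le t)
  have hcauchy : ∀ w ∈ Metric.ball p (r / 2), fderiv ℂ f w v =
      (2 * Real.pi * I : ℂ)⁻¹ • ∫ t in Ioc 0 (2 * Real.pi), Φ w t := by
    intro w hw
    have hopen : IsOpen ((fun ζ : ℂ => w + ζ • v) ⁻¹' Metric.ball p r) :=
      Metric.isOpen_ball.preimage (by fun_prop)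
    have hline : ∀ ζ : ℂ, HasDerivAt (fun ζ : ℂ => w + ζ • v) v ζ := fun ζ => by
      simpa using ((hasDerivAt_id ζ).smul_const v).const_add w
    have h1 := two_pi_I_inv_smul_circleIntegral_sub_sq_inv_smul_of_differentiable hopen
      (fun ζ hζ => hmem w hw ζ hζ) (f := fun ζ => f (w + ζ • v)) (fun ζ hζ =>
        ((hfd _ hζ).comp ζ (hline ζ).differentiableAt).differentiableWithinAt)
      (Metric.mem_ball_self hR0)
    have h2 : deriv (fun ζ : ℂ => f (w + ζ • v)) 0 = fderiv ℂ f w v := by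
      have h3 : HasFDerivAt f (fderiv ℂ f w) (w + (0 : ℂ) • v) := by
        rw [zero_smul, add_zero]
        exact (hfd w (Metric.ball_subset_ball (by linarith) hw)).hasFDerivAt
      exact (h3.comp_hasDerivAt 0 (hline 0)).deriv
    rw [← h2, ← h1, circleIntegral, intervalIntegral.integral_of_le Real.two_pi_pos.le]
  have hcont : ∀ w ∈ Metric.ball p (r / 2), Continuous (Φ w) := by
    intro w hw
    have h1 : Continuous fun t => f (w + circleMap 0 R t • v) := by
      rw [continuous_iff_continuousAt]
      intro t
      exact ContinuousAt.comp (g := f) (f := fun t => w + circleMap 0 R t • v)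
        (hfd _ (hmem w hw _ (hcirc t))).continuousAt (by fun_prop)
    have h2 : ∀ t, (circleMap 0 R t - 0) ^ 2 ≠ 0 := fun t => by
      rw [sub_zero]
      exact pow_ne_zero 2 (circleMap_ne_center hR0.ne')
    simp only [hΦ, deriv_circleMap]
    have h3 : Continuous fun t => ((circleMap 0 R t - 0) ^ 2)⁻¹ :=
      Continuous.inv₀ (by fun_prop) h2
    have h4 : Continuous fun t => circleMap 0 R t * I := by fun_prop
    exact h4.smul (h3.smul h1)
  have key := (hasFDerivAt_integral_of_holomorphic (μ := volume.restrict (Ioc 0 (2 * Real.pi)))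
    (Φ := Φ) (B := Metric.ball p (r / 2)) (b := fun _ => R * ((R ^ 2)⁻¹ * (‖f p‖ + 1)))
    Metric.isOpen_ball (fun w hw => (hcont w hw).aestronglyMeasurable)
    (Filter.Eventually.of_forall fun t w hw => ?_) (Filter.Eventually.of_forall fun t w hw => ?_)
    (integrable_const _) (Metric.mem_ball_self (by linarith))).1
  · exact ((key.fun_const_smul _).congr_of_eventuallyEq (Filter.mem_of_superset
      (Metric.ball_mem_nhds p (half_pos hr)) hcauchy)).differentiableWithinAt
  · have h1 : DifferentiableAt ℂ (fun w => f (w + circleMap 0 R t • v)) w :=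
      DifferentiableAt.comp (g := f) (f := fun w => w + circleMap 0 R t • v) w
        (hfd _ (hmem w hw _ (hcirc t))) (by fun_prop)
    exact ((h1.fun_const_smul _).fun_const_smul _).differentiableWithinAt
  · have h1 := (hrB (hmem w hw _ (hcirc t))).2
    have h2 : ‖circleMap 0 R t‖ = R := by simp [abs_of_pos hR0]
    simp only [hΦ, norm_smul, deriv_circleMap, norm_mul, norm_I, mul_one, norm_inv, norm_pow,
      sub_zero, h2]
    gcongr
    exact (show ‖f (w + circleMap 0 R t • v)‖ < ‖f p‖ + 1 from h1).le

/-- The derivative of a periodic function integrates to zero over the unit cube. -/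
theorem integral_cube_fderiv_eq_zero {G : (Fin m → ℝ) → ℂ} {G' : (Fin m → ℝ) → (Fin m → ℝ) →L[ℝ] ℂ}
    (a : Fin m) (hG : ∀ x, HasFDerivAt G (G' x) x) (hper : ∀ x, G (x + Pi.single a 1) = G x)
    (hi : IntegrableOn (fun x => G' x (Pi.single a 1)) (Icc 0 1)) :
    ∫ x in Icc (0 : Fin m → ℝ) 1, G' x (Pi.single a 1) = 0 := by
  cases m with
  | zero => exact a.elim0
  | succ n =>
    have hG0 : ContinuousOn G (Icc 0 1) := fun x _ => (hG x).continuousAt.continuousWithinAt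
    have h := integral_divergence_of_hasFDerivAt_off_countable' (0 : Fin (n + 1) → ℝ) 1
      zero_le_one (fun i x => if i = a then G x else 0) (fun i x => if i = a then G' x else 0) ∅
      countable_empty (fun i => by split_ifs; exacts [hG0, continuousOn_const])
      (fun x _ i => by split_ifs; exacts [hG x, hasFDerivAt_const _ _]) ?_
    · have e : ∀ x, ∑ i, (if i = a then G' x else 0) (Pi.single i 1) = G' x (Pi.single a 1) := by
        intro x
        rw [Finset.sum_eq_single a (fun i _ hia => by simp [hia]) (by simp)]
        simp
      simp only [e] at h
      rw [h, Finset.sum_eq_single a (fun i _ hia => by simp [hia]) (by simp), sub_eq_zero]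
      simp only [if_true]
      refine setIntegral_congr_fun measurableSet_Icc fun x _ => ?_
      rw [← hper (Fin.insertNth a ((0 : Fin (n + 1) → ℝ) a) x)]
      congr 1
      ext j
      rcases Fin.eq_self_or_eq_succAbove a j with rfl | ⟨k, rfl⟩ <;> simp
    · refine hi.congr_fun (fun x _ => ?_) measurableSet_Icc
      rw [Finset.sum_eq_single a (fun i _ hia => by simp [hia]) (by simp)]
      simp

/-- The point with real coordinates `x` on the real torus through `θ₀`. -/
def realShift (θ₀ : Cpx m) (x : Fin m → ℝ) : Cpx m := fun a => θ₀ a + (x a : ℂ)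

/-- The inclusion `ℝᵐ → ℂᵐ`. -/
def realIncl (m : ℕ) : (Fin m → ℝ) →L[ℝ] Cpx m :=
  ContinuousLinearMap.pi fun a => Complex.ofRealCLM.comp
    (ContinuousLinearMap.proj (R := ℝ) (φ := fun _ : Fin m => ℝ) a)

theorem hasFDerivAt_realShift (θ₀ : Cpx m) (x : Fin m → ℝ) :
    HasFDerivAt (realShift θ₀) (realIncl m) x :=
  (realIncl m).hasFDerivAt.const_add θ₀

theorem continuous_realShift (θ₀ : Cpx m) : Continuous (realShift θ₀) :=
  continuous_iff_continuousAt.2 fun x => (hasFDerivAt_realShift θ₀ x).continuousAt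

/-- Holomorphic functions on a set `V` that are invariant under integral translations. -/
def PeriodicOn (V : Set (Cpx m)) (f : Cpx m → ℂ) : Prop :=
  DifferentiableOn ℂ f V ∧ ∀ θ ∈ V, ∀ k : Fin m → ℤ, f (fun a => θ a + (k a : ℂ)) = f θ

variable {V : Set (Cpx m)} {f f' : Cpx m → ℂ} {θ₀ : Cpx m}

theorem PeriodicOn.pderiv (hV : IsOpen V) (hf : PeriodicOn V f) (a : Fin m) :
    PeriodicOn V (pderiv a f) := by
  refine ⟨differentiableOn_fderiv_apply hV hf.1 _, fun θ hθ k => ?_⟩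
  have h1 : (fun η => f (η + fun a => (k a : ℂ))) =ᶠ[𝓝 θ] f :=
    Filter.mem_of_superset (hV.mem_nhds hθ) fun η hη => hf.2 η hη k
  have h2 := h1.fderiv_eq (𝕜 := ℂ)
  rw [fderiv_comp_add_right] at h2
  exact congrArg (fun L : Cpx m →L[ℂ] ℂ => L (Pi.single a 1)) h2

theorem PeriodicOn.continuous (hVr : ∀ x, realShift θ₀ x ∈ V)
    (hf : PeriodicOn V f) : Continuous fun x => f (realShift θ₀ x) :=
  hf.1.continuousOn.comp_continuous (continuous_realShift θ₀) hVr

/-- Integration by parts over the torus: an angular derivative acts on the modes by multiplication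
with `2πi γ_a`. -/
theorem fourierMode_pderiv (hV : IsOpen V) (hVr : ∀ x, realShift θ₀ x ∈ V) (hf : PeriodicOn V f)
    (a : Fin m) (γ : Lat m) :
    fourierMode (pderiv a f) θ₀ γ = 2 * Real.pi * I * γ a * fourierMode f θ₀ γ := by
  set E : Cpx m → ℂ := fun θ => exp (-(2 * Real.pi * I * lin γ θ)) with hE
  have hE' : ∀ θ, HasFDerivAt E (E θ • (-(2 * Real.pi * I) • linL γ)) θ := fun θ => by
    have h1 : HasFDerivAt (fun θ => -(2 * Real.pi * I * lin γ θ)) (-(2 * Real.pi * I) • linL γ) θ := by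
      have := ((linL γ).hasFDerivAt (x := θ)).const_mul (-(2 * Real.pi * I))
      simpa [neg_mul] using this
    exact h1.cexp
  have hfE : ∀ x, HasFDerivAt (fun θ => f θ * E θ) _ (realShift θ₀ x) := fun x =>
    ((hf.1.differentiableAt (hV.mem_nhds (hVr x))).hasFDerivAt).fun_mul (hE' _)
  have hG : ∀ x, HasFDerivAt (fun x => f (realShift θ₀ x) * E (realShift θ₀ x)) _ x := fun x =>
    ((hfE x).restrictScalars ℝ).comp x (hasFDerivAt_realShift θ₀ x)
  have hv : realIncl m (Pi.single a 1) = (Pi.single a 1 : Cpx m) := by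
    ext b
    simp only [realIncl, ContinuousLinearMap.coe_pi', ContinuousLinearMap.comp_apply,
      ContinuousLinearMap.proj_apply, ofRealCLM_apply]
    by_cases hb : b = a
    · subst hb; simp
    · simp [hb]
  have c1 := ((hf.pderiv hV a).continuous hVr)
  have c2 := hf.continuous hVr
  have c3 : Continuous fun x => E (realShift θ₀ x) :=
    (continuous_iff_continuousAt.2 fun θ => (hE' θ).continuousAt).comp (continuous_realShift θ₀)
  have hper : ∀ x, E (realShift θ₀ (x + Pi.single a 1)) = E (realShift θ₀ x) := by
    intro x
    have h1 : realShift θ₀ (x + Pi.single a 1) = realShift θ₀ x + Pi.single a 1 := by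
      ext b
      by_cases hb : b = a
      · subst hb; simp [realShift, add_assoc]
      · simp [realShift, hb]
    simp only [hE]
    rw [h1, lin_add, lin_single, show -(2 * Real.pi * I * (lin γ (realShift θ₀ x) + γ a)) =
      -(2 * Real.pi * I * lin γ (realShift θ₀ x)) + ((-γ a : ℤ) : ℂ) * (2 * Real.pi * I) by
        push_cast; ring, exp_add, exp_int_mul_two_pi_mul_I, mul_one]
  have hper' : ∀ x, f (realShift θ₀ (x + Pi.single a 1)) = f (realShift θ₀ x) := by
    intro x
    rw [← hf.2 _ (hVr x) (Pi.single a 1)]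
    congr 1
    ext b
    by_cases hb : b = a
    · subst hb; simp [realShift, add_assoc]
    · simp [realShift, hb]
  have hz := integral_cube_fderiv_eq_zero a hG (fun x => by rw [hper, hper']) ?_
  · simp only [ContinuousLinearMap.comp_apply, hv, ContinuousLinearMap.coe_restrictScalars',
      add_apply, smul_apply, linL_apply, lin_single, smul_eq_mul] at hz
    have i1 : IntegrableOn (fun x => pderiv a f (realShift θ₀ x) * E (realShift θ₀ x))
        (Icc 0 1) := (c1.mul c3).continuousOn.integrableOn_compact isCompact_Icc
    have i2 : IntegrableOn (fun x => f (realShift θ₀ x) * E (realShift θ₀ x))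
        (Icc 0 1) := (c2.mul c3).continuousOn.integrableOn_compact isCompact_Icc
    have e1 : ∀ x, f (realShift θ₀ x) * (E (realShift θ₀ x) * (-(2 * Real.pi * I) * (γ a : ℂ))) +
        E (realShift θ₀ x) * fderiv ℂ f (realShift θ₀ x) (Pi.single a 1) =
        pderiv a f (realShift θ₀ x) * E (realShift θ₀ x) -
          2 * Real.pi * I * γ a * (f (realShift θ₀ x) * E (realShift θ₀ x)) := fun x => by
      rw [Joyce.pderiv]; ring
    simp only [e1] at hz
    rw [integral_sub i1 (i2.const_mul _), integral_const_mul, sub_eq_zero] at hz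
    exact hz
  · simp only [ContinuousLinearMap.comp_apply, hv, ContinuousLinearMap.coe_restrictScalars',
      add_apply, smul_apply, linL_apply, lin_single, smul_eq_mul]
    exact ((c2.mul (c3.mul continuous_const)).add (c3.mul c1)).continuousOn.integrableOn_compact
      isCompact_Icc

section Parseval

local instance : MeasureSpace UnitAddCircle := ⟨AddCircle.haarAddCircle⟩

local instance : Measure.IsAddHaarMeasure (volume : Measure UnitAddCircle) :=
  inferInstanceAs (Measure.IsAddHaarMeasure AddCircle.haarAddCircle)

local instance : IsProbabilityMeasure (volume : Measure UnitAddCircle) :=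
  inferInstanceAs (IsProbabilityMeasure AddCircle.haarAddCircle)

/-- The covering of the unit torus. -/
def torusMk (x : Fin m → ℝ) : UnitAddTorus (Fin m) := fun a => (x a : UnitAddCircle)

theorem isOpenQuotientMap_torusMk : IsOpenQuotientMap (torusMk (m := m)) :=
  IsOpenQuotientMap.piMap fun _ => QuotientAddGroup.isOpenQuotientMap_mk

/-- A continuous function on `ℝᵐ` that is periodic under `ℤᵐ` descends to the torus. -/
theorem exists_torus_lift {φ : (Fin m → ℝ) → ℂ} (hφ : Continuous φ)
    (hper : ∀ (x : Fin m → ℝ) (k : Fin m → ℤ), φ (fun a => x a + k a) = φ x) :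
    ∃ Φ : C(UnitAddTorus (Fin m), ℂ), ∀ x, Φ (torusMk x) = φ x := by
  have hlift : ∀ x y : Fin m → ℝ, torusMk x = torusMk y → φ x = φ y := by
    intro x y hxy
    have h : ∀ a, ∃ k : ℤ, x a = y a + k := fun a => by
      have h1 : ((x a - y a : ℝ) : UnitAddCircle) = 0 := by
        rw [AddCircle.coe_sub, sub_eq_zero]
        exact congrFun hxy a
      obtain ⟨k, hk⟩ := (AddCircle.coe_eq_zero_iff (1 : ℝ)).1 h1
      exact ⟨k, by rw [zsmul_eq_mul, mul_one] at hk; rw [hk]; ring⟩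
    choose k hk using h
    rw [← hper y k]
    congr 1
    exact funext hk
  set s : UnitAddTorus (Fin m) → (Fin m → ℝ) := Function.surjInv isOpenQuotientMap_torusMk.surjective
  have hs : ∀ x, φ (s (torusMk x)) = φ x := fun x =>
    hlift _ _ (Function.surjInv_eq isOpenQuotientMap_torusMk.surjective _)
  refine ⟨⟨fun y => φ (s y), ?_⟩, hs⟩
  rw [isOpenQuotientMap_torusMk.isQuotientMap.continuous_iff]
  exact hφ.congr fun x => (hs x).symm

theorem mFourier_torusMk (γ : Lat m) (x : Fin m → ℝ) :
    UnitAddTorus.mFourier γ (torusMk x) =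
      exp (2 * Real.pi * I * lin γ fun a => (x a : ℂ)) := by
  simp only [UnitAddTorus.mFourier, ContinuousMap.coe_mk, torusMk, fourier_coe_apply]
  rw [← exp_sum]
  congr 1
  rw [lin, Finset.mul_sum]
  refine Finset.sum_congr rfl fun a _ => ?_
  simp
  ring

theorem fourierMode_eq_mFourierCoeff {f : Cpx m → ℂ} {θ₀ : Cpx m} {Φ : C(UnitAddTorus (Fin m), ℂ)}
    (hΦ : ∀ x, Φ (torusMk x) = f (realShift θ₀ x)) (γ : Lat m) :
    fourierMode f θ₀ γ =
      exp (-(2 * Real.pi * I * lin γ θ₀)) * UnitAddTorus.mFourierCoeff Φ γ := by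
  rw [UnitAddTorus.mFourierCoeff_eq_integral Φ γ 0, ← integral_const_mul, fourierMode]
  have hset : {x : Fin m → ℝ | ∀ i, x i ∈ Ioc ((0 : Fin m → ℝ) i) ((0 : Fin m → ℝ) i + 1)} =
      pi univ fun i => Ioc ((0 : Fin m → ℝ) i) ((1 : Fin m → ℝ) i) := by
    ext x; simp
  have hae : (pi univ fun i => Ioc ((0 : Fin m → ℝ) i) ((1 : Fin m → ℝ) i)) =ᵐ[volume] Icc 0 1 :=
    Measure.univ_pi_Ioc_ae_eq_Icc
  rw [hset, setIntegral_congr_set hae]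
  refine setIntegral_congr_fun measurableSet_Icc fun x _ => ?_
  have h1 : lin γ (realShift θ₀ x) = lin γ θ₀ + lin γ fun a => (x a : ℂ) := lin_add γ θ₀ _
  have h2 : lin (-γ) (fun a => (x a : ℂ)) = -lin γ fun a => (x a : ℂ) := by
    simp [lin]
  have h3 : UnitAddTorus.mFourier (-γ) (fun a => (x a : UnitAddCircle)) = _ :=
    mFourier_torusMk (-γ) x
  have h4 : Φ (fun a => (x a : UnitAddCircle)) = _ := hΦ x
  simp only [h3, h4, h2, smul_eq_mul]
  change f (realShift θ₀ x) * exp (-(2 * Real.pi * I * lin γ (realShift θ₀ x))) = _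
  rw [h1, mul_left_comm, mul_comm (f _), ← mul_assoc, ← exp_add]
  congr 2
  ring

/-- The Fourier modes of a product: Parseval's identity. -/
theorem hasSum_fourierMode_mul {f g : Cpx m → ℂ} {θ₀ : Cpx m}
    (hf : Continuous fun x => f (realShift θ₀ x)) (hg : Continuous fun x => g (realShift θ₀ x))
    (hfp : ∀ (x : Fin m → ℝ) (k : Fin m → ℤ),
      f (realShift θ₀ fun a => x a + k a) = f (realShift θ₀ x))
    (hgp : ∀ (x : Fin m → ℝ) (k : Fin m → ℤ),
      g (realShift θ₀ fun a => x a + k a) = g (realShift θ₀ x)) (γ : Lat m) :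
    HasSum (fun δ => fourierMode f θ₀ (γ - δ) * fourierMode g θ₀ δ)
      (fourierMode (fun θ => f θ * g θ) θ₀ γ) := by
  obtain ⟨Φ, hΦ⟩ := exists_torus_lift hf hfp
  obtain ⟨Ψ, hΨ⟩ := exists_torus_lift hg hgp
  have hΦΨ : ∀ x, (Φ * Ψ) (torusMk x) = (fun θ => f θ * g θ) (realShift θ₀ x) := fun x => by
    rw [ContinuousMap.mul_apply, hΦ, hΨ]
  set Φ' : C(UnitAddTorus (Fin m), ℂ) := star Φ * UnitAddTorus.mFourier γ with hΦ'
  have h := UnitAddTorus.hasSum_prod_mFourierCoeff (Φ'.toLp 2 volume ℂ) (Ψ.toLp 2 volume ℂ)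
  simp only [UnitAddTorus.mFourierCoeff_toLp] at h
  have e1 : ∫ t, (starRingEnd ℂ) (Φ'.toLp 2 volume ℂ t) * Ψ.toLp 2 volume ℂ t =
      UnitAddTorus.mFourierCoeff (Φ * Ψ : C(UnitAddTorus (Fin m), ℂ)) γ := by
    refine integral_congr_ae ?_
    filter_upwards [ContinuousMap.coeFn_toLp (p := 2) (𝕜 := ℂ) volume Φ',
      ContinuousMap.coeFn_toLp (p := 2) (𝕜 := ℂ) volume Ψ] with t h1 h2
    rw [h1, h2, UnitAddTorus.mFourier_neg]
    simp only [hΦ', ContinuousMap.mul_apply, ContinuousMap.star_apply, map_mul, smul_eq_mul,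
      RCLike.star_def, Complex.conj_conj]
    ring
  have e2 : ∀ δ, (starRingEnd ℂ) (UnitAddTorus.mFourierCoeff Φ' δ) =
      UnitAddTorus.mFourierCoeff Φ (γ - δ) := fun δ => by
    rw [UnitAddTorus.mFourierCoeff, UnitAddTorus.mFourierCoeff, ← integral_conj]
    refine integral_congr_ae (Filter.Eventually.of_forall fun t => ?_)
    simp only [hΦ', ContinuousMap.mul_apply, ContinuousMap.star_apply, map_mul, smul_eq_mul,
      RCLike.star_def, Complex.conj_conj, sub_eq_add_neg, UnitAddTorus.mFourier_add,
      UnitAddTorus.mFourier_neg]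
    ring
  rw [e1] at h
  simp only [e2] at h
  rw [fourierMode_eq_mFourierCoeff hΦΨ]
  refine (h.mul_left (exp (-(2 * Real.pi * I * lin γ θ₀)))).congr_fun fun δ => ?_
  rw [fourierMode_eq_mFourierCoeff hΦ, fourierMode_eq_mFourierCoeff hΨ]
  have h1 : lin γ θ₀ = lin (γ - δ) θ₀ + lin δ θ₀ := by
    simp only [lin, ← Finset.sum_add_distrib, ← add_mul, Pi.sub_apply]
    push_cast
    simp
  rw [h1, mul_add, neg_add, exp_add]
  ring

end Parseval

theorem fourierMode_holomorphic {F : Cpx m → Cpx m → ℂ} {U V : Set (Cpx m)} (hU : IsOpen U)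
    (hV : IsOpen V) (hF : DifferentiableOn ℂ (fun p : Cpx m × Cpx m => F p.1 p.2) (U ×ˢ V))
    {θ₀ : Cpx m} (hVr : ∀ x, realShift θ₀ x ∈ V) {z : Cpx m} (hz : z ∈ U) (γ : Lat m) :
    DifferentiableAt ℂ (fun w => fourierMode (F w) θ₀ γ) z ∧ ∀ v,
      fderiv ℂ (fun w => fourierMode (F w) θ₀ γ) z v =
        fourierMode (fun θ => fderiv ℂ (fun w => F w θ) z v) θ₀ γ := by
  obtain ⟨r, hr, hrU⟩ := Metric.nhds_basis_closedBall.mem_iff.1 (hU.mem_nhds hz)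
  set e : (Fin m → ℝ) → ℂ := fun x => exp (-(2 * Real.pi * I * lin γ (realShift θ₀ x))) with he
  have hec : Continuous e := by
    have h1 : Continuous fun x => lin γ (realShift θ₀ x) :=
      (linL γ).continuous.comp (continuous_realShift θ₀)
    fun_prop
  have hFc : ContinuousOn (fun w : Cpx m × (Fin m → ℝ) => F w.1 (realShift θ₀ w.2) * e w.2)
      (Metric.closedBall z r ×ˢ Icc 0 1) := by
    have h1 : Continuous fun w : Cpx m × (Fin m → ℝ) => (w.1, realShift θ₀ w.2) :=
      continuous_fst.prodMk ((continuous_realShift θ₀).comp continuous_snd)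
    exact (hF.continuousOn.comp h1.continuousOn fun w hw => ⟨hrU hw.1, hVr w.2⟩).mul
      (hec.comp continuous_snd).continuousOn
  obtain ⟨C, hC⟩ := ((isCompact_closedBall z r).prod isCompact_Icc).exists_bound_of_continuousOn hFc
  have hd : ∀ x, ∀ w ∈ Metric.ball z r, DifferentiableAt ℂ (fun w => F w (realShift θ₀ x)) w := by
    intro x w hw
    have h1 := hF.differentiableAt ((hU.prod hV).mem_nhds
      (mk_mem_prod (hrU (Metric.ball_subset_closedBall hw)) (hVr x)))
    exact DifferentiableAt.comp (g := fun p : Cpx m × Cpx m => F p.1 p.2)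
      (f := fun w => (w, realShift θ₀ x)) w h1 (by fun_prop)
  have key := hasFDerivAt_integral_of_holomorphic (μ := volume.restrict (Icc (0 : Fin m → ℝ) 1))
    (Φ := fun w x => F w (realShift θ₀ x) * e x) (B := Metric.ball z r) (b := fun _ => C)
    Metric.isOpen_ball (fun w hw => ContinuousOn.aestronglyMeasurable
      (hFc.comp (f := fun x => (w, x)) (by fun_prop) fun x hx =>
        ⟨Metric.ball_subset_closedBall hw, hx⟩) measurableSet_Icc)
    (Filter.Eventually.of_forall fun x w hw =>
      ((hd x w hw).mul_const (e x)).differentiableWithinAt)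
    ((ae_restrict_mem measurableSet_Icc).mono fun x hx w hw =>
      hC (w, x) ⟨Metric.ball_subset_closedBall hw, hx⟩)
    (continuous_const.continuousOn.integrableOn_compact isCompact_Icc) (Metric.mem_ball_self hr)
  refine ⟨key.1, fun v => (key.2 v).2.trans ?_⟩
  refine integral_congr_ae (Filter.Eventually.of_forall fun x => ?_)
  simp only
  rw [fderiv_mul_const (hd x z (Metric.mem_ball_self hr)), smul_apply, smul_eq_mul, mul_comm]
  rfl

theorem fourierMode_const_mul (f : Cpx m → ℂ) (θ₀ : Cpx m) (γ : Lat m) (r : ℂ) :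
    fourierMode (fun θ => r * f θ) θ₀ γ = r * fourierMode f θ₀ γ := by
  rw [fourierMode, fourierMode, ← integral_const_mul]
  exact integral_congr_ae (Filter.Eventually.of_forall fun x => mul_assoc _ _ _)

theorem fourierMode_sum {α : Type*} (s : Finset α) {f : α → Cpx m → ℂ} {θ₀ : Cpx m}
    (hf : ∀ i ∈ s, Continuous fun x => f i (realShift θ₀ x)) (γ : Lat m) :
    fourierMode (fun θ => ∑ i ∈ s, f i θ) θ₀ γ = ∑ i ∈ s, fourierMode (f i) θ₀ γ := by
  simp only [fourierMode, Finset.sum_mul]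
  have he : Continuous fun x : Fin m → ℝ => exp (-(2 * Real.pi * I * lin γ (realShift θ₀ x))) := by
    have h1 : Continuous fun x => lin γ (realShift θ₀ x) :=
      (linL γ).continuous.comp (continuous_realShift θ₀)
    fun_prop
  exact integral_finsetSum _ fun i hi =>
    ((hf i hi).mul he).continuousOn.integrableOn_compact isCompact_Icc

theorem fderiv_apply_eq_sum {f : Cpx m → ℂ} {z : Cpx m} (v : Cpx m) :
    fderiv ℂ f z v = ∑ a, v a * pderiv a f z := by
  have h : v = ∑ a, v a • (Pi.single a 1 : Cpx m) := by
    ext b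
    simp [Pi.single_apply]
  conv_lhs => rw [h]
  simp [pderiv]

/-- The isomonodromy equation for the Fourier modes follows from the equation for the potentials:
a mode of an angular derivative of `W` is proportional to the mode of `F`. -/
theorem modeEq_of_potentialEq {ω : Matrix (Fin m) (Fin m) ℤ} {U V : Set (Cpx m)}
    (hD : IsOpen (U ×ˢ V)) {F W : Cpx m → Cpx m → ℂ} (P : PotentialEq ω (U ×ˢ V) F W)
    (hFW : ∀ p ∈ U ×ˢ V, F p.1 p.2 = ∑ a, p.1 a * dθ a W p.1 p.2)
    (hVr : ∀ θ ∈ V, ∀ x : Fin m → ℝ, realShift θ x ∈ V)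
    (hFp : ∀ z ∈ U, ∀ θ ∈ V, ∀ k : Fin m → ℤ, F z (fun a => θ a + (k a : ℂ)) = F z θ)
    (hWp : ∀ z ∈ U, ∀ θ ∈ V, ∀ k : Fin m → ℤ, W z (fun a => θ a + (k a : ℂ)) = W z θ)
    {θ₀ : Cpx m} (hθ₀ : θ₀ ∈ V) {z : Cpx m} (hz : z ∈ U) (hZ : ∀ γ : Lat m, γ ≠ 0 → lin γ z ≠ 0) :
    ModeEq ω (fun γ w => fourierMode (F w) θ₀ γ) z := by
  have hU : IsOpen U := by
    have h1 : U = (fun w => (w, θ₀)) ⁻¹' (U ×ˢ V) := by ext w; simp [hθ₀]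
    rw [h1]
    exact hD.preimage (by fun_prop)
  have hV : IsOpen V := by
    have h1 : V = (fun w => (z, w)) ⁻¹' (U ×ˢ V) := by ext w; simp [hz]
    rw [h1]
    exact hD.preimage (by fun_prop)
  have hVr₀ := hVr θ₀ hθ₀
  obtain ⟨dF, dW, dE, hPot⟩ := P
  have hslice : ∀ Φ : Cpx m → Cpx m → ℂ,
      DifferentiableOn ℂ (fun p : Cpx m × Cpx m => Φ p.1 p.2) (U ×ˢ V) →
      DifferentiableOn ℂ (Φ z) V := fun Φ hΦ =>
    hΦ.comp (f := fun θ => (z, θ)) (by fun_prop) fun θ hθ => ⟨hz, hθ⟩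
  have pF : PeriodicOn V (F z) := ⟨hslice F dF, hFp z hz⟩
  have pW : PeriodicOn V (W z) := ⟨hslice W dW, hWp z hz⟩
  have pE : ∀ e, PeriodicOn V (pderiv e (W z)) := fun e => pW.pderiv hV e
  have hcong : ∀ {f f' : Cpx m → ℂ}, (∀ θ ∈ V, f θ = f' θ) → ∀ γ,
      fourierMode f θ₀ γ = fourierMode f' θ₀ γ := fun {f f'} hff γ => by
    refine integral_congr_ae (Filter.Eventually.of_forall fun x => ?_)
    have : f (fun a => θ₀ a + (x a : ℂ)) = f' fun a => θ₀ a + (x a : ℂ) := hff _ (hVr₀ x)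
    simp only [this]
  -- modes of `F` and of the angular derivatives of `W`, in terms of those of `W`
  have hE : ∀ e γ, fourierMode (pderiv e (W z)) θ₀ γ =
      2 * Real.pi * I * γ e * fourierMode (W z) θ₀ γ := fun e γ =>
    fourierMode_pderiv hV hVr₀ pW e γ
  have hF : ∀ γ, fourierMode (F z) θ₀ γ = 2 * Real.pi * I * lin γ z * fourierMode (W z) θ₀ γ := by
    intro γ
    rw [hcong (fun θ hθ => hFW (z, θ) ⟨hz, hθ⟩) γ]
    have h1 := fourierMode_sum Finset.univ (f := fun a θ => z a * dθ a W z θ) (θ₀ := θ₀)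
      (fun a _ => continuous_const.mul ((pE a).continuous hVr₀)) γ
    rw [h1]
    simp only [fourierMode_const_mul]
    rw [lin, Finset.mul_sum, Finset.sum_mul]
    refine Finset.sum_congr rfl fun a _ => ?_
    have := hE a γ
    rw [show dθ a W z = pderiv a (W z) from rfl, this]
    ring
  intro γ
  obtain ⟨hdiff, hfd⟩ := fourierMode_holomorphic hU hV dF hVr₀ hz γ
  refine ⟨hdiff, fun v => ?_⟩
  rw [hfd]
  have hper : ∀ {f : Cpx m → ℂ}, PeriodicOn V f → ∀ (x : Fin m → ℝ) (k : Fin m → ℤ),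
      f (realShift θ₀ fun a => x a + k a) = f (realShift θ₀ x) := fun hf x k => by
    rw [← hf.2 _ (hVr₀ x) k]
    congr 1
    funext a
    simp [realShift, add_assoc]
  -- the product of the two angular derivatives, integrated mode by mode
  have hprod : ∀ e a b, HasSum (fun δ => (2 * Real.pi * I * ((γ - δ) a : ℂ) *
      fourierMode (F z) θ₀ (γ - δ)) * (2 * Real.pi * I * (δ b : ℂ) *
        (2 * Real.pi * I * δ e * fourierMode (W z) θ₀ δ)))
      (fourierMode (fun θ => dθ a F z θ * dθ b (dθ e W) z θ) θ₀ γ) := fun e a b => by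
    have h1 := hasSum_fourierMode_mul ((pF.pderiv hV a).continuous hVr₀)
      (((pE e).pderiv hV b).continuous hVr₀) (hper (pF.pderiv hV a))
      (hper ((pE e).pderiv hV b)) γ
    refine h1.congr_fun fun δ => ?_
    rw [fourierMode_pderiv hV hVr₀ pF, fourierMode_pderiv hV hVr₀ (pE e), hE]
  have hcont : ∀ e a b, Continuous fun x : Fin m → ℝ =>
      dθ a F z (realShift θ₀ x) * dθ b (dθ e W) z (realShift θ₀ x) := fun e a b =>
    ((pF.pderiv hV a).continuous hVr₀).mul (((pE e).pderiv hV b).continuous hVr₀)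
  have e1 : fourierMode (fun θ => fderiv ℂ (fun w => F w θ) z v) θ₀ γ =
      ∑ e, v e * (1 / (2 * Real.pi * I) ^ 2 * ∑ a, ∑ b, (ω a b : ℂ) *
        fourierMode (fun θ => dθ a F z θ * dθ b (dθ e W) z θ) θ₀ γ) := by
    rw [hcong (f' := fun θ => ∑ e, v e * (1 / (2 * Real.pi * I) ^ 2 * ∑ a, ∑ b, (ω a b : ℂ) *
      (dθ a F z θ * dθ b (dθ e W) z θ)))]
    · have c1 := fun e a b => continuous_const (y := (ω a b : ℂ)).mul (hcont e a b)
      have c2 := fun e a => continuous_finsetSum Finset.univ fun b _ => c1 e a b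
      have c3 := fun e => continuous_finsetSum Finset.univ fun a _ => c2 e a
      rw [fourierMode_sum Finset.univ fun e _ => continuous_const.mul (continuous_const.mul (c3 e))]
      refine Finset.sum_congr rfl fun e _ => ?_
      rw [fourierMode_const_mul, fourierMode_const_mul,
        fourierMode_sum Finset.univ fun a _ => c2 e a]
      congr 2
      refine Finset.sum_congr rfl fun a _ => ?_
      rw [fourierMode_sum Finset.univ fun b _ => c1 e a b]
      exact Finset.sum_congr rfl fun b _ => fourierMode_const_mul _ _ _ _
    · intro θ hθ
      rw [fderiv_apply_eq_sum]
      refine Finset.sum_congr rfl fun e _ => ?_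
      have := hPot (z, θ) ⟨hz, hθ⟩ e
      simp only [mul_assoc (ω _ _ : ℂ)] at this
      exact congrArg (v e * ·) this
  rw [e1]
  have hsum := hasSum_sum (s := Finset.univ) fun e _ => ((hasSum_sum (s := Finset.univ) fun a _ =>
    hasSum_sum (s := Finset.univ) fun b _ => (hprod e a b).mul_left (ω a b : ℂ)).mul_left
      (1 / (2 * Real.pi * I) ^ 2 : ℂ)).mul_left (v e)
  have hpi : (2 * Real.pi * I : ℂ) ≠ 0 := by simp [Real.pi_ne_zero]
  have hterm : ∀ δ : Lat m, ∑ e, v e * (1 / (2 * Real.pi * I) ^ 2 * ∑ a, ∑ b, (ω a b : ℂ) *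
      ((2 * Real.pi * I * ((γ - δ) a : ℂ) * fourierMode (F z) θ₀ (γ - δ)) *
        (2 * Real.pi * I * (δ b : ℂ) * (2 * Real.pi * I * δ e * fourierMode (W z) θ₀ δ)))) =
      (pairing ω (γ - δ) δ : ℂ) * fourierMode (F z) θ₀ (γ - δ) *
        (2 * Real.pi * I * lin δ v * fourierMode (W z) θ₀ δ) := fun δ => by
    have h1 : ∀ e, v e * (1 / (2 * Real.pi * I) ^ 2 * ∑ a, ∑ b, (ω a b : ℂ) *
      ((2 * Real.pi * I * ((γ - δ) a : ℂ) * fourierMode (F z) θ₀ (γ - δ)) *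
        (2 * Real.pi * I * (δ b : ℂ) * (2 * Real.pi * I * δ e * fourierMode (W z) θ₀ δ)))) =
        (δ e * v e) * ((pairing ω (γ - δ) δ : ℂ) * fourierMode (F z) θ₀ (γ - δ) *
          (2 * Real.pi * I * fourierMode (W z) θ₀ δ)) := fun e => by
      simp only [pairing, Int.cast_sum, Int.cast_mul, Finset.mul_sum, Finset.sum_mul]
      refine Finset.sum_congr rfl fun a _ => Finset.sum_congr rfl fun b _ => ?_
      field_simp
    simp only [h1, ← Finset.sum_mul]
    rw [lin]
    ring
  simp only [hterm] at hsum
  -- only decompositions into two nonzero charges contribute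
  set T : Lat m → ℂ := fun δ => (pairing ω (γ - δ) δ : ℂ) * fourierMode (F z) θ₀ (γ - δ) *
        (2 * Real.pi * I * lin δ v * fourierMode (W z) θ₀ δ) with hT
  set ψ : Decomp γ → Lat m := fun p => p.1.2 with hψ
  have hψi : Function.Injective ψ := by
    rintro ⟨⟨a, b⟩, h1, h2, h3⟩ ⟨⟨a', b'⟩, h1', h2', h3'⟩ h
    simp only [hψ] at h h3 h3'
    subst h
    have : a = a' := by rw [← h3'] at h3; exact add_right_cancel h3
    subst this
    rfl
  have hsupp : ∀ δ ∉ range ψ, T δ = 0 := fun δ hδ => by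
    by_cases h1 : δ = 0
    · simp [hT, h1, pairing]
    · by_cases h2 : γ - δ = 0
      · simp only [hT, h2]
        simp [pairing]
      · exact absurd ⟨⟨(γ - δ, δ), h2, h1, by simp⟩, rfl⟩ hδ
  refine ((hψi.hasSum_iff hsupp).2 hsum).congr_fun fun p => ?_
  obtain ⟨⟨a, b⟩, h1, h2, h3⟩ := p
  simp only at h1 h2 h3
  have hab : γ - b = a := by rw [← h3]; simp
  have hb := hZ b h2
  simp only [Function.comp, hψ, hT, hab, hF]
  field_simp

section Convergent

variable {ω : Matrix (Fin m) (Fin m) ℤ} {σ c : Lat m → ℂ} {g h : ℂ → ℂ}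
  {D : Set (Cpx m × Cpx m)} {X : Lat m → Cpx m → Cpx m → ℂ → ℂ}

theorem IsConvergentSolution.isomonodromy (H : IsConvergentSolution ω σ c g h D X) (hD : IsOpen D)
    (P : PotentialEq ω D (potF c g X) (potW ω c g h X))
    (hFW : ∀ p ∈ D, potF c g X p.1 p.2 = ∑ a, p.1 a * dθ a (potW ω c g h X) p.1 p.2) :
    Isomonodromy ω c D X (potF c g X) (potW ω c g h X) := by
  refine ⟨P, fun U V hUV hV hX θ₀ hθ₀ z hz hZ => ?_⟩
  subst hUV
  have hcong := fun z (hz : z ∈ U) θ (hθ : θ ∈ V) (k : Fin m → ℤ) =>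
    pot_congr ω c g h X (z := z) (θ := fun a => θ a + (k a : ℂ)) (θ' := θ)
      (fun γ hγ => H.lin_ne_zero (p := (z, θ)) ⟨hz, hθ⟩ hγ) fun γ hγ t ht => hX z hz θ hθ k γ hγ t ht
  exact modeEq_of_potentialEq hD P hFW hV (fun z hz θ hθ k => (hcong z hz θ hθ k).1)
    (fun z hz θ hθ k => (hcong z hz θ hθ k).2) hθ₀ hz hZ

theorem IsConvergentSolution.isomonodromy_id (H : IsConvergentSolution ω σ c id id D X)
    (hω : ω.transpose = -ω) (hσ : ∀ γ, σ γ ≠ 0) (hD : IsOpen D) :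
    Isomonodromy ω c D X (potF c id X) (potW ω c id id X) :=
  H.isomonodromy hD (H.potentialEq_id hω hσ hD).1 (H.potentialEq_id hω hσ hD).2

theorem IsConvergentSolution.isomonodromy_negLog
    (H : IsConvergentSolution ω σ c negLog dilog D X) (hω : ω.transpose = -ω)
    (hσ : ∀ γ, σ γ ≠ 0) (hD : IsOpen D)
    (hX : ∀ p ∈ D, ∀ γ, c γ ≠ 0 → ∀ t ∈ bpsRay (lin γ p.1), 1 - X γ p.1 p.2 t ∈ slitPlane) :
    Isomonodromy ω c D X (potF c negLog X) (potW ω c negLog dilog X) :=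
  H.isomonodromy hD (H.potentialEq_negLog hω hσ hD hX).1 (H.potentialEq_negLog hω hσ hD hX).2

end Convergent

/-! ### Truncated power series as a Banach algebra -/

section Trunc

variable {τ : Type*} (n : τ →₀ ℕ)

/-- The ideal of power series whose coefficients of exponent at most `n` vanish. -/
def truncIdeal : Ideal (MvPowerSeries τ ℂ) where
  carrier := {f | ∀ k ≤ n, MvPowerSeries.coeff k f = 0}
  add_mem' hf hg k hk := by rw [map_add, hf k hk, hg k hk, add_zero]
  zero_mem' _ _ := map_zero _
  smul_mem' r f hf k hk := by
    classical
    rw [smul_eq_mul, MvPowerSeries.coeff_mul]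
    refine Finset.sum_eq_zero fun p hp => ?_
    rw [hf p.2 ((le_add_self.trans_eq (Finset.HasAntidiagonal.mem_antidiagonal.1 hp)).trans hk), mul_zero]

/-- Power series truncated at the exponent `n`. -/
def Trunc : Type _ := MvPowerSeries τ ℂ ⧸ truncIdeal n

instance : CommRing (Trunc n) := inferInstanceAs (CommRing (MvPowerSeries τ ℂ ⧸ truncIdeal n))

instance : Algebra ℂ (Trunc n) := inferInstanceAs (Algebra ℂ (MvPowerSeries τ ℂ ⧸ truncIdeal n))

/-- The truncation of a power series. -/
def toTrunc : MvPowerSeries τ ℂ →ₐ[ℂ] Trunc n := Ideal.Quotient.mkₐ ℂ (truncIdeal n)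

variable {n}

theorem toTrunc_surjective : Function.Surjective (toTrunc n) := Ideal.Quotient.mk_surjective

theorem toTrunc_eq_iff {f f' : MvPowerSeries τ ℂ} : toTrunc n f = toTrunc n f' ↔
    ∀ k ≤ n, MvPowerSeries.coeff k f = MvPowerSeries.coeff k f' := by
  refine Ideal.Quotient.eq.trans (forall₂_congr fun k hk => ?_)
  rw [map_sub, sub_eq_zero]

variable (n) in
open Classical in
/-- The coefficients of a truncated power series; zero beyond `n`. -/
def coeffT (k : τ →₀ ℕ) : Trunc n →ₗ[ℂ] ℂ where
  toFun x := if k ≤ n then MvPowerSeries.coeff k (Function.surjInv toTrunc_surjective x) else 0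
  map_add' x y := by
    split_ifs with hk
    · rw [← map_add]
      refine toTrunc_eq_iff.1 ?_ k hk
      rw [map_add, Function.surjInv_eq toTrunc_surjective (x + y),
        Function.surjInv_eq toTrunc_surjective x, Function.surjInv_eq toTrunc_surjective y]
    · simp
  map_smul' r x := by
    split_ifs with hk
    · rw [RingHom.id_apply, ← map_smul]
      refine toTrunc_eq_iff.1 ?_ k hk
      rw [map_smul, Function.surjInv_eq toTrunc_surjective (r • x),
        Function.surjInv_eq toTrunc_surjective x]
    · simp

theorem coeffT_toTrunc {k : τ →₀ ℕ} (hk : k ≤ n) (f : MvPowerSeries τ ℂ) :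
    coeffT n k (toTrunc n f) = MvPowerSeries.coeff k f := by
  rw [coeffT, LinearMap.coe_mk, AddHom.coe_mk, if_pos hk]
  exact toTrunc_eq_iff.1 (Function.surjInv_eq toTrunc_surjective _) k hk

theorem trunc_ext {x y : Trunc n} (h : ∀ k ≤ n, coeffT n k x = coeffT n k y) : x = y := by
  obtain ⟨f, rfl⟩ := toTrunc_surjective x
  obtain ⟨f', rfl⟩ := toTrunc_surjective y
  refine toTrunc_eq_iff.2 fun k hk => ?_
  rw [← coeffT_toTrunc hk, h k hk, coeffT_toTrunc hk]

theorem coeffT_mul [DecidableEq τ] {k : τ →₀ ℕ} (hk : k ≤ n) (x y : Trunc n) :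
    coeffT n k (x * y) = ∑ p ∈ Finset.HasAntidiagonal.antidiagonal k, coeffT n p.1 x * coeffT n p.2 y := by
  obtain ⟨f, rfl⟩ := toTrunc_surjective x
  obtain ⟨f', rfl⟩ := toTrunc_surjective y
  rw [← map_mul, coeffT_toTrunc hk, MvPowerSeries.coeff_mul]
  refine Finset.sum_congr rfl fun p hp => ?_
  rw [coeffT_toTrunc ((le_self_add.trans_eq (Finset.HasAntidiagonal.mem_antidiagonal.1 hp)).trans hk),
    coeffT_toTrunc ((le_add_self.trans_eq (Finset.HasAntidiagonal.mem_antidiagonal.1 hp)).trans hk)]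

open Classical in
/-- The exponents at most `n`. -/
def exponents (n : τ →₀ ℕ) : Finset (τ →₀ ℕ) := Finset.Icc 0 n

theorem mem_exponents {k : τ →₀ ℕ} : k ∈ exponents n ↔ k ≤ n := by
  simp [exponents]

variable (n) in
/-- The sum of the absolute values of the coefficients. -/
def truncNorm : RingNorm (Trunc n) where
  toFun x := ∑ k ∈ exponents n, ‖coeffT n k x‖
  map_zero' := by simp
  add_le' x y := by
    rw [← Finset.sum_add_distrib]
    exact Finset.sum_le_sum fun k _ => by rw [map_add]; exact norm_add_le _ _
  neg' x := by simp
  mul_le' x y := by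
    classical
    have h1 : ∀ k ∈ exponents n, ‖coeffT n k (x * y)‖ ≤
        ∑ p ∈ ((exponents n ×ˢ exponents n).filter fun p => p.1 + p.2 ≤ n) with p.1 + p.2 = k,
          ‖coeffT n p.1 x‖ * ‖coeffT n p.2 y‖ := by
      intro k hk
      rw [mem_exponents] at hk
      rw [coeffT_mul hk]
      refine (norm_sum_le _ _).trans (le_of_eq ?_)
      refine Finset.sum_congr ?_ fun p _ => norm_mul _ _
      ext p
      simp only [Finset.HasAntidiagonal.mem_antidiagonal, Finset.mem_filter, Finset.mem_product, mem_exponents]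
      constructor
      · rintro rfl
        exact ⟨⟨⟨le_self_add.trans hk, le_add_self.trans hk⟩, hk⟩, rfl⟩
      · exact fun h => h.2
    refine (Finset.sum_le_sum h1).trans ?_
    rw [Finset.sum_fiberwise_of_maps_to fun p hp => by
      rw [mem_exponents]; exact (Finset.mem_filter.1 hp).2, Finset.sum_mul_sum,
      ← Finset.sum_product']
    exact Finset.sum_le_sum_of_subset_of_nonneg (Finset.filter_subset _ _) fun _ _ _ => by
      positivity
  eq_zero_of_map_eq_zero' x hx := by
    refine trunc_ext fun k hk => ?_
    have := (Finset.sum_eq_zero_iff_of_nonneg fun _ _ => norm_nonneg _).1 hx k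
      (mem_exponents.2 hk)
    rw [norm_eq_zero.1 this, map_zero]

instance : NormedCommRing (Trunc n) :=
  { RingNorm.toNormedRing (truncNorm n) with mul_comm := mul_comm }

theorem trunc_norm_def (x : Trunc n) : ‖x‖ = ∑ k ∈ exponents n, ‖coeffT n k x‖ := rfl

instance : NormedAlgebra ℂ (Trunc n) where
  norm_smul_le r x := by
    simp only [trunc_norm_def, map_smul, norm_smul, Finset.mul_sum]
    exact le_rfl

/-- The truncated monomials. -/
def truncMonomial (k : τ →₀ ℕ) : Trunc n := toTrunc n (MvPowerSeries.monomial k 1)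

theorem toTrunc_eq_sum (f : MvPowerSeries τ ℂ) :
    toTrunc n f = ∑ k ∈ exponents n, MvPowerSeries.coeff k f • (truncMonomial k : Trunc n) := by
  classical
  refine trunc_ext fun j hj => ?_
  rw [map_sum, Finset.sum_eq_single j]
  · rw [map_smul, truncMonomial, coeffT_toTrunc hj, coeffT_toTrunc hj,
      MvPowerSeries.coeff_monomial_same, smul_eq_mul, mul_one]
  · intro k _ hkj
    rw [map_smul, truncMonomial, coeffT_toTrunc hj, MvPowerSeries.coeff_monomial_ne hkj.symm,
      smul_zero]
  · exact fun h => absurd (mem_exponents.2 hj) h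

instance : FiniteDimensional ℂ (Trunc n) := by
  refine Module.Finite.of_surjective (Fintype.linearCombination ℂ
    fun k : exponents n => (truncMonomial k.1 : Trunc n)) fun x => ?_
  obtain ⟨f, rfl⟩ := toTrunc_surjective x
  refine ⟨fun k => MvPowerSeries.coeff k.1 f, ?_⟩
  rw [Fintype.linearCombination_apply, toTrunc_eq_sum]
  exact Finset.sum_coe_sort (exponents n) fun k => MvPowerSeries.coeff k f • (truncMonomial k : Trunc n)

instance : CompleteSpace (Trunc n) := FiniteDimensional.complete ℂ _

variable (n) in
/-- The coefficients of a truncated power series are continuous functionals. -/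
def coeffTL (k : τ →₀ ℕ) : Trunc n →L[ℂ] ℂ := LinearMap.toContinuousLinearMap (coeffT n k)

theorem coeffTL_toTrunc {k : τ →₀ ℕ} (hk : k ≤ n) (f : MvPowerSeries τ ℂ) :
    coeffTL n k (toTrunc n f) = MvPowerSeries.coeff k f := coeffT_toTrunc hk f

/-- The coefficients of the exponential of a power series without constant term. -/
theorem coeff_exp_subst {f : MvPowerSeries τ ℂ} (hf : MvPowerSeries.constantCoeff f = 0)
    (k : τ →₀ ℕ) {M : ℕ} (hM : k.degree < M) : MvPowerSeries.coeff k ((PowerSeries.exp ℂ).subst f) =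
      ∑ d ∈ Finset.range M, ((d.factorial : ℂ)⁻¹) * MvPowerSeries.coeff k (f ^ d) := by
  rw [PowerSeries.coeff_subst (PowerSeries.HasSubst.of_constantCoeff_zero hf),
    finsum_eq_sum_of_support_subset (s := Finset.range M)]
  · refine Finset.sum_congr rfl fun d _ => ?_
    rw [PowerSeries.coeff_exp]
    simp
  · intro d hd
    by_contra hd'
    rw [Finset.coe_range, mem_Iio, not_lt] at hd'
    apply hd
    simp only
    rw [MvPowerSeries.coeff_eq_zero_of_constantCoeff_nilpotent (m := 1) (by rw [hf, pow_one])
      (by omega), smul_zero]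

/-- Truncation takes the exponential of a power series without constant term to the exponential of
the Banach algebra, because such a series becomes nilpotent. -/
theorem toTrunc_exp_subst {f : MvPowerSeries τ ℂ} (hf : MvPowerSeries.constantCoeff f = 0) :
    toTrunc n ((PowerSeries.exp ℂ).subst f) = NormedSpace.exp (toTrunc n f) := by
  have hnil : ∀ d, n.degree + 1 ≤ d → toTrunc n f ^ d = 0 := fun d hd => by
    rw [← map_pow, ← map_zero (toTrunc n)]
    refine toTrunc_eq_iff.2 fun k hk => ?_
    have h1 : k.degree ≤ n.degree := Finsupp.degree_mono hk
    rw [map_zero, MvPowerSeries.coeff_eq_zero_of_constantCoeff_nilpotent (m := 1)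
      (by rw [hf, pow_one]) (by omega)]
  rw [NormedSpace.exp_eq_tsum ℂ]
  beta_reduce
  rw [tsum_eq_sum (s := Finset.range (n.degree + 1)) fun d hd => by
    rw [hnil d (by simpa using hd), smul_zero]]
  simp only [← map_pow, ← map_smul, ← map_sum]
  refine toTrunc_eq_iff.2 fun k hk => ?_
  have h1 : k.degree ≤ n.degree := Finsupp.degree_mono hk
  rw [coeff_exp_subst hf k (M := n.degree + 1) (by omega), map_sum]
  exact Finset.sum_congr rfl fun d _ => by rw [map_smul, smul_eq_mul]

end Trunc

/-! ### Functions of slow growth at the end point of a ray -/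

section Tame

/-- The weight `1 + 1 / s`, which measures growth at the end point `t = ∞` of a ray. -/
def growth (s : ℝ) : ℝ := 1 + 1 / s

theorem one_le_growth {s : ℝ} (hs : 0 < s) : 1 ≤ growth s := by
  rw [growth, le_add_iff_nonneg_right]
  positivity

theorem growth_pos {s : ℝ} (hs : 0 < s) : 0 < growth s := one_pos.trans_le (one_le_growth hs)

theorem inv_le_growth (s : ℝ) : s⁻¹ ≤ growth s := by
  rw [growth, one_div, le_add_iff_nonneg_left]
  exact zero_le_one

theorem growth_rpow_eq {s : ℝ} (hs : 0 < s) (b : ℝ) : growth s ^ b = (1 + s) ^ b * s ^ (-b) := by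
  have : growth s = (1 + s) * s⁻¹ := by
    rw [growth]
    field_simp
    ring
  rw [this, Real.mul_rpow (by positivity) (by positivity), Real.inv_rpow hs.le, Real.rpow_neg hs.le]

theorem continuousOn_growth_rpow (b : ℝ) : ContinuousOn (fun s => growth s ^ b) (Ioi 0) := by
  refine ContinuousOn.rpow_const ?_ fun s hs => Or.inl (growth_pos hs).ne'
  unfold growth
  exact continuousOn_const.add (continuousOn_const.div continuousOn_id fun s hs => (ne_of_gt hs))

/-- `1 / (s + s')` is bounded by a product of powers of the weights with total exponent one. -/
theorem inv_add_le_growth {s s' a : ℝ} (hs : 0 < s) (hs' : 0 < s') (ha : 0 ≤ a) (ha1 : a ≤ 1) :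
    (s + s')⁻¹ ≤ growth s ^ a * growth s' ^ (1 - a) := by
  have h : 0 < (s + s')⁻¹ := by positivity
  have h1 : (s + s')⁻¹ ≤ growth s :=
    (inv_anti₀ hs (by linarith)).trans (inv_le_growth s)
  have h2 : (s + s')⁻¹ ≤ growth s' :=
    (inv_anti₀ hs' (by linarith)).trans (inv_le_growth s')
  calc (s + s')⁻¹ = (s + s')⁻¹ ^ a * (s + s')⁻¹ ^ (1 - a) := by
        rw [← Real.rpow_add h, add_sub_cancel, Real.rpow_one]
    _ ≤ _ := mul_le_mul (Real.rpow_le_rpow h.le h1 ha) (Real.rpow_le_rpow h.le h2 (by linarith))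
        (by positivity) (Real.rpow_nonneg (growth_pos hs).le _)

theorem integrableOn_pow_mul_rpow_mul_exp (j : ℕ) {b : ℝ} (hb : -1 < b) :
    IntegrableOn (fun s : ℝ => (1 + s) ^ j * (s ^ b * Real.exp (-(2 * Real.pi) * s))) (Ioi 0) := by
  induction j generalizing b with
  | zero =>
    have := integrableOn_rpow_mul_exp_neg_mul_rpow (p := 1) (s := b) hb one_pos (b := 2 * Real.pi)
      (by positivity)
    simpa using this
  | succ j ih =>
    refine ((ih hb).add (ih (b := b + 1) (by linarith))).congr_fun (fun s hs => ?_) measurableSet_Ioi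
    simp only [Pi.add_apply]
    rw [Real.rpow_add_one (ne_of_gt hs)]
    ring

theorem integrableOn_growth (j : ℕ) {b : ℝ} (hb1 : b < 1) :
    IntegrableOn (fun s : ℝ => (1 + s) ^ j * (growth s ^ b * Real.exp (-(2 * Real.pi) * s)))
      (Ioi 0) := by
  refine (integrableOn_pow_mul_rpow_mul_exp (j + 1) (b := -b) (by linarith)).mono' ?_ ?_
  · refine ContinuousOn.aestronglyMeasurable ?_ measurableSet_Ioi
    exact ContinuousOn.mul (by fun_prop)
      (ContinuousOn.mul (continuousOn_growth_rpow b) (by fun_prop))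
  · filter_upwards [ae_restrict_mem measurableSet_Ioi] with s hs
    have h0 : (0 : ℝ) < s := hs
    have h1 : (1 + s) ^ b ≤ 1 + s := by
      have := Real.rpow_le_rpow_of_exponent_le (x := 1 + s) (by linarith) hb1.le
      rwa [Real.rpow_one] at this
    have h2 := growth_pos h0
    rw [Real.norm_of_nonneg (by positivity), growth_rpow_eq h0]
    calc (1 + s) ^ j * ((1 + s) ^ b * s ^ (-b) * Real.exp (-(2 * Real.pi) * s))
        ≤ (1 + s) ^ j * ((1 + s) * s ^ (-b) * Real.exp (-(2 * Real.pi) * s)) := by gcongr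
      _ = _ := by ring

/-- Functions `φ(s, p)` that are holomorphic in `p ∈ B` and differentiable in `s > 0` and that,
together with `s ∂_s φ`, grow more slowly than every power of `1 + 1 / s`, uniformly on `B`. -/
structure Tame (B : Set (Cpx m × Cpx m)) (φ : ℝ → Cpx m × Cpx m → ℂ) : Prop where
  holomorphic : ∀ s, 0 < s → DifferentiableOn ℂ (φ s) B
  differentiable : ∀ p ∈ B, ∀ s, 0 < s → DifferentiableAt ℝ (fun r => φ r p) s
  bound : ∀ a : ℝ, 0 < a → a < 1 → ∃ C, 0 ≤ C ∧ ∀ p ∈ B, ∀ s, 0 < s →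
    ‖φ s p‖ ≤ C * growth s ^ a ∧ ‖(s : ℂ) * deriv (fun r => φ r p) s‖ ≤ C * growth s ^ a

variable {B : Set (Cpx m × Cpx m)} {φ ψ : ℝ → Cpx m × Cpx m → ℂ}

namespace Tame

theorem congr (h : Tame B φ) (e : ∀ p ∈ B, ∀ s, 0 < s → ψ s p = φ s p) : Tame B ψ where
  holomorphic s hs := (h.holomorphic s hs).congr fun p hp => e p hp s hs
  differentiable p hp s hs := (h.differentiable p hp s hs).congr_of_eventuallyEq
    (Filter.mem_of_superset (Ioi_mem_nhds hs) fun r hr => e p hp r hr)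
  bound a ha ha1 := by
    obtain ⟨C, hC, hb⟩ := h.bound a ha ha1
    refine ⟨C, hC, fun p hp s hs => ?_⟩
    rw [e p hp s hs, Filter.EventuallyEq.deriv_eq (f := fun r => φ r p)
      (Filter.mem_of_superset (Ioi_mem_nhds hs) fun r hr => e p hp r hr)]
    exact hb p hp s hs

/-- Bounded holomorphic functions of the parameters are tame. -/
theorem of_bounded {f : Cpx m × Cpx m → ℂ} (hf : DifferentiableOn ℂ f B) {C : ℝ}
    (hC : ∀ p ∈ B, ‖f p‖ ≤ C) : Tame B fun _ => f where
  holomorphic _ _ := hf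
  differentiable _ _ _ _ := differentiableAt_const _
  bound a ha _ := by
    refine ⟨max C 0, le_max_right _ _, fun p hp s hs => ?_⟩
    have h := Real.one_le_rpow (one_le_growth hs) ha.le
    have h1 : max C 0 ≤ max C 0 * growth s ^ a := le_mul_of_one_le_right (le_max_right _ _) h
    refine ⟨((hC p hp).trans (le_max_left _ _)).trans h1, ?_⟩
    rw [deriv_const, mul_zero, norm_zero]
    exact (le_max_right C 0).trans h1

theorem const (r : ℂ) : Tame B fun _ _ => r :=
  of_bounded (differentiableOn_const _) fun _ _ => le_rfl

theorem add (hφ : Tame B φ) (hψ : Tame B ψ) : Tame B fun s p => φ s p + ψ s p where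
  holomorphic s hs := (hφ.holomorphic s hs).add (hψ.holomorphic s hs)
  differentiable p hp s hs := (hφ.differentiable p hp s hs).add (hψ.differentiable p hp s hs)
  bound a ha ha1 := by
    obtain ⟨C, hC, hb⟩ := hφ.bound a ha ha1
    obtain ⟨C', hC', hb'⟩ := hψ.bound a ha ha1
    refine ⟨C + C', add_nonneg hC hC', fun p hp s hs => ⟨?_, ?_⟩⟩
    · rw [add_mul]
      exact norm_add_le_of_le (hb p hp s hs).1 (hb' p hp s hs).1
    · rw [deriv_fun_add (hφ.differentiable p hp s hs) (hψ.differentiable p hp s hs), mul_add, add_mul]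
      exact norm_add_le_of_le (hb p hp s hs).2 (hb' p hp s hs).2

theorem mul (hφ : Tame B φ) (hψ : Tame B ψ) : Tame B fun s p => φ s p * ψ s p where
  holomorphic s hs := (hφ.holomorphic s hs).mul (hψ.holomorphic s hs)
  differentiable p hp s hs := (hφ.differentiable p hp s hs).mul (hψ.differentiable p hp s hs)
  bound a ha ha1 := by
    obtain ⟨C, hC, hb⟩ := hφ.bound (a / 2) (by linarith) (by linarith)
    obtain ⟨C', hC', hb'⟩ := hψ.bound (a / 2) (by linarith) (by linarith)
    refine ⟨2 * (C * C'), by positivity, fun p hp s hs => ?_⟩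
    have hg := growth_pos hs
    have e : growth s ^ a = growth s ^ (a / 2) * growth s ^ (a / 2) := by
      rw [← Real.rpow_add hg, add_halves]
    obtain ⟨h1, h2⟩ := hb p hp s hs
    obtain ⟨h1', h2'⟩ := hb' p hp s hs
    have key : ∀ {x y : ℂ}, ‖x‖ ≤ C * growth s ^ (a / 2) → ‖y‖ ≤ C' * growth s ^ (a / 2) →
        ‖x * y‖ ≤ C * C' * growth s ^ a := fun hx hy => by
      rw [norm_mul, e]
      refine (mul_le_mul hx hy (norm_nonneg _) (by positivity)).trans (le_of_eq (by ring))
    have h0 : 0 ≤ C * C' * growth s ^ a := by positivity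
    refine ⟨(key h1 h1').trans (by linarith), ?_⟩
    rw [deriv_fun_mul (hφ.differentiable p hp s hs) (hψ.differentiable p hp s hs), mul_add,
      ← mul_assoc, mul_left_comm]
    exact (norm_add_le_of_le (key h2 h1') (key h1 h2')).trans (by linarith)

theorem sum {α : Type*} (t : Finset α) {φ : α → ℝ → Cpx m × Cpx m → ℂ}
    (h : ∀ i ∈ t, Tame B (φ i)) : Tame B fun s p => ∑ i ∈ t, φ i s p := by
  classical
  induction t using Finset.induction_on with
  | empty => simpa using const 0
  | insert i t hi ih =>
    simp only [Finset.sum_insert hi]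
    exact (h i (Finset.mem_insert_self i t)).add
      (ih fun j hj => h j (Finset.mem_insert_of_mem hj))

theorem continuousOn (h : Tame B φ) {p : Cpx m × Cpx m} (hp : p ∈ B) :
    ContinuousOn (fun s => φ s p) (Ioi 0) := fun s hs =>
  (h.differentiable p hp s hs).continuousAt.continuousWithinAt

/-- Tameness is preserved by the integral operators of the integral equations, when the quotient of
the central charges `L` and `L'` stays away from the positive reals. -/
theorem integral (hB : IsOpen B) (h : Tame B φ) {L L' : Cpx m × Cpx m → ℂ}
    (hL : DifferentiableOn ℂ L B) (hL' : DifferentiableOn ℂ L' B) {M δ : ℝ} (hδ : 0 < δ)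
    (hM : ∀ p ∈ B, ‖L p‖ ≤ M) (hM' : ∀ p ∈ B, ‖L' p‖ ≤ M)
    (hoff : ∀ p ∈ B, ∀ s s' : ℝ, 0 < s → 0 < s' → δ * (s + s') ≤ ‖s * L' p - s' * L p‖) :
    Tame B fun s p => ∫ s' in Ioi (0 : ℝ),
      L p / (s * L' p - s' * L p) * (Real.exp (-(2 * Real.pi) * s') * φ s' p) := by
  have hne : ∀ p ∈ B, ∀ s s' : ℝ, 0 < s → 0 < s' → (s : ℂ) * L' p - s' * L p ≠ 0 :=
    fun p hp s s' hs hs' => norm_pos_iff.1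
      (lt_of_lt_of_le (by positivity) (hoff p hp s s' hs hs'))
  have hker : ∀ p ∈ B, ∀ s s' : ℝ, 0 < s → 0 < s' →
      ‖L p / (s * L' p - s' * L p)‖ ≤ M / δ * (s + s')⁻¹ := by
    intro p hp s s' hs hs'
    have hM0 : 0 ≤ M := (norm_nonneg _).trans (hM p hp)
    rw [norm_div]
    refine (div_le_div₀ hM0 (hM p hp) (by positivity) (hoff p hp s s' hs hs')).trans (le_of_eq ?_)
    field_simp
  have hker' : ∀ p ∈ B, ∀ s s' : ℝ, 0 < s → 0 < s' →
      ‖-(L p * L' p) / (s * L' p - s' * L p) ^ 2‖ ≤ (M / δ) ^ 2 * (s + s')⁻¹ * s⁻¹ := by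
    intro p hp s s' hs hs'
    have hM0 : 0 ≤ M := (norm_nonneg _).trans (hM p hp)
    rw [norm_div, norm_neg, norm_mul, norm_pow]
    refine (div_le_div₀ (by positivity) (mul_le_mul (hM p hp) (hM' p hp) (norm_nonneg _) hM0)
      (by positivity) (pow_le_pow_left₀ (by positivity) (hoff p hp s s' hs hs') 2)).trans ?_
    have : (s + s')⁻¹ ≤ s⁻¹ := inv_anti₀ hs (by linarith)
    calc M * M / (δ * (s + s')) ^ 2 = (M / δ) ^ 2 * (s + s')⁻¹ * (s + s')⁻¹ := by
          field_simp
      _ ≤ _ := by gcongr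
  have hcont : ∀ p ∈ B, ∀ s : ℝ, 0 < s → ContinuousOn (fun s' : ℝ =>
      L p / (s * L' p - s' * L p) * (Real.exp (-(2 * Real.pi) * s') * φ s' p)) (Ioi 0) := by
    intro p hp s hs
    refine (continuousOn_const.div (by fun_prop) fun s' hs' => hne p hp s s' hs hs').mul ?_
    exact ContinuousOn.mul (by fun_prop) (h.continuousOn hp)
  have hmain : ∀ a : ℝ, 0 < a → a < 1 → ∃ C, 0 ≤ C ∧ ∀ p ∈ B, ∀ s s' : ℝ, 0 < s → 0 < s' →
      ∀ k : ℂ, ∀ R : ℝ, 0 ≤ R → ‖k‖ ≤ R * (s + s')⁻¹ →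
      ‖k * (Real.exp (-(2 * Real.pi) * s') * φ s' p)‖ ≤ R * C * growth s ^ a *
        (growth s' ^ (1 - a / 2) * Real.exp (-(2 * Real.pi) * s')) := by
    intro a ha ha1
    obtain ⟨C, hC, hb⟩ := h.bound (a / 2) (by linarith) (by linarith)
    refine ⟨C, hC, fun p hp s s' hs hs' k R hR hk => ?_⟩
    have hg := growth_pos hs
    have hg' := growth_pos hs'
    have e : growth s' ^ (1 - a / 2) = growth s' ^ (1 - a) * growth s' ^ (a / 2) := by
      rw [← Real.rpow_add hg']
      congr 1
      ring
    rw [norm_mul, norm_mul, Complex.norm_of_nonneg (Real.exp_pos _).le]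
    calc ‖k‖ * (Real.exp (-(2 * Real.pi) * s') * ‖φ s' p‖)
        ≤ (R * (growth s ^ a * growth s' ^ (1 - a))) *
          (Real.exp (-(2 * Real.pi) * s') * (C * growth s' ^ (a / 2))) := by
          refine mul_le_mul (hk.trans ?_) ?_ (by positivity) (by positivity)
          · exact mul_le_mul_of_nonneg_left (inv_add_le_growth hs hs' ha.le ha1.le) hR
          · exact mul_le_mul_of_nonneg_left (hb p hp s' hs').1 (Real.exp_pos _).le
      _ = _ := by rw [e]; ring
  have hint : ∀ a : ℝ, 0 < a → a < 1 → IntegrableOn (fun s' : ℝ =>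
      growth s' ^ (1 - a / 2) * Real.exp (-(2 * Real.pi) * s')) (Ioi 0) := fun a ha ha1 => by
    simpa using integrableOn_growth 0 (b := 1 - a / 2) (by linarith)
  have hderiv : ∀ p ∈ B, ∀ s : ℝ, 0 < s → HasDerivAt (fun s : ℝ => ∫ s' in Ioi (0 : ℝ),
      L p / (s * L' p - s' * L p) * (Real.exp (-(2 * Real.pi) * s') * φ s' p))
      (∫ s' in Ioi (0 : ℝ), -(L p * L' p) / (s * L' p - s' * L p) ^ 2 *
        (Real.exp (-(2 * Real.pi) * s') * φ s' p)) s := by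
    intro p hp s hs
    have hM0 : 0 ≤ M := (norm_nonneg _).trans (hM p hp)
    obtain ⟨C, hC, hb⟩ := hmain (1 / 2) (by norm_num) (by norm_num)
    have hball : ∀ r ∈ Metric.ball s (s / 2), s / 2 < r := fun r hr => by
      rw [Metric.mem_ball, Real.dist_eq, abs_lt] at hr
      linarith [hr.1]
    refine (hasDerivAt_integral_of_dominated_loc_of_deriv_le (s := Metric.ball s (s / 2))
      (bound := fun s' => (M / δ) ^ 2 * (s / 2)⁻¹ * C * growth (s / 2) ^ ((1 : ℝ) / 2) *
        (growth s' ^ (1 - (1 : ℝ) / 2 / 2) * Real.exp (-(2 * Real.pi) * s')))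
      (F' := fun (r : ℝ) (s' : ℝ) => -(L p * L' p) / (r * L' p - s' * L p) ^ 2 *
        (Real.exp (-(2 * Real.pi) * s') * φ s' p))
      (Metric.ball_mem_nhds s (by positivity)) ?_ ?_ ?_ ?_ ?_ ?_).2
    · filter_upwards [Ioi_mem_nhds hs] with r hr
      exact (hcont p hp r hr).aestronglyMeasurable measurableSet_Ioi
    · refine ((hint (1 / 2) (by norm_num) (by norm_num)).const_mul
        (M / δ * C * growth s ^ ((1 : ℝ) / 2))).mono'
        ((hcont p hp s hs).aestronglyMeasurable measurableSet_Ioi) ?_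
      filter_upwards [ae_restrict_mem measurableSet_Ioi] with s' hs'
      have hM0 : 0 ≤ M := (norm_nonneg _).trans (hM p hp)
      exact hb p hp s s' hs hs' _ _ (by positivity) (hker p hp s s' hs hs')
    · refine ContinuousOn.aestronglyMeasurable ?_ measurableSet_Ioi
      refine (continuousOn_const.div (by fun_prop) fun s' hs' =>
        pow_ne_zero 2 (hne p hp s s' hs hs')).mul ?_
      exact ContinuousOn.mul (by fun_prop) (h.continuousOn hp)
    · filter_upwards [ae_restrict_mem measurableSet_Ioi] with s' hs' r hr
      have hr' := hball r hr
      have hs2 : 0 < s / 2 := by positivity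
      have hr0 : 0 < r := hs2.trans hr'
      refine hb p hp (s / 2) s' hs2 hs' _ ((M / δ) ^ 2 * (s / 2)⁻¹) (by positivity) ?_
      refine (hker' p hp r s' hr0 hs').trans ?_
      have h0 : (0 : ℝ) < s' := hs'
      have h1 : (r + s')⁻¹ ≤ (s / 2 + s')⁻¹ := inv_anti₀ (by positivity) (by linarith)
      have h2 : r⁻¹ ≤ (s / 2)⁻¹ := inv_anti₀ (by positivity) hr'.le
      calc (M / δ) ^ 2 * (r + s')⁻¹ * r⁻¹ ≤ (M / δ) ^ 2 * (s / 2 + s')⁻¹ * (s / 2)⁻¹ := by gcongr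
        _ = _ := by ring
    · exact (hint (1 / 2) (by norm_num) (by norm_num)).const_mul _
    · filter_upwards [ae_restrict_mem measurableSet_Ioi] with s' hs' r hr
      have hr0 : 0 < r := (by positivity : 0 < s / 2).trans (hball r hr)
      refine HasDerivAt.mul_const ?_ _
      have h1 : HasDerivAt (fun r : ℝ => (r : ℂ) * L' p - s' * L p) (L' p) r := by
        simpa using ((hasDerivAt_id r).ofReal_comp.mul_const (L' p)).sub_const (s' * L p)
      have h2 := (hasDerivAt_const r (L p)).fun_div h1 (hne p hp r s' hr0 hs')
      simpa using h2
  refine ⟨fun s hs => ?_, fun p hp s hs => (hderiv p hp s hs).differentiableAt, fun a ha ha1 => ?_⟩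
  · obtain ⟨C, hC, hb⟩ := hmain (1 / 2) (by norm_num) (by norm_num)
    intro p hp
    have hM0 : 0 ≤ M := (norm_nonneg _).trans (hM p hp)
    refine (hasFDerivAt_integral_of_holomorphic (B := B) hB
      (Φ := fun p (s' : ℝ) => L p / (s * L' p - s' * L p) *
        (Real.exp (-(2 * Real.pi) * s') * φ s' p))
      (b := fun s' => M / δ * C * growth s ^ ((1 : ℝ) / 2) *
        (growth s' ^ (1 - (1 : ℝ) / 2 / 2) * Real.exp (-(2 * Real.pi) * s')))
      (μ := volume.restrict (Ioi (0 : ℝ))) ?_ ?_ ?_ ?_ hp).1.differentiableWithinAt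
    · exact fun p hp => (hcont p hp s hs).aestronglyMeasurable measurableSet_Ioi
    · filter_upwards [ae_restrict_mem measurableSet_Ioi] with s' hs'
      simp only [div_eq_mul_inv]
      exact (hL.mul (((hL'.const_mul _).sub (hL.const_mul _)).inv fun p hp =>
        hne p hp s s' hs hs')).mul ((h.holomorphic s' hs').const_mul _)
    · filter_upwards [ae_restrict_mem measurableSet_Ioi] with s' hs' p hp
      exact hb p hp s s' hs hs' _ _ (by positivity) (hker p hp s s' hs hs')
    · exact (hint (1 / 2) (by norm_num) (by norm_num)).const_mul _
  · obtain ⟨C, hC, hb⟩ := hmain a ha ha1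
    set J := ∫ s' in Ioi (0 : ℝ), growth s' ^ (1 - a / 2) * Real.exp (-(2 * Real.pi) * s') with hJ
    have hJ0 : 0 ≤ J := setIntegral_nonneg measurableSet_Ioi fun s' hs' =>
      mul_nonneg (Real.rpow_nonneg (growth_pos hs').le _) (Real.exp_pos _).le
    have hgen : ∀ p ∈ B, ∀ s : ℝ, 0 < s → ∀ k : ℝ → ℂ, ∀ R : ℝ, 0 ≤ R →
        (∀ s' : ℝ, 0 < s' → ‖k s'‖ ≤ R * (s + s')⁻¹) →
        ‖∫ s' in Ioi (0 : ℝ), k s' * (Real.exp (-(2 * Real.pi) * s') * φ s' p)‖ ≤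
          R * C * J * growth s ^ a := by
      intro p hp s hs k R hR hk
      refine (norm_integral_le_of_norm_le ((hint a ha ha1).const_mul (R * C * growth s ^ a))
        ?_).trans (le_of_eq ?_)
      · filter_upwards [ae_restrict_mem measurableSet_Ioi] with s' hs'
        exact hb p hp s s' hs hs' _ _ hR (hk s' hs')
      · rw [integral_const_mul, ← hJ]
        ring
    rcases B.eq_empty_or_nonempty with rfl | ⟨p₀, hp₀⟩
    · exact ⟨0, le_rfl, fun p hp => absurd hp (notMem_empty p)⟩
    have hM0 : 0 ≤ M := (norm_nonneg _).trans (hM p₀ hp₀)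
    refine ⟨(M / δ + (M / δ) ^ 2) * C * J, by positivity, fun p hp s hs => ⟨?_, ?_⟩⟩
    · refine (hgen p hp s hs _ (M / δ) (by positivity) fun s' hs' => hker p hp s s' hs hs').trans ?_
      have := growth_pos hs
      gcongr
      exact le_add_of_nonneg_right (by positivity)
    · rw [(hderiv p hp s hs).deriv, ← integral_const_mul]
      simp only [← mul_assoc (s : ℂ)]
      refine (hgen p hp s hs _ ((M / δ) ^ 2) (by positivity) fun s' hs' => ?_).trans ?_
      · rw [norm_mul, Complex.norm_of_nonneg hs.le]
        refine (mul_le_mul_of_nonneg_left (hker' p hp s s' hs hs') hs.le).trans (le_of_eq ?_)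
        field_simp
      · have := growth_pos hs
        gcongr
        exact le_add_of_nonneg_left (by positivity)

end Tame

end Tame

/-! ### Uniform control of finitely many central charges -/

/-- Uniform bounds over the open set `B`, with one constant `δ`, for the central charges and the
angular exponentials of the finitely many charges `q i`, `i ∈ T`: the central charges and the
exponentials are bounded, and so are, from below, the central charges and the denominators of the
kernels. -/
structure IsControlled {ι : Type*} (ω : Matrix (Fin m) (Fin m) ℤ) (q : ι → Lat m) (T : Finset ι)
    (B : Set (Cpx m × Cpx m)) (δ : ℝ) : Prop where
  isOpen : IsOpen B
  pos : 0 < δ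
  lower : ∀ p ∈ B, ∀ i ∈ T, δ ≤ ‖lin (q i) p.1‖
  upper : ∀ p ∈ B, ∀ i ∈ T, ‖lin (q i) p.1‖ ≤ δ⁻¹
  angle : ∀ p ∈ B, ∀ i ∈ T, ‖exp (2 * Real.pi * I * lin (q i) p.2)‖ ≤ δ⁻¹
  cone : ∀ p ∈ B, ∀ i ∈ T, ∀ j ∈ T, pairing ω (q i) (q j) ≠ 0 → ∀ s s' : ℝ, 0 < s → 0 < s' →
    δ * (s + s') ≤ ‖(s : ℂ) * lin (q j) p.1 - s' * lin (q i) p.1‖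

/-- Two complex numbers off a common ray span a cone that stays away from zero. -/
theorem exists_cone_bound {Z Z' : ℂ} (hZ : Z ≠ 0) (hZ' : Z' ≠ 0) (h : ¬ Aligned Z Z') :
    ∃ μ : ℝ, 0 < μ ∧ ∀ s s' : ℝ, 0 < s → 0 < s' → μ * (s + s') ≤ ‖(s : ℂ) * Z' - s' * Z‖ := by
  obtain ⟨u₀, hu₀, hmin⟩ := isCompact_Icc.exists_isMinOn (nonempty_Icc.2 zero_le_one)
    (f := fun u : ℝ => ‖((1 - u : ℝ) : ℂ) * Z' - u * Z‖) (s := Icc (0 : ℝ) 1) (by fun_prop)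
  refine ⟨‖((1 - u₀ : ℝ) : ℂ) * Z' - u₀ * Z‖, norm_pos_iff.2 ?_, fun s s' hs hs' => ?_⟩
  · rcases hu₀.1.eq_or_lt with h0 | h0
    · simpa [← h0] using hZ'
    rcases hu₀.2.eq_or_lt with h1 | h1
    · simpa [h1] using hZ
    exact not_aligned_sub_ne_zero hZ h (sub_pos.2 h1) h0
  · have hr : 0 < s + s' := by positivity
    have hr' : ((s + s' : ℝ) : ℂ) ≠ 0 := by exact_mod_cast hr.ne'
    have hu : s' / (s + s') ∈ Icc (0 : ℝ) 1 := ⟨by positivity, by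
      rw [div_le_one hr]; linarith⟩
    have e : (s : ℂ) * Z' - s' * Z = ((s + s' : ℝ) : ℂ) *
        (((1 - s' / (s + s') : ℝ) : ℂ) * Z' - (s' / (s + s') : ℝ) * Z) := by
      push_cast at hr' ⊢
      field_simp
      ring
    rw [e, norm_mul, Complex.norm_of_nonneg hr.le, mul_comm]
    exact mul_le_mul_of_nonneg_left (hmin hu) hr.le

/-- The charges off the walls are controlled near each point. -/
theorem exists_isControlled {ι : Type*} (ω : Matrix (Fin m) (Fin m) ℤ) (q : ι → Lat m)
    (T : Finset ι) {U : Set (Cpx m)} (hU : IsOpen U) {p₀ : Cpx m × Cpx m} (hp₀ : p₀.1 ∈ U)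
    (hZ : ∀ i, lin (q i) p₀.1 ≠ 0)
    (hoff : ∀ i j, pairing ω (q i) (q j) ≠ 0 → ¬ Aligned (lin (q i) p₀.1) (lin (q j) p₀.1)) :
    ∃ B δ, p₀ ∈ B ∧ (∀ p ∈ B, p.1 ∈ U) ∧ IsControlled ω q T B δ := by
  have hcl : ∀ γ : Lat m, Continuous (lin γ) := fun γ => (linL γ).continuous
  have hδ : Filter.Tendsto (fun x : ℝ × (Cpx m × Cpx m) => x.1) (𝓝[>] 0 ×ˢ 𝓝 p₀) (𝓝 0) :=
    (tendsto_nhdsWithin_of_tendsto_nhds Filter.tendsto_id).comp Filter.tendsto_fst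
  have hδ0 : ∀ᶠ x : ℝ × (Cpx m × Cpx m) in 𝓝[>] 0 ×ˢ 𝓝 p₀, 0 < x.1 :=
    Filter.tendsto_fst.eventually self_mem_nhdsWithin
  have hlim : ∀ {f : Cpx m × Cpx m → ℂ}, Continuous f → Filter.Tendsto
      (fun x : ℝ × (Cpx m × Cpx m) => ‖f x.2‖) (𝓝[>] 0 ×ˢ 𝓝 p₀) (𝓝 ‖f p₀‖) := fun hf =>
    (hf.norm.tendsto p₀).comp Filter.tendsto_snd
  have hup : ∀ {f : Cpx m × Cpx m → ℂ}, Continuous f →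
      ∀ᶠ x : ℝ × (Cpx m × Cpx m) in 𝓝[>] 0 ×ˢ 𝓝 p₀, ‖f x.2‖ ≤ x.1⁻¹ := fun hf => by
    have h := (hδ.mul (hlim hf)).eventually (eventually_lt_nhds (b := 1) (by simp))
    filter_upwards [h, hδ0] with x hx hx0
    rw [inv_eq_one_div, le_div_iff₀ hx0, mul_comm]
    exact hx.le
  have h : ∀ᶠ x : ℝ × (Cpx m × Cpx m) in 𝓝[>] 0 ×ˢ 𝓝 p₀, x.2.1 ∈ U ∧ 0 < x.1 ∧ ∀ i ∈ T,
      x.1 ≤ ‖lin (q i) x.2.1‖ ∧ ‖lin (q i) x.2.1‖ ≤ x.1⁻¹ ∧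
      ‖exp (2 * Real.pi * I * lin (q i) x.2.2)‖ ≤ x.1⁻¹ ∧
      ∀ j ∈ T, pairing ω (q i) (q j) ≠ 0 → ∀ s s' : ℝ, 0 < s → 0 < s' →
        x.1 * (s + s') ≤ ‖(s : ℂ) * lin (q j) x.2.1 - s' * lin (q i) x.2.1‖ := by
    refine (Filter.tendsto_snd.eventually
      (continuous_fst.continuousAt.eventually (hU.mem_nhds hp₀))).and (hδ0.and
        ((Filter.eventually_all_finset T).2 fun i _ => ?_))
    have hli : Continuous fun p : Cpx m × Cpx m => lin (q i) p.1 := (hcl _).comp continuous_fst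
    refine (((hδ.eventually_lt (hlim hli) (norm_pos_iff.2 (hZ i))).mono fun _ hx => hx.le).and
      ((hup hli).and ((hup (f := fun p => exp (2 * Real.pi * I * lin (q i) p.2))
        (Complex.continuous_exp.comp (continuous_const.mul ((hcl _).comp continuous_snd)))).and
      ((Filter.eventually_all_finset T).2 fun j _ => ?_))))
    by_cases hij : pairing ω (q i) (q j) = 0
    · exact Filter.Eventually.of_forall fun _ h0 => absurd hij h0
    obtain ⟨μ, hμ, hcone⟩ := exists_cone_bound (hZ i) (hZ j) (hoff i j hij)
    have hnear : ∀ k, ∀ᶠ x : ℝ × (Cpx m × Cpx m) in 𝓝[>] 0 ×ˢ 𝓝 p₀,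
        ‖lin (q k) x.2.1 - lin (q k) p₀.1‖ < μ / 2 := fun k => by
      have hk : Continuous fun p : Cpx m × Cpx m => lin (q k) p.1 - lin (q k) p₀.1 :=
        ((hcl _).comp continuous_fst).sub continuous_const
      exact (hlim hk).eventually (eventually_lt_nhds (by simpa using hμ))
    filter_upwards [hnear i, hnear j, hδ.eventually (eventually_lt_nhds (half_pos hμ))] with
      x h1 h2 h3 _ s s' hs hs'
    have h4 := hcone s s' hs hs'
    have e : (s : ℂ) * lin (q j) p₀.1 - s' * lin (q i) p₀.1 =
        (s * lin (q j) x.2.1 - s' * lin (q i) x.2.1) -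
          (s * (lin (q j) x.2.1 - lin (q j) p₀.1) - s' * (lin (q i) x.2.1 - lin (q i) p₀.1)) := by
      ring
    have h5 : ‖(s : ℂ) * (lin (q j) x.2.1 - lin (q j) p₀.1) -
        s' * (lin (q i) x.2.1 - lin (q i) p₀.1)‖ ≤ s * (μ / 2) + s' * (μ / 2) := by
      refine norm_sub_le_of_le ?_ ?_
      · rw [norm_mul, Complex.norm_of_nonneg hs.le]
        exact mul_le_mul_of_nonneg_left h2.le hs.le
      · rw [norm_mul, Complex.norm_of_nonneg hs'.le]
        exact mul_le_mul_of_nonneg_left h1.le hs'.le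
    have h6 := norm_sub_le ((s : ℂ) * lin (q j) x.2.1 - s' * lin (q i) x.2.1)
      (s * (lin (q j) x.2.1 - lin (q j) p₀.1) - s' * (lin (q i) x.2.1 - lin (q i) p₀.1))
    rw [← e] at h6
    nlinarith
  obtain ⟨δ, hδ'⟩ := h.curry.exists
  obtain ⟨B, hB, hBo, hpB⟩ := eventually_nhds_iff.1 hδ'
  exact ⟨B, δ, hpB, fun p hp => (hB p hp).1, hBo, (hB p₀ hpB).2.1,
    fun p hp i hi => ((hB p hp).2.2 i hi).1, fun p hp i hi => ((hB p hp).2.2 i hi).2.1,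
    fun p hp i hi => ((hB p hp).2.2 i hi).2.2.1, fun p hp i hi => ((hB p hp).2.2 i hi).2.2.2⟩

/-! ### Coefficients of formal solutions -/

section Formal

variable {ω : Matrix (Fin m) (Fin m) ℤ} {σ : Lat m → ℂ} {S : Set (Lat m)} {U : Set (Cpx m)}
  {X : S → Cpx m → Cpx m → ℂ → MvPowerSeries S ℂ}

/-- The unknowns of the formal system as functions of the ray parameter. -/
def fRay (X : S → Cpx m → Cpx m → ℂ → MvPowerSeries S ℂ) (i : S) (s : ℝ) (p : Cpx m × Cpx m) :
    MvPowerSeries S ℂ :=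
  X i p.1 p.2 (rayPoint (lin i.1 p.1) s)

/-- The exponent in the formal integral equations, as a function of the ray parameter. -/
def fExpo (ω : Matrix (Fin m) (Fin m) ℤ) (X : S → Cpx m → Cpx m → ℂ → MvPowerSeries S ℂ) (i : S)
    (s : ℝ) (p : Cpx m × Cpx m) : MvPowerSeries S ℂ :=
  fSumInt S p.1 fun j t => MvPowerSeries.C (kern ω i.1 j.1 (rayPoint (lin i.1 p.1) s) t) *
    X j p.1 p.2 t

theorem coeff_fSumInt (k : S →₀ ℕ) (z : Cpx m) (f : S → ℂ → MvPowerSeries S ℂ) :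
    MvPowerSeries.coeff k (fSumInt S z f) = ∑ i ∈ k.support, rayInt (lin i.1 z) fun t =>
      MvPowerSeries.coeff (k - Finsupp.single i 1) (f i t) := rfl

theorem constantCoeff_fSumInt (z : Cpx m) (f : S → ℂ → MvPowerSeries S ℂ) :
    MvPowerSeries.constantCoeff (fSumInt S z f) = 0 := by
  rw [← MvPowerSeries.coeff_zero_eq_constantCoeff_apply, coeff_fSumInt, Finsupp.support_zero,
    Finset.sum_empty]

theorem IsFormalSolution.fRay_eq (H : IsFormalSolution ω σ S U X) {p : Cpx m × Cpx m}
    (hp : p.1 ∈ U) (i : S) (hZ : lin i.1 p.1 ≠ 0) {s : ℝ} (hs : 0 < s) :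
    fRay X i s p = MvPowerSeries.C (σ i.1 * exp (2 * Real.pi * I * lin i.1 p.2 - 2 * Real.pi * s)) *
      (PowerSeries.exp ℂ).subst (fExpo ω X i s p) := by
  rw [fRay, H p.1 hp p.2 i _ (rayPoint_mem_bpsRay hZ hs), semiflat_rayPoint σ i.1 p.1 p.2 hZ hs,
    fExpo]

theorem coeff_fExpo (p : Cpx m × Cpx m) (hZ : ∀ i : S, lin i.1 p.1 ≠ 0) (i : S) {s : ℝ}
    (hs : 0 < s) (k : S →₀ ℕ) : MvPowerSeries.coeff k (fExpo ω X i s p) =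
      ∑ j ∈ k.support, ∫ s' in Ioi (0 : ℝ), (lin i.1 p.1 * rayKern ω Subtype.val (i, s) (j, s') p.1) *
        MvPowerSeries.coeff (k - Finsupp.single j 1) (fRay X j s' p) := by
  rw [fExpo, coeff_fSumInt]
  refine Finset.sum_congr rfl fun j _ => setIntegral_congr_fun measurableSet_Ioi fun s' hs' => ?_
  have hi := hZ i
  have hj := hZ j
  simp only [MvPowerSeries.coeff_C_mul, fRay]
  rw [kern_rayPoint ω Subtype.val i j p.1 hi hj hs hs']
  field_simp

theorem constantCoeff_fExpo (i : S) (s : ℝ) (p : Cpx m × Cpx m) :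
    MvPowerSeries.constantCoeff (fExpo ω X i s p) = 0 := constantCoeff_fSumInt _ _

theorem tame_coeff_pow {B : Set (Cpx m × Cpx m)} {G : ℝ → Cpx m × Cpx m → MvPowerSeries S ℂ}
    {k : S →₀ ℕ} (hG : ∀ j ≤ k, Tame B fun s p => MvPowerSeries.coeff j (G s p)) (d : ℕ) :
    ∀ j ≤ k, Tame B fun s p => MvPowerSeries.coeff j (G s p ^ d) := by
  classical
  induction d with
  | zero =>
    intro j _
    simp only [pow_zero]
    exact Tame.const _
  | succ d ih =>
    intro j hj
    simp only [pow_succ, MvPowerSeries.coeff_mul]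
    refine Tame.sum _ fun a ha => ?_
    have h := Finset.HasAntidiagonal.mem_antidiagonal.1 ha
    exact (ih a.1 ((le_self_add.trans_eq h).trans hj)).mul
      (hG a.2 ((le_add_self.trans_eq h).trans hj))

/-- The coefficients of a formal solution are tame, apart from their exponential decay. -/
theorem IsFormalSolution.tame (H : IsFormalSolution ω σ S U X) (hZ : ∀ z ∈ U, ∀ γ ∈ S, lin γ z ≠ 0)
    {n : S →₀ ℕ} {B : Set (Cpx m × Cpx m)} {δ : ℝ} (hB : IsControlled ω Subtype.val n.support B δ)
    (hBU : ∀ p ∈ B, p.1 ∈ U) {k : S →₀ ℕ} (hk : k ≤ n) {i : S} (hi : i ∈ n.support) :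
    Tame B fun s p => (Real.exp (2 * Real.pi * s) : ℂ) * MvPowerSeries.coeff k (fRay X i s p) := by
  induction hN : k.degree using Nat.strong_induction_on generalizing k i with
  | _ N ih =>
  have hlin : ∀ γ : Lat m, DifferentiableOn ℂ (fun p : Cpx m × Cpx m => lin γ p.1) B := fun γ =>
    ((linL γ).differentiable.comp differentiable_fst).differentiableOn
  have hG : ∀ j ≤ k, Tame B fun s p => MvPowerSeries.coeff j (fExpo ω X i s p) := by
    intro j hj
    have hj' : ∀ i' ∈ j.support, i' ∈ n.support := Finsupp.support_mono (hj.trans hk)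
    refine Tame.congr (φ := fun s p => ∑ i' ∈ j.support, ∫ s' in Ioi (0 : ℝ),
      (lin i.1 p.1 * rayKern ω Subtype.val (i, s) (i', s') p.1) *
        MvPowerSeries.coeff (j - Finsupp.single i' 1) (fRay X i' s' p)) ?_
      fun p hp s hs => coeff_fExpo p (fun i' => hZ _ (hBU p hp) i'.1 i'.2) i hs j
    refine Tame.sum _ fun i' hi' => ?_
    by_cases hpair : pairing ω i.1 i'.1 = 0
    · refine (Tame.const 0).congr fun p hp s hs => ?_
      simp [rayKern, hpair]
    have hle : Finsupp.single i' 1 ≤ j := by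
      rw [Finsupp.single_le_iff]
      exact Nat.one_le_iff_ne_zero.2 (Finsupp.mem_support_iff.1 hi')
    have hdeg : (j - Finsupp.single i' 1).degree < N := by
      have h1 := congrArg Finsupp.degree (tsub_add_cancel_of_le hle)
      rw [map_add, Finsupp.degree_single] at h1
      have h2 : j.degree ≤ k.degree := Finsupp.degree_mono hj
      omega
    have h1 := ih _ hdeg (k := j - Finsupp.single i' 1) (tsub_le_self.trans (hj.trans hk))
      (hj' i' hi') rfl
    refine ((Tame.const ((pairing ω i.1 i'.1 : ℂ) / (2 * Real.pi * I))).mul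
      (h1.integral hB.isOpen (hlin i.1) (hlin i'.1) hB.pos (fun p hp => hB.upper p hp i hi)
        (fun p hp => hB.upper p hp i' (hj' i' hi'))
        fun p hp => hB.cone p hp i hi i' (hj' i' hi') hpair)).congr fun p hp s hs => ?_
    rw [← integral_const_mul]
    refine setIntegral_congr_fun measurableSet_Ioi fun s' _ => ?_
    have he : (Real.exp (-(2 * Real.pi) * s') : ℂ) * Real.exp (2 * Real.pi * s') = 1 := by
      rw [← ofReal_mul, ← Real.exp_add]
      simp
    simp only [rayKern]
    rw [← mul_assoc (Real.exp (-(2 * Real.pi) * s') : ℂ), he]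
    ring
  have hexp : DifferentiableOn ℂ (fun p : Cpx m × Cpx m => exp (2 * Real.pi * I * lin i.1 p.2)) B :=
    (((linL i.1).differentiable.comp differentiable_snd).const_mul
      (2 * Real.pi * I : ℂ)).cexp.differentiableOn
  refine (((Tame.const (σ i.1)).mul (Tame.of_bounded hexp fun p hp => hB.angle p hp i hi)).mul
    (Tame.sum (Finset.range (k.degree + 1)) fun d _ =>
      (Tame.const ((d.factorial : ℂ)⁻¹)).mul (tame_coeff_pow hG d k le_rfl))).congr
      fun p hp s hs => ?_
  rw [H.fRay_eq (hBU p hp) i (hZ _ (hBU p hp) i.1 i.2) hs, MvPowerSeries.coeff_C_mul,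
    coeff_exp_subst (constantCoeff_fExpo i s p) k (Nat.lt_succ_self _), ← mul_assoc]
  congr 1
  rw [ofReal_exp, mul_left_comm, ← Complex.exp_add]
  congr 2
  push_cast
  ring

end Formal

/-! ### Truncations of formal solutions -/

/-- The common decay rate of the coefficients of a formal solution along the rays. -/
def decay (s : ℝ) : ℝ := (1 + s) * (growth s ^ (1 / 4 : ℝ) * Real.exp (-(2 * Real.pi) * s))

theorem decay_nonneg {s : ℝ} (hs : 0 < s) : 0 ≤ decay s := by
  have := growth_pos hs
  rw [decay]
  positivity

/-- A tame function divided by `exp (2πs)`, and its scaling derivative, are bounded by a multiple of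
`decay`. -/
theorem Tame.decay {B : Set (Cpx m × Cpx m)} {φ : ℝ → Cpx m × Cpx m → ℂ}
    (h : Tame B fun s p => (Real.exp (2 * Real.pi * s) : ℂ) * φ s p) :
    (∀ s, 0 < s → DifferentiableOn ℂ (φ s) B) ∧
    (∀ p ∈ B, ∀ s, 0 < s → DifferentiableAt ℝ (fun r => φ r p) s) ∧
    ∃ C, 0 ≤ C ∧ ∀ p ∈ B, ∀ s, 0 < s → ‖φ s p‖ ≤ C * decay s ∧
      ‖(s : ℂ) * deriv (fun r => φ r p) s‖ ≤ C * decay s := by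
  have e : ∀ s p, φ s p = (Real.exp (-(2 * Real.pi) * s) : ℂ) *
      ((Real.exp (2 * Real.pi * s) : ℂ) * φ s p) := fun s p => by
    rw [← mul_assoc, ← ofReal_mul, ← Real.exp_add]
    simp
  have hE : ∀ s : ℝ, HasDerivAt (fun s : ℝ => (Real.exp (-(2 * Real.pi) * s) : ℂ))
      ((Real.exp (-(2 * Real.pi) * s) * (-(2 * Real.pi)) : ℝ) : ℂ) s := fun s => by
    have := ((hasDerivAt_id s).const_mul (-(2 * Real.pi))).exp.ofReal_comp
    simpa using this
  have hd : ∀ p ∈ B, ∀ s, 0 < s → HasDerivAt (fun r => φ r p)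
      (((Real.exp (-(2 * Real.pi) * s) * (-(2 * Real.pi)) : ℝ) : ℂ) *
        ((Real.exp (2 * Real.pi * s) : ℂ) * φ s p) + (Real.exp (-(2 * Real.pi) * s) : ℂ) *
          deriv (fun r : ℝ => (Real.exp (2 * Real.pi * r) : ℂ) * φ r p) s) s := by
    intro p hp s hs
    exact ((hE s).mul (h.differentiable p hp s hs).hasDerivAt).congr_of_eventuallyEq
      (Filter.Eventually.of_forall fun r => e r p)
  refine ⟨fun s hs => ?_, fun p hp s hs => (hd p hp s hs).differentiableAt, ?_⟩
  · exact ((h.holomorphic s hs).const_mul _).congr fun p _ => e s p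
  obtain ⟨C, hC, hb⟩ := h.bound (1 / 4) (by norm_num) (by norm_num)
  have hpi := Real.pi_pos
  refine ⟨(1 + 2 * Real.pi) * C, by positivity, fun p hp s hs => ?_⟩
  have hg := growth_pos hs
  obtain ⟨h1, h2⟩ := hb p hp s hs
  have hx := Real.exp_pos (-(2 * Real.pi) * s)
  refine ⟨?_, ?_⟩
  · rw [e s p, norm_mul, Complex.norm_of_nonneg hx.le, Joyce.decay]
    calc _ ≤ Real.exp (-(2 * Real.pi) * s) * (C * growth s ^ (1 / 4 : ℝ)) := by gcongr
      _ = 1 * C * (1 * (growth s ^ (1 / 4 : ℝ) * Real.exp (-(2 * Real.pi) * s))) := by ring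
      _ ≤ _ := by gcongr <;> linarith
  · rw [(hd p hp s hs).deriv, mul_add, mul_left_comm (s : ℂ) (Real.exp _ : ℂ)]
    have h3 : ‖(s : ℂ) * (((Real.exp (-(2 * Real.pi) * s) * (-(2 * Real.pi)) : ℝ) : ℂ) *
        ((Real.exp (2 * Real.pi * s) : ℂ) * φ s p))‖ ≤ s * (Real.exp (-(2 * Real.pi) * s) *
          (2 * Real.pi) * (C * growth s ^ (1 / 4 : ℝ))) := by
      rw [norm_mul, norm_mul, Complex.norm_of_nonneg hs.le, Complex.norm_real, norm_mul, norm_neg,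
        Real.norm_of_nonneg hx.le, Real.norm_of_nonneg (by positivity)]
      gcongr
    have h4 : ‖(Real.exp (-(2 * Real.pi) * s) : ℂ) * ((s : ℂ) *
        deriv (fun r : ℝ => (Real.exp (2 * Real.pi * r) : ℂ) * φ r p) s)‖ ≤
        Real.exp (-(2 * Real.pi) * s) * (C * growth s ^ (1 / 4 : ℝ)) := by
      rw [norm_mul, Complex.norm_of_nonneg hx.le]
      gcongr
    refine (norm_add_le_of_le h3 h4).trans ?_
    rw [Joyce.decay]
    have h5 : 0 ≤ Real.exp (-(2 * Real.pi) * s) * C * growth s ^ (1 / 4 : ℝ) := by positivity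
    calc _ = (2 * Real.pi * s + 1) * (Real.exp (-(2 * Real.pi) * s) * C * growth s ^ (1 / 4 : ℝ)) := by
          ring
      _ ≤ ((1 + 2 * Real.pi) * (1 + s)) *
          (Real.exp (-(2 * Real.pi) * s) * C * growth s ^ (1 / 4 : ℝ)) := by
          gcongr
          nlinarith
      _ = _ := by ring

section Formal

variable {ω : Matrix (Fin m) (Fin m) ℤ} {σ : Lat m → ℂ} {S : Set (Lat m)} {U : Set (Cpx m)}
  {X : S → Cpx m → Cpx m → ℂ → MvPowerSeries S ℂ} {n : S →₀ ℕ}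

theorem toTrunc_C_mul {τ : Type*} {n : τ →₀ ℕ} (a : ℂ) (f : MvPowerSeries τ ℂ) :
    toTrunc n (MvPowerSeries.C a * f) = a • toTrunc n f := by
  rw [← MvPowerSeries.smul_eq_C_mul, map_smul]

variable (n) in
/-- The truncations of the formal unknowns. -/
def tRay (X : S → Cpx m → Cpx m → ℂ → MvPowerSeries S ℂ) (i : n.support) (s : ℝ)
    (p : Cpx m × Cpx m) : Trunc n :=
  toTrunc n (fRay X i.1 s p)

variable (n) in
/-- The truncations of the formal variables. -/
def tVar (i : n.support) : Trunc n := toTrunc n (MvPowerSeries.X i.1)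

/-- Only the charges in the support of `n` contribute to sums over charges in the truncation. -/
theorem toTrunc_fSumInt (z : Cpx m) (f : S → ℂ → MvPowerSeries S ℂ)
    (hf : ∀ j : n.support, IntegrableOn (fun s => (1 / (I * lin j.1.1 z)) •
      (tVar n j * toTrunc n (f j.1 (rayPoint (lin j.1.1 z) s)))) (Ioi 0)) :
    toTrunc n (fSumInt S z f) = ∑ j : n.support, ∫ s in Ioi (0 : ℝ), (1 / (I * lin j.1.1 z)) •
      (tVar n j * toTrunc n (f j.1 (rayPoint (lin j.1.1 z) s))) := by
  classical
  refine trunc_ext fun k hk => ?_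
  have h1 : ∀ j : n.support, coeffT n k (∫ s in Ioi (0 : ℝ), (1 / (I * lin j.1.1 z)) •
      (tVar n j * toTrunc n (f j.1 (rayPoint (lin j.1.1 z) s)))) =
      if j.1 ∈ k.support then rayInt (lin j.1.1 z) fun t =>
        MvPowerSeries.coeff (k - Finsupp.single j.1 1) (f j.1 t) else 0 := by
    intro j
    have h := (coeffTL n k).integral_comp_comm (hf j)
    refine h.symm.trans ?_
    have hc : ∀ s : ℝ, coeffTL n k ((1 / (I * lin j.1.1 z)) •
        (tVar n j * toTrunc n (f j.1 (rayPoint (lin j.1.1 z) s)))) =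
        if j.1 ∈ k.support then MvPowerSeries.coeff (k - Finsupp.single j.1 1)
          (f j.1 (rayPoint (lin j.1.1 z) s)) / (I * lin j.1.1 z) else 0 := by
      intro s
      rw [map_smul, tVar, ← map_mul, coeffTL_toTrunc hk, MvPowerSeries.X,
        MvPowerSeries.coeff_monomial_mul, smul_eq_mul]
      have : Finsupp.single j.1 1 ≤ k ↔ j.1 ∈ k.support := by
        rw [Finsupp.single_le_iff, Finsupp.mem_support_iff, Nat.one_le_iff_ne_zero]
      simp only [this]
      split_ifs
      · ring
      · ring
    simp only [hc]
    split_ifs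
    · rfl
    · simp
  rw [map_sum, coeffT_toTrunc hk, coeff_fSumInt, Finset.sum_congr rfl fun j _ => h1 j,
    Finset.sum_coe_sort n.support fun i => if i ∈ k.support then rayInt (lin i.1 z) fun t =>
      MvPowerSeries.coeff (k - Finsupp.single i 1) (f i t) else 0, ← Finset.sum_filter]
  refine Finset.sum_congr ?_ fun _ _ => rfl
  ext i
  rw [Finset.mem_filter]
  exact ⟨fun h => ⟨Finsupp.support_mono hk h, h⟩, fun h => h.2⟩

theorem wt_tRay_ne_zero (H : IsFormalSolution ω σ S U X) (hσ : ∀ γ, σ γ ≠ 0) {p : Cpx m × Cpx m}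
    (hp : p.1 ∈ U) (i : n.support) (hZ : lin i.1.1 p.1 ≠ 0) {s : ℝ} (hs : 0 < s) :
    wt (tVar n) id (tRay n X) (i, s) p ≠ 0 := by
  intro h0
  have hle : Finsupp.single i.1 1 ≤ n := by
    rw [Finsupp.single_le_iff]
    exact Nat.one_le_iff_ne_zero.2 (Finsupp.mem_support_iff.1 i.2)
  have h1 := congrArg (coeffT n (Finsupp.single i.1 1)) h0
  rw [wt, id, tVar, tRay, ← map_mul, coeffT_toTrunc hle, map_zero, MvPowerSeries.X,
    MvPowerSeries.coeff_monomial_mul, if_pos le_rfl, one_mul, tsub_self,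
    H.fRay_eq hp i.1 hZ hs, MvPowerSeries.coeff_C_mul,
    coeff_exp_subst (constantCoeff_fExpo i.1 s p) 0 (M := 1) (by simp)] at h1
  simp [hσ] at h1

theorem hasDerivAt_tRay {p : Cpx m × Cpx m} (i : n.support) (s : ℝ)
    (h : ∀ k ≤ n, DifferentiableAt ℝ (fun r => MvPowerSeries.coeff k (fRay X i.1 r p)) s) :
    HasDerivAt (fun r => tRay n X i r p) (∑ k ∈ exponents n,
      deriv (fun r => MvPowerSeries.coeff k (fRay X i.1 r p)) s • (truncMonomial k : Trunc n)) s := by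
  simp only [tRay, toTrunc_eq_sum]
  exact HasDerivAt.fun_sum fun k hk =>
    (h k (mem_exponents.1 hk)).hasDerivAt.smul_const (truncMonomial k)

/-- A common bound for all coefficients of the weighted unknowns. -/
theorem IsFormalSolution.exists_bound (H : IsFormalSolution ω σ S U X)
    (hZ : ∀ z ∈ U, ∀ γ ∈ S, lin γ z ≠ 0) {B : Set (Cpx m × Cpx m)} {δ : ℝ}
    (hB : IsControlled ω Subtype.val n.support B δ) (hBU : ∀ p ∈ B, p.1 ∈ U) :
    ∃ D, 0 ≤ D ∧ ∀ p ∈ B, ∀ x : n.support × ℝ, 0 < x.2 →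
      ‖wt (tVar n) id (tRay n X) x p‖ ≤ D * decay x.2 ∧
      ‖wtD (tVar n) id (tRay n X) x p‖ ≤ D * decay x.2 := by
  have hdec := fun (k : exponents n) (i : n.support) =>
    (H.tame hZ hB hBU (mem_exponents.1 k.2) i.2).decay
  choose hhol hdiff C hC hb using hdec
  have hnn : ∀ i : n.support, 0 ≤ ‖tVar n i‖ * ∑ k : exponents n, C k i * ‖(truncMonomial k.1 : Trunc n)‖ :=
    fun i => mul_nonneg (norm_nonneg _)
      (Finset.sum_nonneg fun k _ => mul_nonneg (hC k i) (norm_nonneg _))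
  refine ⟨∑ i : n.support, ‖tVar n i‖ * ∑ k : exponents n, C k i * ‖(truncMonomial k.1 : Trunc n)‖,
    Finset.sum_nonneg fun i _ => hnn i, fun p hp x hx => ?_⟩
  have hbig : ∀ f : (S →₀ ℕ) → ℂ, (∀ k : exponents n, ‖f k.1‖ ≤ C k x.1 * decay x.2) →
      ‖tVar n x.1 * ∑ k ∈ exponents n, f k • (truncMonomial k : Trunc n)‖ ≤
        (∑ i : n.support, ‖tVar n i‖ *
          ∑ k : exponents n, C k i * ‖(truncMonomial k.1 : Trunc n)‖) * decay x.2 := by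
    intro f hf
    refine (norm_mul_le _ _).trans ?_
    refine le_trans ?_ (mul_le_mul_of_nonneg_right
      (Finset.single_le_sum (fun i _ => hnn i) (Finset.mem_univ x.1)) (decay_nonneg hx))
    rw [mul_assoc, Finset.sum_mul, ← Finset.sum_coe_sort]
    refine mul_le_mul_of_nonneg_left ((norm_sum_le _ _).trans
      (Finset.sum_le_sum fun k _ => ?_)) (norm_nonneg _)
    rw [norm_smul, mul_right_comm]
    exact mul_le_mul_of_nonneg_right (hf k) (norm_nonneg _)
  constructor
  · rw [wt, id, tRay, toTrunc_eq_sum]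
    exact hbig _ fun k => (hb k x.1 p hp x.2 hx).1
  · rw [wtD]
    simp only [id]
    rw [(hasDerivAt_tRay x.1 x.2 fun k hk =>
      hdiff ⟨k, mem_exponents.2 hk⟩ x.1 p hp x.2 hx).deriv, Finset.smul_sum]
    simp only [← smul_assoc]
    refine hbig _ fun k => ?_
    rw [Complex.real_smul]
    exact (hb k x.1 p hp x.2 hx).2

/-- A majorant of the kernel. -/
def kernBound {ι : Type*} (ω : Matrix (Fin m) (Fin m) ℤ) (q : ι → Lat m) (δ : ℝ)
    (x y : ι × ℝ) : ℝ :=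
  ‖(pairing ω (q x.1) (q y.1) : ℂ) / (2 * Real.pi * I)‖ / δ *
    (growth x.2 ^ (1 / 2 : ℝ) * growth y.2 ^ (1 / 2 : ℝ))

theorem IsControlled.norm_rayKern_le {B : Set (Cpx m × Cpx m)} {δ : ℝ}
    (hB : IsControlled ω Subtype.val n.support B δ) {p : Cpx m × Cpx m} (hp : p ∈ B)
    (x y : n.support × ℝ) (hx : 0 < x.2) (hy : 0 < y.2) :
    ‖rayKern ω (fun i : n.support => i.1.1) x y p.1‖ ≤
      kernBound ω (fun i : n.support => i.1.1) δ x y := by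
  have hg := growth_pos hx
  have hg' := growth_pos hy
  have hδ := hB.pos
  rw [rayKern, kernBound, norm_div]
  by_cases hpair : pairing ω x.1.1.1 y.1.1.1 = 0
  · simp [hpair]
  have h1 := hB.cone p hp x.1.1 x.1.2 y.1.1 y.1.2 hpair x.2 y.2 hx hy
  have h2 := inv_add_le_growth hx hy (a := 1 / 2) (by norm_num) (by norm_num)
  rw [show (1 : ℝ) - 1 / 2 = 1 / 2 by norm_num] at h2
  refine (div_le_div_of_nonneg_left (norm_nonneg _) (by positivity) h1).trans ?_
  rw [← div_div, div_eq_mul_inv _ (x.2 + y.2)]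
  exact mul_le_mul_of_nonneg_left h2 (by positivity)

theorem integrableOn_growth_mul_decay (j : ℕ) :
    IntegrableOn (fun s => (1 + s) ^ j * (growth s ^ (1 / 2 : ℝ) * decay s)) (Ioi 0) := by
  refine (integrableOn_growth (j + 1) (b := 1 / 2 + 1 / 4) (by norm_num)).congr_fun
    (fun s hs => ?_) measurableSet_Ioi
  simp only [decay]
  rw [Real.rpow_add (growth_pos hs)]
  ring

/-- The exponents of the truncated equations. -/
theorem IsFormalSolution.toTrunc_fExpo (H : IsFormalSolution ω σ S U X)
    (hZ : ∀ z ∈ U, ∀ γ ∈ S, lin γ z ≠ 0) {B : Set (Cpx m × Cpx m)} {δ : ℝ}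
    (hB : IsControlled ω Subtype.val n.support B δ) (hBU : ∀ p ∈ B, p.1 ∈ U) {p : Cpx m × Cpx m}
    (hp : p ∈ B) (i : n.support) {s : ℝ} (hs : 0 < s) : toTrunc n (fExpo ω X i.1 s p) =
      ∑' j : n.support, ∫ s' in Ioi (0 : ℝ), (lin i.1.1 p.1 *
        rayKern ω (fun i : n.support => i.1.1) (i, s) (j, s') p.1) •
          wt (tVar n) id (tRay n X) (j, s') p := by
  obtain ⟨D, hD, hb⟩ := H.exists_bound hZ hB hBU
  have hi := hZ p.1 (hBU p hp) i.1.1 i.1.2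
  have e : ∀ j : n.support, EqOn (fun s' : ℝ => (1 / (I * lin j.1.1 p.1)) • (tVar n j * toTrunc n
      (MvPowerSeries.C (kern ω i.1.1 j.1.1 (rayPoint (lin i.1.1 p.1) s)
        (rayPoint (lin j.1.1 p.1) s')) * X j.1 p.1 p.2 (rayPoint (lin j.1.1 p.1) s'))))
      (fun s' => (lin i.1.1 p.1 * rayKern ω (fun i : n.support => i.1.1) (i, s) (j, s') p.1) •
          wt (tVar n) id (tRay n X) (j, s') p) (Ioi 0) := by
    intro j s' hs'
    have hj := hZ p.1 (hBU p hp) j.1.1 j.1.2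
    simp only [wt, tRay, fRay, id]
    rw [toTrunc_C_mul, mul_smul_comm, smul_smul,
      kern_rayPoint ω (fun i : n.support => i.1.1) i j p.1 hi hj hs hs']
    congr 1
    field_simp
  rw [fExpo, toTrunc_fSumInt, tsum_fintype]
  · exact Finset.sum_congr rfl fun j _ => setIntegral_congr_fun measurableSet_Ioi (e j)
  · intro j
    refine IntegrableOn.congr_fun ?_ (e j).symm measurableSet_Ioi
    refine ((integrableOn_growth_mul_decay 0).const_mul (‖lin i.1.1 p.1‖ *
      (‖(pairing ω i.1.1 j.1.1 : ℂ) / (2 * Real.pi * I)‖ / δ *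
        growth s ^ (1 / 2 : ℝ)) * D)).mono' ?_ ?_
    · have hk : Measurable fun s' : ℝ => lin i.1.1 p.1 *
          rayKern ω (fun i : n.support => i.1.1) (i, s) (j, s') p.1 := by
        unfold rayKern
        fun_prop
      have hw : ContinuousOn (fun s' => wt (tVar n) id (tRay n X) (j, s') p) (Ioi 0) :=
        fun s' hs' => ((hasDerivAt_tRay j s' fun k hk =>
          (H.tame hZ hB hBU hk j.2).decay.2.1 p hp s' hs').continuousAt.const_mul
            (tVar n j)).continuousWithinAt
      exact hk.aestronglyMeasurable.smul (hw.aestronglyMeasurable measurableSet_Ioi)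
    · filter_upwards [ae_restrict_mem measurableSet_Ioi] with s' hs'
      have h1 := hB.norm_rayKern_le hp (i, s) (j, s') hs hs'
      have h2 := (hb p hp (j, s') hs').1
      have h3 := growth_pos hs
      have h4 := growth_pos hs'
      have h5 := hB.pos
      have h6 := decay_nonneg hs'
      rw [norm_smul, norm_mul]
      refine (mul_le_mul (mul_le_mul_of_nonneg_left h1 (norm_nonneg _)) h2 (norm_nonneg _)
        (by unfold kernBound; positivity)).trans (le_of_eq ?_)
      simp only [kernBound]
      ring

/-- Near each point, the truncations of a formal solution form a uniform solution with values in
the truncated power series. -/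
theorem IsFormalSolution.uniformSolution (H : IsFormalSolution ω σ S U X) (hω : ω.transpose = -ω)
    (hσ : ∀ γ, σ γ ≠ 0) (hZ : ∀ z ∈ U, ∀ γ ∈ S, lin γ z ≠ 0)
    (hoff : ∀ z ∈ U, ∀ γ ∈ S, ∀ γ' ∈ S, pairing ω γ γ' ≠ 0 → ¬ Aligned (lin γ z) (lin γ' z))
    {B : Set (Cpx m × Cpx m)} {δ D : ℝ} (hB : IsControlled ω Subtype.val n.support B δ)
    (hBU : ∀ p ∈ B, p.1 ∈ U) (hD : ∀ p ∈ B, ∀ x : n.support × ℝ, 0 < x.2 →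
      ‖wt (tVar n) id (tRay n X) x p‖ ≤ D * decay x.2 ∧
      ‖wtD (tVar n) id (tRay n X) x p‖ ≤ D * decay x.2) :
    UniformSolution ω (fun i : n.support => i.1.1) (fun i => σ i.1.1) (tVar n) id id B (tRay n X)
      (fun x => D * decay x.2) (fun x => D * decay x.2)
      (kernBound ω (fun i : n.support => i.1.1) δ) where
  skew := hω
  isOpen := hB.isOpen
  support := by
    have hδ := hB.pos
    have hs : ∀ i : n.support, ‖i.1.1‖ ≤ ∑ j : n.support, ‖j.1.1‖ := fun i =>
      Finset.single_le_sum (f := fun j : n.support => ‖j.1.1‖) (fun _ _ => norm_nonneg _)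
        (Finset.mem_univ i)
    have h0 : 0 ≤ ∑ j : n.support, ‖j.1.1‖ := Finset.sum_nonneg fun _ _ => norm_nonneg _
    refine ⟨δ⁻¹ * (1 + ∑ j : n.support, ‖j.1.1‖), by positivity, fun p hp i => ?_⟩
    have h1 : 1 + ∑ j : n.support, ‖j.1.1‖ ≤
        δ⁻¹ * (1 + ∑ j : n.support, ‖j.1.1‖) * ‖lin i.1.1 p.1‖ := by
      calc 1 + ∑ j : n.support, ‖j.1.1‖ = δ⁻¹ * (1 + ∑ j : n.support, ‖j.1.1‖) * δ := by field_simp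
        _ ≤ _ := by
          gcongr
          exact hB.lower p hp i.1 i.2
    exact ⟨fun a => by linarith [norm_le_of_cast i.1.1 a, hs i], by linarith⟩
  offWalls p hp i j hij s s' hs hs' := not_aligned_sub_ne_zero (hZ _ (hBU p hp) _ i.1.2)
    (hoff _ (hBU p hp) _ i.1.2 _ j.1.2 hij) hs hs'
  sigma_ne_zero i := hσ _
  regular p hp i s hs := by
    refine ⟨1, 1, ?_, ?_, one_mul _⟩ <;>
    · exact (hasFDerivAt_id _).congr_fderiv (by ext; simp)
  ne_zero p hp x hx := wt_tRay_ne_zero H hσ (hBU p hp) x.1 (hZ _ (hBU p hp) _ x.1.1.2) hx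
  tba p hp i s hs := by
    rw [tRay, H.fRay_eq (hBU p hp) i.1 (hZ _ (hBU p hp) _ i.1.2) hs, toTrunc_C_mul,
      toTrunc_exp_subst (constantCoeff_fExpo i.1 s p), H.toTrunc_fExpo hZ hB hBU hp i hs]
  holomorphic i s hs := by
    have e : tRay n X i s = fun p => ∑ k ∈ exponents n,
        MvPowerSeries.coeff k (fRay X i.1 s p) • (truncMonomial k : Trunc n) :=
      funext fun p => toTrunc_eq_sum _
    rw [e]
    exact DifferentiableOn.fun_sum fun k hk =>
      ((H.tame hZ hB hBU (mem_exponents.1 hk) i.2).decay.1 s hs).smul_const _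
  differentiable p hp i s hs := (hasDerivAt_tRay i s fun k hk =>
    (H.tame hZ hB hBU hk i.2).decay.2.1 p hp s hs).differentiableAt
  bound_wt p hp x hx := (hD p hp x hx).1
  bound_wtD p hp x hx := (hD p hp x hx).2
  bound_h p hp x hx := (hD p hp x hx).1
  bound_kern p hp x y hx hy := hB.norm_rayKern_le hp x y hx hy
  integrable := by
    refine integrable_rayMeasure_iff.2 ⟨fun i => ?_, (hasSum_fintype _).summable⟩
    refine ((integrableOn_growth 2 (b := 1 / 4) (by norm_num)).const_mul D).congr
      (Filter.Eventually.of_forall fun s => ?_)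
    simp only [decay]
    ring
  integrable_h := by
    refine integrable_rayMeasure_iff.2 ⟨fun i => ?_, (hasSum_fintype _).summable⟩
    refine ((integrableOn_growth 1 (b := 1 / 4) (by norm_num)).const_mul D).congr
      (Filter.Eventually.of_forall fun s => ?_)
    simp only [decay]
    ring
  integrable_prod := by
    refine integrable_rayMeasure_prod_iff.2 ⟨fun i j => ?_, (hasSum_fintype _).summable⟩
    have h := ((integrableOn_growth_mul_decay 1).mul_prod (integrableOn_growth_mul_decay 0)).const_mul
      (D * D * (‖(pairing ω i.1.1 j.1.1 : ℂ) / (2 * Real.pi * I)‖ / δ))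
    rw [Measure.prod_restrict, ← Measure.volume_eq_prod] at h
    refine h.congr (Filter.Eventually.of_forall fun w => ?_)
    simp only [kernBound]
    ring

end Formal

/-! ### Potentials of formal solutions -/

section Formal

variable {ω : Matrix (Fin m) (Fin m) ℤ} {σ : Lat m → ℂ} {S : Set (Lat m)} {U : Set (Cpx m)}
  {X : S → Cpx m → Cpx m → ℂ → MvPowerSeries S ℂ} {n : S →₀ ℕ}

/-- The coefficientwise derivatives of a formal power series are, after truncation, derivatives of
functions with values in a Banach space. -/
theorem toTrunc_derivatives {Φ : Cpx m → Cpx m → MvPowerSeries S ℂ} {P : Cpx m × Cpx m → Trunc n}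
    {B : Set (Cpx m × Cpx m)} (hB : IsOpen B) (e : ∀ p ∈ B, toTrunc n (Φ p.1 p.2) = P p)
    {p : Cpx m × Cpx m} (hp : p ∈ B) (hP : DifferentiableAt ℂ P p) :
    (∀ k ≤ n, DifferentiableAt ℂ (fun p : Cpx m × Cpx m => MvPowerSeries.coeff k (Φ p.1 p.2)) p) ∧
    ∀ a, toTrunc n (fdz a Φ p.1 p.2) = fderiv ℂ P p (Pi.single a 1, 0) ∧
      toTrunc n (fdθ a Φ p.1 p.2) = fderiv ℂ P p (0, Pi.single a 1) := by
  have hk : ∀ k ≤ n, (fun p : Cpx m × Cpx m => MvPowerSeries.coeff k (Φ p.1 p.2)) =ᶠ[𝓝 p]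
      fun p => coeffTL n k (P p) := fun k hk =>
    Filter.mem_of_superset (hB.mem_nhds hp) fun p' hp' => by
      change MvPowerSeries.coeff k (Φ p'.1 p'.2) = coeffTL n k (P p')
      rw [← e p' hp', coeffTL_toTrunc hk]
  have hF : ∀ k ≤ n, HasFDerivAt
      (fun p : Cpx m × Cpx m => MvPowerSeries.coeff k (Φ p.1 p.2)) ((coeffTL n k).comp (fderiv ℂ P p))
      p := fun k h => ((coeffTL n k).hasFDerivAt.comp p hP.hasFDerivAt).congr_of_eventuallyEq (hk k h)
  refine ⟨fun k h => (hF k h).differentiableAt, fun a => ⟨?_, ?_⟩⟩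
  · refine trunc_ext fun k h => ?_
    rw [coeffT_toTrunc h]
    refine (dz_eq_fderiv (Φ := fun w η => MvPowerSeries.coeff k (Φ w η)) a
      (hF k h).differentiableAt).trans ?_
    rw [(hF k h).fderiv]
    rfl
  · refine trunc_ext fun k h => ?_
    rw [coeffT_toTrunc h]
    refine (dθ_eq_fderiv (Φ := fun w η => MvPowerSeries.coeff k (Φ w η)) a
      (hF k h).differentiableAt).trans ?_
    rw [(hF k h).fderiv]
    rfl

namespace IsFormalSolution

variable {N N' : n.support × ℝ → ℝ} {κ : n.support × ℝ → n.support × ℝ → ℝ}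
  {B : Set (Cpx m × Cpx m)} {p : Cpx m × Cpx m}

theorem toTrunc_fPotF (hZ : ∀ z ∈ U, ∀ γ ∈ S, lin γ z ≠ 0) (hBU : ∀ p ∈ B, p.1 ∈ U)
    (T : UniformSolution ω (fun i : n.support => i.1.1) (fun i => σ i.1.1) (tVar n) id id B
      (tRay n X) N N' κ) (hp : p ∈ B) :
    toTrunc n (fPotF S X p.1 p.2) = joycePot (tVar n) id (tRay n X) p := by
  have h1 := T.integrable_smul hp (T.adm_wt hp) (a := fun _ => -I) measurable_const (C := 1)
    fun x hx => by rw [norm_neg, norm_I]; linarith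
  have e : ∀ (j : n.support) (s : ℝ), (1 / (I * lin j.1.1 p.1)) • (tVar n j * toTrunc n
      (MvPowerSeries.C (lin j.1.1 p.1) * X j.1 p.1 p.2 (rayPoint (lin j.1.1 p.1) s))) =
      (-I) • wt (tVar n) id (tRay n X) (j, s) p := by
    intro j s
    have hj := hZ p.1 (hBU p hp) j.1.1 j.1.2
    simp only [wt, tRay, fRay, id]
    rw [toTrunc_C_mul, mul_smul_comm, smul_smul, show (-I : ℂ) = 1 / I by simp]
    congr 1
    field_simp
  rw [fPotF, toTrunc_fSumInt, joycePot, integral_rayMeasure h1, tsum_fintype]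
  · exact Finset.sum_congr rfl fun j _ => integral_congr_ae (Filter.Eventually.of_forall (e j))
  · intro j
    simp only [e j]
    exact (integrable_rayMeasure_iff.1 h1).1 j

theorem toTrunc_fPotW (hZ : ∀ z ∈ U, ∀ γ ∈ S, lin γ z ≠ 0) (hBU : ∀ p ∈ B, p.1 ∈ U)
    (hG : ∀ p ∈ B, ∀ (i : n.support) (s : ℝ), 0 < s → toTrunc n (fExpo ω X i.1 s p) =
      ∑' j : n.support, ∫ s' in Ioi (0 : ℝ), (lin i.1.1 p.1 *
        rayKern ω (fun i : n.support => i.1.1) (i, s) (j, s') p.1) •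
          wt (tVar n) id (tRay n X) (j, s') p)
    (T : UniformSolution ω (fun i : n.support => i.1.1) (fun i => σ i.1.1) (tVar n) id id B
      (tRay n X) N N' κ) (hp : p ∈ B) :
    toTrunc n (fPotW ω S X p.1 p.2) =
      plebPot ω (fun i : n.support => i.1.1) (tVar n) id id (tRay n X) p := by
  have hI := T.integrable_plebPot hp
  have e : ∀ j : n.support, (fun s : ℝ => (1 / (I * lin j.1.1 p.1)) • (tVar n j * toTrunc n
      (X j.1 p.1 p.2 (rayPoint (lin j.1.1 p.1) s) * (1 - MvPowerSeries.C (1 / 2) *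
        fSumInt S p.1 fun γ' t' => MvPowerSeries.C (kern ω j.1.1 γ'.1
          (rayPoint (lin j.1.1 p.1) s) t') * X γ' p.1 p.2 t'))))
      =ᵐ[volume.restrict (Ioi 0)] fun s =>
        (1 / (I * lin j.1.1 p.1)) • (tVar n j * id (tRay n X j s p)) -
          (1 / (2 * I) : ℂ) • (wt (tVar n) id (tRay n X) (j, s) p *
            rayConv ω (fun i : n.support => i.1.1) p.1
              (fun y => wt (tVar n) id (tRay n X) y p) (j, s)) := by
    intro j
    filter_upwards [ae_restrict_mem measurableSet_Ioi,
      ae_rayMeasure_iff.1 (T.integrable_kern hp) j] with s hs hk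
    have hj := hZ p.1 (hBU p hp) j.1.1 j.1.2
    have h1 := T.integrable_kern_smul hp (T.adm_wt hp) (x := (j, s)) hs hk
    have h2 := integral_rayMeasure (h1.fun_smul (lin j.1.1 p.1))
    rw [integral_smul, ← rayConv] at h2
    simp only [smul_smul] at h2
    rw [← fExpo, map_mul, map_sub, map_one, toTrunc_C_mul, hG p hp j s hs, ← h2]
    have h3 : toTrunc n (X j.1 p.1 p.2 (rayPoint (lin j.1.1 p.1) s)) = tRay n X j s p := rfl
    simp only [wt, id]
    rw [h3, mul_sub, mul_one, mul_sub, smul_sub, mul_smul_comm, mul_smul_comm,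
      mul_smul_comm, mul_smul_comm, smul_smul, smul_smul, mul_assoc (tVar n j)]
    congr 2
    field_simp
  rw [fPotW, toTrunc_C_mul, plebPot, integral_rayMeasure hI, tsum_fintype, toTrunc_fSumInt]
  · congr 1
    exact Finset.sum_congr rfl fun j _ => integral_congr_ae (e j)
  · exact fun j => ((integrable_rayMeasure_iff.1 hI).1 j).congr (e j).symm

/-- The potentials of a formal solution satisfy the isomonodromy equation, and `F` is the
contraction of the angular derivatives of `W` with `z`. -/
theorem potentialEq (H : IsFormalSolution ω σ S U X) (hω : ω.transpose = -ω)
    (hσ : ∀ γ, σ γ ≠ 0) (hU : IsOpen U) (hZ : ∀ z ∈ U, ∀ γ ∈ S, lin γ z ≠ 0)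
    (hoff : ∀ z ∈ U, ∀ γ ∈ S, ∀ γ' ∈ S, pairing ω γ γ' ≠ 0 → ¬ Aligned (lin γ z) (lin γ' z)) :
    FPotentialEq ω U (fPotF S X) (fPotW ω S X) ∧ ∀ z ∈ U, ∀ θ,
      fPotF S X z θ = ∑ a, MvPowerSeries.C (z a) * fdθ a (fPotW ω S X) z θ := by
  have key : ∀ (n : S →₀ ℕ), ∀ p : Cpx m × Cpx m, p.1 ∈ U →
      DifferentiableAt ℂ (fun p : Cpx m × Cpx m => MvPowerSeries.coeff n (fPotF S X p.1 p.2)) p ∧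
      DifferentiableAt ℂ (fun p : Cpx m × Cpx m => MvPowerSeries.coeff n (fPotW ω S X p.1 p.2)) p ∧
      (∀ c, DifferentiableAt ℂ (fun p : Cpx m × Cpx m =>
        MvPowerSeries.coeff n (fdθ c (fPotW ω S X) p.1 p.2)) p) ∧
      (∀ c, toTrunc n (fdz c (fPotF S X) p.1 p.2) = toTrunc n
        (MvPowerSeries.C (1 / (2 * Real.pi * I) ^ 2) * ∑ a, ∑ b, MvPowerSeries.C (ω a b : ℂ) *
          fdθ a (fPotF S X) p.1 p.2 * fdθ b (fdθ c (fPotW ω S X)) p.1 p.2)) ∧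
      toTrunc n (fPotF S X p.1 p.2) =
        toTrunc n (∑ a, MvPowerSeries.C (p.1 a) * fdθ a (fPotW ω S X) p.1 p.2) := by
    intro n p₀ hp₀
    obtain ⟨B, δ, hp₀B, hBU, hB⟩ := exists_isControlled ω (Subtype.val : S → Lat m) n.support hU hp₀
      (fun i => hZ _ hp₀ _ i.2) fun i j => hoff _ hp₀ _ i.2 _ j.2
    obtain ⟨D, -, hD⟩ := H.exists_bound hZ hB hBU
    have T := H.uniformSolution hω hσ hZ hoff hB hBU hD
    have eF : ∀ p ∈ B, toTrunc n (fPotF S X p.1 p.2) = joycePot (tVar n) id (tRay n X) p :=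
      fun p hp => toTrunc_fPotF hZ hBU T hp
    have eW : ∀ p ∈ B, toTrunc n (fPotW ω S X p.1 p.2) =
        plebPot ω (fun i : n.support => i.1.1) (tVar n) id id (tRay n X) p := fun p hp =>
      toTrunc_fPotW hZ hBU (fun p hp i s hs => H.toTrunc_fExpo hZ hB hBU hp i hs) T hp
    have dF := toTrunc_derivatives T.isOpen eF hp₀B (T.joycePot_holomorphic hp₀B).1
    have dW := fun p (hp : p ∈ B) => toTrunc_derivatives T.isOpen eW hp (T.plebPot_holomorphic hp).1
    have eE : ∀ a, ∀ p ∈ B, toTrunc n (fdθ a (fPotW ω S X) p.1 p.2) =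
        anglePot (fun i : n.support => i.1.1) (tVar n) id (tRay n X) (Pi.single a 1) p :=
      fun a p hp => by rw [((dW p hp).2 a).2, (T.plebPot_holomorphic hp).2]
    have dE := fun a => toTrunc_derivatives T.isOpen (eE a) hp₀B
      (T.anglePot_holomorphic hp₀B (Pi.single a 1)).1
    refine ⟨dF.1 n le_rfl, (dW p₀ hp₀B).1 n le_rfl, fun c => (dE c).1 n le_rfl, fun c => ?_, ?_⟩
    · rw [(dF.2 c).1, T.fderiv_joycePot_eq hp₀B, toTrunc_C_mul]
      simp only [map_sum, mul_assoc, toTrunc_C_mul]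
      simp only [map_mul, (dF.2 _).2, ((dE c).2 _).2]
    · rw [eF p₀ hp₀B, T.joycePot_eq_anglePot hp₀B, T.anglePot_eq_sum hp₀B]
      simp only [map_sum, toTrunc_C_mul, eE _ p₀ hp₀B]
  refine ⟨⟨fun n p hp => (key n p hp.1).1.differentiableWithinAt,
    fun n p hp => (key n p hp.1).2.1.differentiableWithinAt,
    fun c n p hp => ((key n p hp.1).2.2.1 c).differentiableWithinAt, fun z hz θ c => ?_⟩,
    fun z hz θ => ?_⟩
  · ext n
    exact toTrunc_eq_iff.1 ((key n (z, θ) hz).2.2.2.1 c) n le_rfl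
  · ext n
    exact toTrunc_eq_iff.1 (key n (z, θ) hz).2.2.2.2 n le_rfl

end IsFormalSolution

end Formal

/-! ### Fourier modes of formal solutions -/

theorem lin_charge_add (γ γ' : Lat m) (v : Cpx m) : lin (γ + γ') v = lin γ v + lin γ' v := by
  simp [lin, add_mul, Finset.sum_add_distrib]

theorem lin_zero (γ : Lat m) : lin γ 0 = 0 := by simp [lin]

theorem zero_lin (v : Cpx m) : lin 0 v = 0 := by simp [lin]

/-- The character `exp(2πi θ_γ)`. -/
def character (γ : Lat m) (θ : Cpx m) : ℂ := exp (2 * Real.pi * I * lin γ θ)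

theorem character_add (γ γ' : Lat m) (θ : Cpx m) :
    character (γ + γ') θ = character γ θ * character γ' θ := by
  rw [character, lin_charge_add, mul_add, Complex.exp_add]
  rfl

theorem character_zero (γ : Lat m) : character γ 0 = 1 := by simp [character, lin_zero]

theorem zero_character (θ : Cpx m) : character 0 θ = 1 := by simp [character, zero_lin]

theorem hasFDerivAt_character (γ : Lat m) (θ : Cpx m) :
    HasFDerivAt (character γ) (character γ θ • ((2 * Real.pi * I : ℂ) • linL γ)) θ :=
  (((linL γ).hasFDerivAt (x := θ)).const_mul (2 * Real.pi * I)).cexp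

theorem pderiv_mul_character (c : ℂ) (γ : Lat m) (a : Fin m) (θ : Cpx m) :
    pderiv a (fun θ => c * character γ θ) θ = 2 * Real.pi * I * γ a * c * character γ θ := by
  rw [pderiv, ((hasFDerivAt_character γ θ).const_mul c).fderiv]
  simp only [smul_apply, linL_apply, lin_single, smul_eq_mul]
  ring

/-- Orthogonality of characters. -/
theorem fourierMode_mul_character [DecidableEq (Lat m)] (c : ℂ) (δ γ : Lat m) :
    fourierMode (fun θ => c * character δ θ) 0 γ = if γ = δ then c else 0 := by
  split_ifs with h
  · subst h
    have : ∀ x : Fin m → ℝ, c * character γ (fun a => (0 : Cpx m) a + (x a : ℂ)) *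
        exp (-(2 * Real.pi * I * lin γ fun a => (0 : Cpx m) a + (x a : ℂ))) = c := fun x => by
      rw [character, mul_assoc, ← Complex.exp_add, add_neg_cancel, Complex.exp_zero, mul_one]
    simp only [fourierMode, this]
    rw [setIntegral_const, Measure.real, Real.volume_Icc_pi]
    simp
  · -- an angular derivative multiplies the mode both by `δ a` and by `γ a`
    obtain ⟨a, ha⟩ := Function.ne_iff.1 h
    have hper : PeriodicOn univ fun θ : Cpx m => c * character δ θ := by
      refine ⟨fun θ _ =>
        ((hasFDerivAt_character δ θ).const_mul c).differentiableAt.differentiableWithinAt,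
        fun θ _ k => ?_⟩
      have e : (fun b => θ b + (k b : ℂ)) = θ + fun b => (k b : ℂ) := rfl
      have hk : lin δ (fun b => (k b : ℂ)) = ((∑ b, δ b * k b : ℤ) : ℂ) := by
        simp [lin]
      simp only [e, character]
      rw [lin_add, hk, mul_add, Complex.exp_add, mul_comm (2 * Real.pi * I) (((_ : ℤ)) : ℂ),
        exp_int_mul_two_pi_mul_I, mul_one]
    have h1 := fourierMode_pderiv isOpen_univ (fun x => mem_univ (realShift 0 x)) hper a γ
    have h2 : pderiv a (fun θ : Cpx m => c * character δ θ) =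
        fun θ => 2 * Real.pi * I * δ a * (c * character δ θ) :=
      funext fun θ => by rw [pderiv_mul_character, mul_assoc]
    rw [h2, fourierMode_const_mul] at h1
    have h3 : 2 * Real.pi * I * ((γ a : ℂ) - δ a) *
        fourierMode (fun θ => c * character δ θ) 0 γ = 0 := by linear_combination -h1
    have h4 : (γ a : ℂ) - δ a ≠ 0 := sub_ne_zero.2 (by exact_mod_cast ha)
    simpa [h4, Real.pi_ne_zero] using h3

section Covariance

variable {τ : Type*}

/-- Up to the exponent `k`, the coefficients of `f` are those of `f₀` multiplied by `a χ`. -/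
def Covariant (χ : (τ →₀ ℕ) → ℂ) (k : τ →₀ ℕ) (a : ℂ) (f f₀ : MvPowerSeries τ ℂ) : Prop :=
  ∀ j ≤ k, MvPowerSeries.coeff j f = a * χ j * MvPowerSeries.coeff j f₀

variable {χ : (τ →₀ ℕ) → ℂ} {k : τ →₀ ℕ} {a b : ℂ} {f f₀ g g₀ : MvPowerSeries τ ℂ}

namespace Covariant

theorem one (h0 : χ 0 = 1) : Covariant χ k 1 1 1 := by
  classical
  intro j _
  rw [MvPowerSeries.coeff_one]
  split_ifs with hj
  · rw [hj, h0, mul_one, mul_one]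
  · rw [mul_zero]

theorem sub (h : Covariant χ k a f f₀) (h' : Covariant χ k a g g₀) :
    Covariant χ k a (f - g) (f₀ - g₀) := fun j hj => by
  rw [map_sub, map_sub, h j hj, h' j hj, mul_sub]

theorem C_mul (r : ℂ) (h : Covariant χ k a f f₀) :
    Covariant χ k a (MvPowerSeries.C r * f) (MvPowerSeries.C r * f₀) := fun j hj => by
  rw [MvPowerSeries.coeff_C_mul, MvPowerSeries.coeff_C_mul, h j hj]
  ring

theorem mul (hχ : ∀ i j, χ (i + j) = χ i * χ j) (h : Covariant χ k a f f₀)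
    (h' : Covariant χ k b g g₀) : Covariant χ k (a * b) (f * g) (f₀ * g₀) := by
  classical
  intro j hj
  rw [MvPowerSeries.coeff_mul, MvPowerSeries.coeff_mul, Finset.mul_sum]
  refine Finset.sum_congr rfl fun x hx => ?_
  have hx' := Finset.HasAntidiagonal.mem_antidiagonal.1 hx
  rw [h x.1 ((le_self_add.trans_eq hx').trans hj), h' x.2 ((le_add_self.trans_eq hx').trans hj),
    ← hx', hχ]
  ring

theorem pow (h0 : χ 0 = 1) (hχ : ∀ i j, χ (i + j) = χ i * χ j) (h : Covariant χ k 1 f f₀) (d : ℕ) :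
    Covariant χ k 1 (f ^ d) (f₀ ^ d) := by
  induction d with
  | zero => simpa using one h0
  | succ d ih => simpa [pow_succ] using ih.mul hχ h

theorem exp_subst (h0 : χ 0 = 1) (hχ : ∀ i j, χ (i + j) = χ i * χ j) (h : Covariant χ k 1 f f₀)
    (hf : MvPowerSeries.constantCoeff f = 0) (hf₀ : MvPowerSeries.constantCoeff f₀ = 0) :
    Covariant χ k 1 ((PowerSeries.exp ℂ).subst f) ((PowerSeries.exp ℂ).subst f₀) := by
  intro j hj
  rw [coeff_exp_subst hf j (Nat.lt_succ_self _), coeff_exp_subst hf₀ j (Nat.lt_succ_self _),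
    Finset.mul_sum]
  refine Finset.sum_congr rfl fun d _ => ?_
  rw [h.pow h0 hχ d j hj]
  ring

end Covariant

end Covariance

section Formal

variable {ω : Matrix (Fin m) (Fin m) ℤ} {σ : Lat m → ℂ} {S : Set (Lat m)} {U : Set (Cpx m)}
  {X : S → Cpx m → Cpx m → ℂ → MvPowerSeries S ℂ}

/-- The charge `∑ n_γ γ` of the monomial with exponent `n`. -/
def totalCharge (n : S →₀ ℕ) : Lat m := n.sum fun i c => c • i.1

theorem totalCharge_zero : totalCharge (0 : S →₀ ℕ) = 0 := Finsupp.sum_zero_index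

theorem totalCharge_add (k l : S →₀ ℕ) : totalCharge (k + l) = totalCharge k + totalCharge l :=
  Finsupp.sum_add_index' (fun _ => zero_smul _ _) fun _ _ _ => add_smul _ _ _

theorem totalCharge_single (i : S) : totalCharge (Finsupp.single i 1) = i.1 := by
  rw [totalCharge, Finsupp.sum_single_index (h := fun (i : S) (c : ℕ) => c • i.1) (zero_smul _ _), one_smul]

theorem covariant_fSumInt {z : Cpx m} (hZ : ∀ i : S, lin i.1 z ≠ 0) {χ : (S →₀ ℕ) → ℂ}
    (hχ : ∀ i j, χ (i + j) = χ i * χ j) {f f₀ : S → ℂ → MvPowerSeries S ℂ} {k : S →₀ ℕ}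
    (h : ∀ i : S, ∀ t ∈ bpsRay (lin i.1 z), ∀ j, j + Finsupp.single i 1 ≤ k →
      Covariant χ j (χ (Finsupp.single i 1)) (f i t) (f₀ i t)) :
    Covariant χ k 1 (fSumInt S z f) (fSumInt S z f₀) := by
  intro j hj
  rw [coeff_fSumInt, coeff_fSumInt, Finset.mul_sum]
  refine Finset.sum_congr rfl fun i hi => ?_
  have hle : Finsupp.single i 1 ≤ j := by
    rw [Finsupp.single_le_iff]
    exact Nat.one_le_iff_ne_zero.2 (Finsupp.mem_support_iff.1 hi)
  have e := tsub_add_cancel_of_le hle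
  rw [rayInt, rayInt, ← integral_const_mul]
  refine setIntegral_congr_fun measurableSet_Ioi fun s hs => ?_
  rw [h i _ (rayPoint_mem_bpsRay (hZ i) hs) (j - Finsupp.single i 1) (e.trans_le hj) _ le_rfl,
    mul_comm (χ _), ← hχ, e]
  ring

/-- The dependence of a formal solution on the angles: the coefficient of exponent `k` of `X_γ` is
proportional to the character of `γ` plus the charge of `k`. -/
theorem IsFormalSolution.covariant (H : IsFormalSolution ω σ S U X) {z : Cpx m} (hz : z ∈ U)
    (hZ : ∀ i : S, lin i.1 z ≠ 0) (θ : Cpx m) (k : S →₀ ℕ) (i : S) (t : ℂ)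
    (ht : t ∈ bpsRay (lin i.1 z)) : Covariant (fun n => character (totalCharge n) θ) k
      (character (totalCharge (Finsupp.single i 1)) θ) (X i z θ t) (X i z 0 t) := by
  have h0 : character (totalCharge (0 : S →₀ ℕ)) θ = 1 := by rw [totalCharge_zero, zero_character]
  have hχ : ∀ k l : S →₀ ℕ, character (totalCharge (k + l)) θ =
      character (totalCharge k) θ * character (totalCharge l) θ := fun k l => by
    rw [totalCharge_add, character_add]
  induction hN : k.degree using Nat.strong_induction_on generalizing k i t with
  | _ N ih =>
  have hG := covariant_fSumInt (k := k) hZ hχ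
    (f := fun j t' => MvPowerSeries.C (kern ω i.1 j.1 t t') * X j z θ t')
    (f₀ := fun j t' => MvPowerSeries.C (kern ω i.1 j.1 t t') * X j z 0 t') fun i' t' ht' j hj => by
      have hdeg : j.degree < N := by
        have := Finsupp.degree_mono hj
        rw [map_add, Finsupp.degree_single] at this
        omega
      exact (ih _ hdeg j i' t' ht' rfl).C_mul _
  have hE := hG.exp_subst h0 hχ (constantCoeff_fSumInt _ _) (constantCoeff_fSumInt _ _)
  have hs : semiflat σ i.1 z θ t = character (totalCharge (Finsupp.single i 1)) θ *
      semiflat σ i.1 z 0 t := by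
    rw [semiflat, semiflat, totalCharge_single, lin_zero, zero_sub, sub_eq_add_neg, mul_add,
      Complex.exp_add, character]
    ring
  intro j hj
  rw [H z hz θ i t ht, H z hz 0 i t ht, hs, MvPowerSeries.coeff_C_mul, MvPowerSeries.coeff_C_mul,
    hE j hj]
  ring

/-- Each coefficient of `W` depends on the angles through the character of its total charge. -/
theorem IsFormalSolution.coeff_fPotW (H : IsFormalSolution ω σ S U X) {z : Cpx m} (hz : z ∈ U)
    (hZ : ∀ i : S, lin i.1 z ≠ 0) (θ : Cpx m) (n : S →₀ ℕ) :
    MvPowerSeries.coeff n (fPotW ω S X z θ) =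
      MvPowerSeries.coeff n (fPotW ω S X z 0) * character (totalCharge n) θ := by
  have h0 : character (totalCharge (0 : S →₀ ℕ)) θ = 1 := by rw [totalCharge_zero, zero_character]
  have hχ : ∀ k l : S →₀ ℕ, character (totalCharge (k + l)) θ =
      character (totalCharge k) θ * character (totalCharge l) θ := fun k l => by
    rw [totalCharge_add, character_add]
  have hc := fun (k : S →₀ ℕ) => H.covariant hz hZ θ k
  have hG : ∀ (k : S →₀ ℕ) (i : S) (t : ℂ), Covariant (fun n => character (totalCharge n) θ) k 1
      (fSumInt S z fun j t' => MvPowerSeries.C (kern ω i.1 j.1 t t') * X j z θ t')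
      (fSumInt S z fun j t' => MvPowerSeries.C (kern ω i.1 j.1 t t') * X j z 0 t') := fun k i t =>
    covariant_fSumInt hZ hχ fun i' t' ht' j _ => (hc j i' t' ht').C_mul _
  have hW := covariant_fSumInt (k := n) hZ hχ fun i t ht j _ => by
    have := (hc j i t ht).mul hχ ((Covariant.one h0).sub ((hG j i t).C_mul (1 / 2)))
    rwa [mul_one] at this
  have := hW.C_mul (1 / (2 * Real.pi * I)) n le_rfl
  rw [one_mul] at this
  exact this.trans (mul_comm _ _)

end Formal

section Formal

variable {ω : Matrix (Fin m) (Fin m) ℤ} {S : Set (Lat m)} {U : Set (Cpx m)}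
  {F W : Cpx m → Cpx m → MvPowerSeries S ℂ}

/-- The Fourier modes of power series whose coefficients are multiples of single characters. -/
theorem coeff_fMode [DecidableEq (Lat m)] {z : Cpx m} {n : S →₀ ℕ}
    (hF : ∀ θ, MvPowerSeries.coeff n (F z θ) =
      MvPowerSeries.coeff n (F z 0) * character (totalCharge n) θ) (γ : Lat m) :
    MvPowerSeries.coeff n (fMode F γ z) =
      if γ = totalCharge n then MvPowerSeries.coeff n (F z 0) else 0 := by
  change fourierMode (fun θ => MvPowerSeries.coeff n (F z θ)) 0 γ = _
  rw [funext hF, fourierMode_mul_character]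

theorem coeff_fdθ {z : Cpx m} {n : S →₀ ℕ}
    (hW : ∀ θ, MvPowerSeries.coeff n (W z θ) =
      MvPowerSeries.coeff n (W z 0) * character (totalCharge n) θ) (a : Fin m) (θ : Cpx m) :
    MvPowerSeries.coeff n (fdθ a W z θ) =
      2 * Real.pi * I * totalCharge n a * MvPowerSeries.coeff n (W z 0) *
        character (totalCharge n) θ := by
  change pderiv a (fun θ => MvPowerSeries.coeff n (W z θ)) θ = _
  rw [funext hW, pderiv_mul_character]

theorem coeff_fdθ_zero {z : Cpx m} {n : S →₀ ℕ}
    (hW : ∀ θ, MvPowerSeries.coeff n (W z θ) =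
      MvPowerSeries.coeff n (W z 0) * character (totalCharge n) θ) (a : Fin m) :
    MvPowerSeries.coeff n (fdθ a W z 0) =
      2 * Real.pi * I * totalCharge n a * MvPowerSeries.coeff n (W z 0) := by
  rw [coeff_fdθ hW, character_zero, mul_one]

/-- A sum over the decompositions of `γ` in which each pair of exponents contributes at the pair of
its total charges is a sum over pairs of exponents. Decompositions have nonzero parts, so `T` has to
vanish at charge zero. -/
theorem finsum_decomp [DecidableEq (Lat m)] (n : S →₀ ℕ) (T : Lat m → Lat m → ℂ)
    (hT : ∀ γ, T γ 0 = 0) (hT' : ∀ γ, T 0 γ = 0) (f : (S →₀ ℕ) → ℂ) (γ : Lat m) :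
    ∑ᶠ p : Decomp γ, ∑ x ∈ Finset.HasAntidiagonal.antidiagonal n,
      (if p.1.1 = totalCharge x.1 ∧ p.1.2 = totalCharge x.2 then
        T (totalCharge x.1) (totalCharge x.2) * (f x.1 * f x.2) else 0) =
    if γ = totalCharge n then ∑ x ∈ Finset.HasAntidiagonal.antidiagonal n,
      T (totalCharge x.1) (totalCharge x.2) * (f x.1 * f x.2) else 0 := by
  have hsingle : ∀ (p p' : Decomp γ) (x : (S →₀ ℕ) × (S →₀ ℕ)),
      p.1.1 = totalCharge x.1 ∧ p.1.2 = totalCharge x.2 →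
      p'.1.1 = totalCharge x.1 ∧ p'.1.2 = totalCharge x.2 → p = p' := fun p p' x h h' =>
    Subtype.ext (Prod.ext (h.1.trans h'.1.symm) (h.2.trans h'.2.symm))
  rw [finsum_sum_comm]
  · split_ifs with hγ
    · refine Finset.sum_congr rfl fun x hx => ?_
      have hx' := Finset.HasAntidiagonal.mem_antidiagonal.1 hx
      by_cases h1 : totalCharge x.1 = 0
      · simp [h1, hT']
      by_cases h2 : totalCharge x.2 = 0
      · simp [h2, hT]
      rw [finsum_eq_single _ (⟨(totalCharge x.1, totalCharge x.2), h1, h2, by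
        rw [hγ, ← hx', totalCharge_add]⟩ : Decomp γ) fun p hp => if_neg fun h =>
          hp (hsingle _ _ x h ⟨rfl, rfl⟩)]
      exact if_pos ⟨rfl, rfl⟩
    · refine Finset.sum_eq_zero fun x hx => ?_
      have hx' := Finset.HasAntidiagonal.mem_antidiagonal.1 hx
      refine (finsum_congr fun p => if_neg fun h => hγ ?_).trans finsum_zero
      rw [← p.2.2.2, h.1, h.2, ← totalCharge_add, hx']
  · intro x _
    refine Set.Subsingleton.finite fun p hp p' hp' => ?_
    refine hsingle p p' x ?_ ?_
    · by_contra h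
      exact hp (if_neg h)
    · by_contra h
      exact hp' (if_neg h)

/-- The isomonodromy equation for formal power series whose coefficients are multiples of single
characters: it is the equation for the potentials at `θ = 0`, coefficient by coefficient. -/
theorem modeEq_of_fPotentialEq (hU : IsOpen U) (P : FPotentialEq ω U F W)
    (hFW : ∀ z ∈ U, ∀ θ, F z θ = ∑ a, MvPowerSeries.C (z a) * fdθ a W z θ)
    (hW : ∀ z ∈ U, ∀ θ n, MvPowerSeries.coeff n (W z θ) =
      MvPowerSeries.coeff n (W z 0) * character (totalCharge n) θ) :
    FHasFourierExpansion U F ∧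
      ∀ z ∈ U, (∀ γ : Lat m, γ ≠ 0 → lin γ z ≠ 0) → FModeEq ω (fMode F) z := by
  classical
  have hFn : ∀ z ∈ U, ∀ θ n, MvPowerSeries.coeff n (F z θ) =
      2 * Real.pi * I * lin (totalCharge n) z * MvPowerSeries.coeff n (W z 0) *
        character (totalCharge n) θ := by
    intro z hz θ n
    rw [hFW z hz θ, map_sum, lin, Finset.mul_sum, Finset.sum_mul, Finset.sum_mul]
    refine Finset.sum_congr rfl fun a _ => ?_
    rw [MvPowerSeries.coeff_C_mul, coeff_fdθ (fun θ => hW z hz θ n)]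
    ring
  have hF0 : ∀ z ∈ U, ∀ n, MvPowerSeries.coeff n (F z 0) =
      2 * Real.pi * I * lin (totalCharge n) z * MvPowerSeries.coeff n (W z 0) := fun z hz n => by
    rw [hFn z hz 0 n, character_zero, mul_one]
  have hF : ∀ z ∈ U, ∀ θ n, MvPowerSeries.coeff n (F z θ) =
      MvPowerSeries.coeff n (F z 0) * character (totalCharge n) θ := fun z hz θ n => by
    rw [hFn z hz θ n, hF0 z hz n]
  have hmode : ∀ z ∈ U, ∀ γ n, MvPowerSeries.coeff n (fMode F γ z) =
      if γ = totalCharge n then MvPowerSeries.coeff n (F z 0) else 0 := fun z hz γ n =>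
    coeff_fMode (fun θ => hF z hz θ n) γ
  refine ⟨fun z hz n => ?_, fun z hz hlin γ n => ?_⟩
  · by_cases h0 : totalCharge n = 0
    · -- the coefficients of charge zero vanish
      have hn : MvPowerSeries.coeff n (F z 0) = 0 := by
        rw [hF0 z hz n, h0, zero_lin, mul_zero, zero_mul]
      refine ⟨∅, Finset.notMem_empty _, fun γ _ => ?_, fun θ => ?_⟩
      · rw [hmode z hz, hn, ite_self]
      · rw [hF z hz θ n, hn, zero_mul, Finset.sum_empty]
    · refine ⟨{totalCharge n}, by simpa using Ne.symm h0, fun γ hγ => ?_, fun θ => ?_⟩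
      · rw [hmode z hz, if_neg (by simpa using hγ)]
      · rw [Finset.sum_singleton, hmode z hz, if_pos rfl, hF z hz θ n]
        rfl
  · -- the product of two modes, in terms of the coefficients of `F` at `θ = 0`
    have hprod : ∀ p : Decomp γ, MvPowerSeries.coeff n (fMode F p.1.1 z * fMode F p.1.2 z) =
        ∑ x ∈ Finset.HasAntidiagonal.antidiagonal n,
          if p.1.1 = totalCharge x.1 ∧ p.1.2 = totalCharge x.2 then
            MvPowerSeries.coeff x.1 (F z 0) * MvPowerSeries.coeff x.2 (F z 0) else 0 := by
      intro p
      rw [MvPowerSeries.coeff_mul]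
      refine Finset.sum_congr rfl fun x _ => ?_
      rw [hmode z hz, hmode z hz, ite_and]
      split_ifs <;> simp
    have heq : (fun w => MvPowerSeries.coeff n (fMode F γ w)) =ᶠ[𝓝 z]
        fun w => if γ = totalCharge n then MvPowerSeries.coeff n (F w 0) else 0 :=
      Filter.mem_of_superset (hU.mem_nhds hz) fun w hw => hmode w hw γ n
    have hdF : DifferentiableAt ℂ (fun w => MvPowerSeries.coeff n (F w 0)) z := by
      have h1 := (P.1 n).differentiableAt ((hU.prod isOpen_univ).mem_nhds
        (show (z, (0 : Cpx m)) ∈ U ×ˢ univ from ⟨hz, mem_univ _⟩))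
      exact h1.comp z (f := fun w => (w, (0 : Cpx m))) (by fun_prop)
    have hdiff : DifferentiableAt ℂ (fun w => MvPowerSeries.coeff n (fMode F γ w)) z := by
      refine DifferentiableAt.congr_of_eventuallyEq ?_ heq
      split_ifs
      · exact hdF
      · exact differentiableAt_const _
    refine ⟨hdiff, fun v => ⟨?_, ?_⟩⟩
    · refine ((Finset.HasAntidiagonal.antidiagonal n).image fun x =>
        (totalCharge x.1, totalCharge x.2)).finite_toSet.preimage
          Subtype.val_injective.injOn |>.subset fun p hp => ?_
      by_contra hp'
      refine hp ?_
      simp only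
      rw [hprod p, Finset.sum_eq_zero, mul_zero]
      intro x hx
      refine if_neg fun h => hp' ?_
      rw [mem_preimage, Finset.mem_coe, Finset.mem_image]
      exact ⟨x, hx, Prod.ext h.1.symm h.2.symm⟩
    · set T : Lat m → Lat m → ℂ := fun γ₁ γ₂ =>
        (pairing ω γ₁ γ₂ : ℂ) * (lin γ₂ v / lin γ₂ z) with hT
      have hterm : ∀ p : Decomp γ, (pairing ω p.1.1 p.1.2 : ℂ) *
          MvPowerSeries.coeff n (fMode F p.1.1 z * fMode F p.1.2 z) *
            (lin p.1.2 v / lin p.1.2 z) =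
          ∑ x ∈ Finset.HasAntidiagonal.antidiagonal n,
            if p.1.1 = totalCharge x.1 ∧ p.1.2 = totalCharge x.2 then
              T (totalCharge x.1) (totalCharge x.2) *
                (MvPowerSeries.coeff x.1 (F z 0) * MvPowerSeries.coeff x.2 (F z 0)) else 0 := by
        intro p
        rw [hprod p, Finset.mul_sum, Finset.sum_mul]
        refine Finset.sum_congr rfl fun x _ => ?_
        split_ifs with h
        · rw [hT, h.1, h.2]
          ring
        · simp
      have h1 := finsum_decomp n T (fun γ => by simp [hT, pairing])
        (fun γ => by simp [hT, pairing]) (fun k => MvPowerSeries.coeff k (F z 0)) γ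
      rw [finsum_congr hterm, heq.fderiv_eq]
      refine Eq.trans ?_ h1.symm
      split_ifs
      swap
      · simp
      rw [fderiv_apply_eq_sum]
      have hz' : ∀ e, pderiv e (fun w => MvPowerSeries.coeff n (F w 0)) z =
          ∑ x ∈ Finset.HasAntidiagonal.antidiagonal n,
            (pairing ω (totalCharge x.1) (totalCharge x.2) : ℂ) *
              (MvPowerSeries.coeff x.1 (F z 0) * (2 * Real.pi * I * totalCharge x.2 e *
                MvPowerSeries.coeff x.2 (W z 0))) := by
        intro e
        have h2 := congrArg (MvPowerSeries.coeff n) (P.2.2.2 z hz 0 e)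
        refine Eq.trans h2 ?_
        have hE : ∀ k, ∀ θ, MvPowerSeries.coeff k (fdθ e W z θ) =
            MvPowerSeries.coeff k (fdθ e W z 0) * character (totalCharge k) θ := fun k θ => by
          rw [coeff_fdθ (fun θ => hW z hz θ k), coeff_fdθ_zero (fun θ => hW z hz θ k)]
        have hpi : (2 * Real.pi * I : ℂ) ≠ 0 := by simp [Real.pi_ne_zero]
        rw [MvPowerSeries.coeff_C_mul]
        simp only [map_sum, mul_assoc, MvPowerSeries.coeff_C_mul]
        simp only [MvPowerSeries.coeff_mul, coeff_fdθ_zero (fun θ => hF z hz θ _),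
          coeff_fdθ_zero (hE _), coeff_fdθ_zero (fun θ => hW z hz θ _)]
        simp only [Finset.mul_sum]
        rw [Finset.sum_congr rfl fun a _ => Finset.sum_comm, Finset.sum_comm]
        refine Finset.sum_congr rfl fun x _ => ?_
        rw [pairing]
        push_cast
        simp only [Finset.sum_mul]
        refine Finset.sum_congr rfl fun a _ => Finset.sum_congr rfl fun b _ => ?_
        field_simp
      simp only [hz', Finset.mul_sum]
      rw [Finset.sum_comm]
      refine Finset.sum_congr rfl fun x _ => ?_
      by_cases h2 : totalCharge x.2 = 0
      · simp [hT, h2, pairing]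
      have h3 := hlin _ h2
      rw [hT, hF0 z hz x.2]
      have e : ∑ e, v e * ((pairing ω (totalCharge x.1) (totalCharge x.2) : ℂ) *
          (MvPowerSeries.coeff x.1 (F z 0) * (2 * Real.pi * I * totalCharge x.2 e *
            MvPowerSeries.coeff x.2 (W z 0)))) =
          (pairing ω (totalCharge x.1) (totalCharge x.2) : ℂ) * MvPowerSeries.coeff x.1 (F z 0) *
            (2 * Real.pi * I * MvPowerSeries.coeff x.2 (W z 0)) * lin (totalCharge x.2) v := by
        rw [lin, Finset.mul_sum]
        exact Finset.sum_congr rfl fun e _ => by ring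
      rw [e]
      field_simp

end Formal

end Joyce

end

theorem mainTheorem2 {m : ℕ} (ω : Matrix (Fin m) (Fin m) ℤ) (hω : ω.transpose = -ω)
    (σ : Joyce.Lat m → ℂ) (hσ : Joyce.IsQuadraticRefinement ω σ) :
    -- convergent solutions, rational invariants
    (∀ (Ω : Joyce.Lat m → ℤ) (D : Set (Joyce.Cpx m × Joyce.Cpx m)), IsOpen D →
      ∀ X : Joyce.Lat m → Joyce.Cpx m → Joyce.Cpx m → ℂ → ℂ,
      Joyce.IsConvergentSolution ω σ (Joyce.rationalDT Ω) id id D X →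
      Joyce.Isomonodromy ω (Joyce.rationalDT Ω) D X
        (Joyce.potF (Joyce.rationalDT Ω) id X)
        (Joyce.potW ω (Joyce.rationalDT Ω) id id X)) ∧
    -- convergent solutions, integer invariants
    (∀ (Ω : Joyce.Lat m → ℤ) (D : Set (Joyce.Cpx m × Joyce.Cpx m)), IsOpen D →
      ∀ X : Joyce.Lat m → Joyce.Cpx m → Joyce.Cpx m → ℂ → ℂ,
      (∀ p ∈ D, ∀ γ, Ω γ ≠ 0 → ∀ t ∈ Joyce.bpsRay (Joyce.lin γ p.1),
        1 - X γ p.1 p.2 t ∈ Complex.slitPlane) →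
      Joyce.IsConvergentSolution ω σ (fun γ => (Ω γ : ℂ)) Joyce.negLog Joyce.dilog D X →
      Joyce.Isomonodromy ω (fun γ => (Ω γ : ℂ)) D X
        (Joyce.potF (fun γ => (Ω γ : ℂ)) Joyce.negLog X)
        (Joyce.potW ω (fun γ => (Ω γ : ℂ)) Joyce.negLog Joyce.dilog X)) ∧
    -- formal solutions, as power series in the rational invariants
    (∀ (S : Set (Joyce.Lat m)) (U : Set (Joyce.Cpx m)), IsOpen U →
      (∀ z ∈ U, ∀ γ ∈ S, Joyce.lin γ z ≠ 0) →
      (∀ z ∈ U, ∀ γ ∈ S, ∀ γ' ∈ S, Joyce.pairing ω γ γ' ≠ 0 →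
        ¬ Joyce.Aligned (Joyce.lin γ z) (Joyce.lin γ' z)) →
      ∀ X : S → Joyce.Cpx m → Joyce.Cpx m → ℂ → MvPowerSeries S ℂ,
      Joyce.IsFormalSolution ω σ S U X →
      Joyce.FPotentialEq ω U (Joyce.fPotF S X) (Joyce.fPotW ω S X) ∧
      Joyce.FHasFourierExpansion U (Joyce.fPotF S X) ∧
      ∀ z ∈ U, (∀ γ : Joyce.Lat m, γ ≠ 0 → Joyce.lin γ z ≠ 0) →
        Joyce.FModeEq ω (Joyce.fMode (Joyce.fPotF S X)) z) := by
  refine ⟨fun Ω D hD X H => H.isomonodromy_id hω hσ.1 hD, fun Ω D hD X hX H =>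
    H.isomonodromy_negLog hω hσ.1 hD fun p hp γ hγ => hX p hp γ fun h0 => hγ (by simp [h0]), ?_⟩
  intro S U hU hZ hoff X H
  obtain ⟨h1, h2⟩ := H.potentialEq hω hσ.1 hU hZ hoff
  obtain ⟨h3, h4⟩ := Joyce.modeEq_of_fPotentialEq hU h1 h2 fun z hz θ n =>
    H.coeff_fPotW hz (fun i => hZ z hz i.1 i.2) θ n
  exact ⟨h1, h3, h4⟩
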